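/- **Setting.** Manifolds are smooth, finite dimensional, Hausdorff and second countable. Let $X=(X_1\rightrightarrows X_0)$ be a Lie groupoid with structure maps $s,t,u,i$ and composition $m(p,q)=p*q$ on $X_2=\{(p,q): s(p)=t(q)\}$, and write $1_x=u(x)$. A *Riemannian groupoid* $(X,\eta)$ is a Lie groupoid with a Riemannian metric $\eta^{(2)}$ on $X_2$ that is invariant under the $S_3$-action permuting the vertices of the commutative triangles $(p,q)$ and transverse to $m$; it induces the push-forward metrics $\eta^{(1)}=m_*\eta^{(2)}$ on $X_1$ and $\eta^{(0)}=s_*\eta^{(1)}$ on $X_0$. A *Lie 2-group* $G_1\rightrightarrows G_0$ is a Lie groupoid whose spaces are Lie groups and whose structure maps are homomorphisms. A *right 2-action* $\theta$ of it on $X$ is a Lie groupoid morphism $X\times (G_1\rightrightarrows G_0)\to X$ whose components on arrows and on objects are smooth right actions; it is *isometric* if the induced action of $G_2$ on $(X_2,\eta^{(2)})$ is by isometries. A *crossed module of groups* $(G,H,\rho,\alpha)$ is a homomorphism $\rho:H\to G$ with an action $\alpha$ of $G$ on $H$ by automorphisms such that $\rho(\alpha_g h)=g\rho(h)g^{-1}$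 and $\alpha_{\rho(h)}h'=hh'h^{-1}$. Its *opposite* is $(G^{op},H^{op},\rho,\ g\mapsto\alpha_{g^{-1}})$; it is isomorphic to $(G,H,\rho,\alpha)$ by inversion. A *crossed module of Lie algebras* $(\mathfrak g,\mathfrak h,\partial,\mathcal L)$ is a pair of Lie algebra homomorphisms $\partial:\mathfrak h\to\mathfrak g$, $\mathcal L:\mathfrak g\to\mathrm{Der}(\mathfrak h)$ with $\partial(\mathcal L_xy)=[x,\partial y]$ and $\mathcal L_{\partial y}y'=[y,y']$. Morphisms are pairs of homomorphisms compatible with all structure maps. * To $G_1\rightrightarrows G_0$ belong the crossed module of Lie groups $(G,H,\rho,\alpha)$ with $G=G_0$, $H=\ker(s)$, $\rho=t|_H$, $\alpha_g(h)=1_g h 1_g^{-1}$, and the crossed module of Lie algebras $(\mathfrak g,\mathfrak h,\partial,\mathcal L)$ with $\mathfrak g=\mathrm{Lie}(G_0)$, $\mathfrak h=\ker(ds)\subseteq \mathrm{Lie}(G_1)$, $\partial=dt|_{\mathfrak h}$, $\mathcal L_\zeta=[1_\zeta,\cdot\,]$, where $1_\zeta=du(\zeta)$. * $\mathrm{Bis}_\eta(X)$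 is the group of bisections $\sigma$ (smooth maps $\sigma:X_0\to X_1$ with $s\sigma=\mathrm{id}$ and $\iota_\sigma=t\sigma$ a diffeomorphism) for which $\iota_\sigma$ is an isometry of $(X_0,\eta^{(0)})$, with product $(\sigma\bullet\sigma')(x)=\sigma(t\sigma'(x))*\sigma'(x)$. $\mathrm{Iso}(X,\eta)$ is the group (under composition) of Lie groupoid automorphisms $(\Phi,\phi)$ of $X$ with $\phi$ an isometry of $(X_0,\eta^{(0)})$. With $I_\sigma(p)=\sigma(t(p))*p*\sigma(s(p))^{-1}$ and $\alpha_\Phi(\sigma)=\Phi\circ\sigma\circ\phi^{-1}$ they form the crossed module of strong isometries $(\mathrm{Iso}(X,\eta),\mathrm{Bis}_\eta(X),I,\alpha)$. * $\mathfrak o_m(X)$ is the set of multiplicative vector fields $(\xi,v)$ on $X$ (pairs of smooth vector fields forming a groupoid morphism $X\to TX$) with $v$ a Killing vector field of $(X_0,\eta^{(0)})$. $\Gamma_\eta(A_X)$ is the set of smooth sections $a$ of $A_X=\ker(ds)|_{X_0}$ for which $dt\circ a$ is a Killing vector field of $(X_0,\eta^{(0)})$. With $a^r(p)=dR_p(a_{t(p)})$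 and $a^l(p)=-dL_p(di(a_{s(p)}))$, the bracket on $\mathfrak o_m(X)$ is the componentwise bracket of vector fields, $[a,b]=[a^r,b^r]|_{X_0}$, $\delta(a)=(a^r-a^l,\ dt\circ a)$ and $D_{(\xi,v)}a=[\xi,a^r]|_{X_0}$. **Corollary.** Let $\theta$ be an isometric right 2-action of a Lie 2-group $G_1\rightrightarrows G_0$ on a Riemannian groupoid $(X,\eta)$. 1. The assignments $\sigma_h(x)=1_xh$ and $\Sigma_g(p)=p1_g$ (for $h\in H$, $g\in G$, $x\in X_0$, $p\in X_1$) define a morphism of crossed modules of Lie groups $$(\sigma,\Sigma):(G,H,\rho,\alpha)\longrightarrow(\mathrm{Iso}(X,\eta),\mathrm{Bis}_\eta(X),I,\alpha)^{op},$$ the opposite being due to the fact that $G_1\rightrightarrows G_0$ acts from the right. Equivalently, $h\mapsto\sigma_{h^{-1}}$ and $g\mapsto\Sigma_{g^{-1}}$ define a morphism of crossed modules of Lie groups $(G,H,\rho,\alpha)\to(\mathrm{Iso}(X,\eta),\mathrm{Bis}_\eta(X),I,\alpha)$. Here smoothness means that the evaluation maps $(g,p)\mapsto\Sigma_g(p)$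 on $G\times X_1$ (together with the covered maps on $G\times X_0$) and $(h,x)\mapsto\sigma_h(x)$ on $H\times X_0$ are smooth. 2. $(\mathfrak g,\mathfrak h,\partial,\mathcal L)$ and $(\mathfrak o_m(X),\Gamma_\eta(A_X),\delta,D)$ are crossed modules of Lie algebras, and $$j_{-1}(\xi)=\tilde\xi|_{X_0}\quad(\xi\in\mathfrak h),\qquad j_0(\zeta)=(\widetilde{1_\zeta},\tilde\zeta)\quad(\zeta\in\mathfrak g)$$ define a morphism of crossed modules of Lie algebras $(\mathfrak g,\mathfrak h,\partial,\mathcal L)\to(\mathfrak o_m(X),\Gamma_\eta(A_X),\delta,D)$, where $\tilde{\ }$ denotes the fundamental vector field of the action of $G_1$ on $X_1$, respectively of $G_0$ on $X_0$. -/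

import Mathlib

open scoped Manifold ContDiff
open Bundle VectorField

noncomputable section

/-! ### Crossed modules of groups -/

/-- A crossed module of groups `(G, H, map, action)`. -/
structure CrossedModule (G H : Type*) [Group G] [Group H] where
  map : H →* G
  action : G →* MulAut H
  map_action : ∀ g h, map (action g h) = g * map h * g⁻¹
  peiffer : ∀ h h', action (map h) h' = h * h' * h⁻¹

namespace CrossedModule

/-- Morphisms of crossed modules. -/
structure Hom {G H G' H' : Type*} [Group G] [Group H] [Group G'] [Group H']
    (C : CrossedModule G H) (C' : CrossedModule G' H') where
  onG : G →* G'
  onH : H →* H'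
  comm : ∀ h, onG (C.map h) = C'.map (onH h)
  equivariant : ∀ g h, onH (C.action g h) = C'.action (onG g) (onH h)

/-- The opposite crossed module: both groups carry the opposite multiplication and `g` acts by
the old action of `g⁻¹`. Inversion identifies it with the original crossed module. -/
def op {G H : Type*} [Group G] [Group H] (C : CrossedModule G H) :
    CrossedModule Gᵐᵒᵖ Hᵐᵒᵖ where
  map := MonoidHom.op C.map
  action :=
    { toFun := fun g =>
        { toFun := fun h => MulOpposite.op (C.action g.unop⁻¹ h.unop)
          invFun := fun h => MulOpposite.op (C.action g.unop h.unop)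
          left_inv := fun h => by simp
          right_inv := fun h => by simp
          map_mul' := fun h h' => by simp }
      map_one' := by ext h; simp
      map_mul' := fun g g' => by ext h; simp }
  map_action := fun g h => by
    apply MulOpposite.unop_injective
    change C.map (C.action g.unop⁻¹ h.unop) = (g.unop)⁻¹ * (C.map h.unop * g.unop)
    rw [C.map_action, inv_inv, mul_assoc]
  peiffer := fun h h' => by
    apply MulOpposite.unop_injective
    change C.action (C.map h.unop)⁻¹ h'.unop = (h.unop)⁻¹ * (h'.unop * h.unop)
    rw [← map_inv, C.peiffer, inv_inv, mul_assoc]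

/-- The sub-crossed module on subgroups that are stable under the structure maps. -/
def restrict {G H : Type*} [Group G] [Group H] (C : CrossedModule G H)
    (K : Subgroup G) (L : Subgroup H) (hmap : ∀ h ∈ L, C.map h ∈ K)
    (haction : ∀ g ∈ K, ∀ h ∈ L, C.action g h ∈ L) : CrossedModule K L where
  map := (C.map.comp L.subtype).codRestrict K (fun h => hmap h h.2)
  action :=
    { toFun := fun g =>
        { toFun := fun h => ⟨C.action g h, haction g g.2 h h.2⟩
          invFun := fun h => ⟨C.action (g : G)⁻¹ h, haction _ (K.inv_mem g.2) h h.2⟩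
          left_inv := fun h => by simp
          right_inv := fun h => by simp
          map_mul' := fun h h' => by simp }
      map_one' := by ext h; simp
      map_mul' := fun g g' => by ext h; simp }
  map_action := fun g h => Subtype.ext (C.map_action g h)
  peiffer := fun h h' => Subtype.ext (C.peiffer h h')

end CrossedModule

/-! ### Lie groupoids -/

/-- The set of composable pairs of arrows, with the subspace topology of `X₁ × X₁`. -/
abbrev ComposablePairs {X₀ X₁ : Type*} (s t : X₁ → X₀) := {pq : X₁ × X₁ // s pq.1 = t pq.2}

/-- Lie groupoids `X₁ ⇉ X₀`. The set `X₂` of composable pairs is equipped with its structure of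
embedded submanifold of `X₁ × X₁`, which is determined by `embedding₂`. The surjectivity of `s`
and `t` follows from `s_u` and `t_u`. -/
structure LieGroupoid (n₀ n₁ : ℕ) (X₀ X₁ : Type*)
    [TopologicalSpace X₀] [ChartedSpace (EuclideanSpace ℝ (Fin n₀)) X₀] [IsManifold (𝓡 n₀) ∞ X₀]
    [TopologicalSpace X₁] [ChartedSpace (EuclideanSpace ℝ (Fin n₁)) X₁] [IsManifold (𝓡 n₁) ∞ X₁]
    where
  s : X₁ → X₀
  t : X₁ → X₀
  s_submersion : Manifold.IsSubmersion (𝓡 n₁) (𝓡 n₀) ∞ s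
  t_submersion : Manifold.IsSubmersion (𝓡 n₁) (𝓡 n₀) ∞ t
  n₂ : ℕ
  charted₂ : ChartedSpace (EuclideanSpace ℝ (Fin n₂)) (ComposablePairs s t)
  manifold₂ : IsManifold (𝓡 n₂) ∞ (ComposablePairs s t)
  embedding₂ : Manifold.IsSmoothEmbedding (𝓡 n₂) ((𝓡 n₁).prod (𝓡 n₁)) ∞
    (Subtype.val : ComposablePairs s t → X₁ × X₁)
  m : ComposablePairs s t → X₁
  u : X₀ → X₁
  i : X₁ → X₁
  m_smooth : ContMDiff (𝓡 n₂) (𝓡 n₁) ∞ m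
  u_smooth : ContMDiff (𝓡 n₀) (𝓡 n₁) ∞ u
  i_smooth : ContMDiff (𝓡 n₁) (𝓡 n₁) ∞ i
  s_m : ∀ z, s (m z) = s z.1.2
  t_m : ∀ z, t (m z) = t z.1.1
  m_assoc : ∀ p q r (h : s p = t q) (h' : s q = t r),
    m ⟨(m ⟨(p, q), h⟩, r), (s_m _).trans h'⟩ = m ⟨(p, m ⟨(q, r), h'⟩),
      h.trans (t_m ⟨(q, r), h'⟩).symm⟩
  s_u : ∀ x, s (u x) = x
  t_u : ∀ x, t (u x) = x
  u_m : ∀ p, m ⟨(u (t p), p), s_u _⟩ = p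
  m_u : ∀ p, m ⟨(p, u (s p)), (t_u _).symm⟩ = p
  s_i : ∀ p, s (i p) = t p
  t_i : ∀ p, t (i p) = s p
  m_i : ∀ p, m ⟨(p, i p), (t_i p).symm⟩ = u (t p)
  i_m : ∀ p, m ⟨(i p, p), s_i p⟩ = u (s p)

attribute [instance] LieGroupoid.charted₂ LieGroupoid.manifold₂

namespace LieGroupoid

variable {n₀ n₁ : ℕ} {X₀ X₁ : Type*}
  [TopologicalSpace X₀] [ChartedSpace (EuclideanSpace ℝ (Fin n₀)) X₀] [IsManifold (𝓡 n₀) ∞ X₀]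
  [TopologicalSpace X₁] [ChartedSpace (EuclideanSpace ℝ (Fin n₁)) X₁] [IsManifold (𝓡 n₁) ∞ X₁]
  (X : LieGroupoid n₀ n₁ X₀ X₁)

/-- The manifold `X₂` of composable pairs. -/
abbrev Comp := ComposablePairs X.s X.t

lemma s_smooth : ContMDiff (𝓡 n₁) (𝓡 n₀) ∞ X.s := X.s_submersion.contMDiff

lemma t_smooth : ContMDiff (𝓡 n₁) (𝓡 n₀) ∞ X.t := X.t_submersion.contMDiff

lemma comp_left {p q r : X₁} (h : X.s p = X.t q) (h' : X.s q = X.t r) :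
    X.s p = X.t (X.m ⟨(q, r), h'⟩) := h.trans (X.t_m ⟨(q, r), h'⟩).symm

lemma m_congr {p q p' q' : X₁} {h : X.s p = X.t q} {h' : X.s p' = X.t q'}
    (hp : p = p') (hq : q = q') : X.m ⟨(p, q), h⟩ = X.m ⟨(p', q'), h'⟩ := by
  subst hp; subst hq; rfl

/-- The product of two smooth composable families of arrows is smooth. -/
lemma m_comp_smooth {E H N : Type*} [NormedAddCommGroup E] [NormedSpace ℝ E] [TopologicalSpace H]
    {I : ModelWithCorners ℝ E H} [TopologicalSpace N] [ChartedSpace H N] {f g : N → X₁}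
    (hf : ContMDiff I (𝓡 n₁) ∞ f) (hg : ContMDiff I (𝓡 n₁) ∞ g)
    (h : ∀ x, X.s (f x) = X.t (g x)) :
    ContMDiff I (𝓡 n₁) ∞ (fun x => X.m ⟨(f x, g x), h x⟩) := by
  have hfg : ContMDiff I (𝓡 X.n₂) ∞ (fun x => (⟨(f x, g x), h x⟩ : X.Comp)) := by
    rw [ContMDiff.iff_comp_isImmersion X.embedding₂.isImmersion]
    exact ⟨(hf.continuous.prodMk hg.continuous).subtype_mk _, hf.prodMk hg⟩
  exact X.m_smooth.comp hfg

lemma m_left_cancel {p q q' : X₁} {h : X.s p = X.t q} {h' : X.s p = X.t q'}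
    (e : X.m ⟨(p, q), h⟩ = X.m ⟨(p, q'), h'⟩) : q = q' := by
  have key : ∀ r (k : X.s p = X.t r),
      X.m ⟨(X.i p, X.m ⟨(p, r), k⟩), X.comp_left (X.s_i p) k⟩ = r := fun r k => by
    rw [← X.m_assoc _ _ _ (X.s_i p) k]
    exact (X.m_congr (h' := X.s_u _) ((X.i_m p).trans (by rw [k])) rfl).trans (X.u_m r)
  rw [← key q h, ← key q' h']
  exact X.m_congr rfl e

lemma i_u (x : X₀) : X.i (X.u x) = X.u x := by
  apply X.m_left_cancel (p := X.u x) (h := (X.t_i _).symm)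
    (h' := (X.s_u x).trans (X.t_u x).symm)
  rw [X.m_i]
  refine (congrArg X.u (X.t_u x)).trans ?_
  exact ((X.m_congr (h' := (X.t_u _).symm) rfl (by rw [X.s_u])).trans (X.m_u (X.u x))).symm

lemma i_mul (p q : X₁) (h : X.s p = X.t q) :
    X.i (X.m ⟨(p, q), h⟩)
      = X.m ⟨(X.i q, X.i p), (X.s_i q).trans (h.symm.trans (X.t_i p).symm)⟩ := by
  have h1 : X.s q = X.t (X.m ⟨(X.i q, X.i p), (X.s_i q).trans (h.symm.trans (X.t_i p).symm)⟩) := by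
    rw [X.t_m, X.t_i]
  apply X.m_left_cancel (p := X.m ⟨(p, q), h⟩) (h := (X.t_i _).symm)
    (h' := (X.s_m _).trans h1)
  rw [X.m_i, X.t_m, X.m_assoc p q _ h h1]
  have h2 : X.m ⟨(q, X.m ⟨(X.i q, X.i p), (X.s_i q).trans (h.symm.trans (X.t_i p).symm)⟩), h1⟩
      = X.i p := by
    rw [← X.m_assoc q (X.i q) (X.i p) (X.t_i q).symm]
    exact (X.m_congr (h' := X.s_u _) ((X.m_i q).trans (by rw [← h, X.t_i])) rfl).trans
      (X.u_m (X.i p))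
  exact ((X.m_congr (h' := (X.t_i p).symm) rfl h2).trans (X.m_i p)).symm

/-! ### Bisections and automorphisms -/

/-- Bisections: smooth sections `σ` of `s` for which `t ∘ σ` is a diffeomorphism (recorded as
`base`, which is determined by `σ`). -/
structure Bisection where
  toFun : X₀ → X₁
  smooth : ContMDiff (𝓡 n₀) (𝓡 n₁) ∞ toFun
  base : X₀ ≃ₘ^∞⟮𝓡 n₀, 𝓡 n₀⟯ X₀
  s_toFun : ∀ x, X.s (toFun x) = x
  t_toFun : ∀ x, X.t (toFun x) = base x

/-- Automorphisms of a Lie groupoid. -/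
structure Aut where
  arrows : X₁ ≃ₘ^∞⟮𝓡 n₁, 𝓡 n₁⟯ X₁
  objects : X₀ ≃ₘ^∞⟮𝓡 n₀, 𝓡 n₀⟯ X₀
  s_arrows : ∀ p, X.s (arrows p) = objects (X.s p)
  t_arrows : ∀ p, X.t (arrows p) = objects (X.t p)
  m_arrows : ∀ z : X.Comp, arrows (X.m z) = X.m ⟨(arrows z.1.1, arrows z.1.2),
    (s_arrows _).trans ((congrArg objects z.2).trans (t_arrows _).symm)⟩

variable {X}

namespace Bisection

@[ext]
lemma ext {σ τ : X.Bisection} (h : ∀ x, σ.toFun x = τ.toFun x) : σ = τ := by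
  have hb : σ.base = τ.base := by
    apply Diffeomorph.ext
    intro x
    rw [← σ.t_toFun, ← τ.t_toFun, h]
  cases σ; cases τ
  obtain rfl : _ = _ := funext h
  cases hb
  rfl

/-- `(σ • τ)(x) = σ(t(τ(x))) * τ(x)`. -/
instance : Mul X.Bisection where
  mul σ τ :=
    { toFun := fun x => X.m ⟨(σ.toFun (X.t (τ.toFun x)), τ.toFun x), σ.s_toFun _⟩
      smooth := X.m_comp_smooth (σ.smooth.comp (X.t_smooth.comp τ.smooth)) τ.smooth _
      base := τ.base.trans σ.base
      s_toFun := fun x => by rw [X.s_m, τ.s_toFun]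
      t_toFun := fun x => by rw [X.t_m, σ.t_toFun, τ.t_toFun]; rfl }

instance : One X.Bisection where
  one :=
    { toFun := X.u
      smooth := X.u_smooth
      base := Diffeomorph.refl _ _ _
      s_toFun := X.s_u
      t_toFun := X.t_u }

instance : Inv X.Bisection where
  inv σ :=
    { toFun := fun x => X.i (σ.toFun (σ.base.symm x))
      smooth := X.i_smooth.comp (σ.smooth.comp σ.base.symm.contMDiff)
      base := σ.base.symm
      s_toFun := fun x => by rw [X.s_i, σ.t_toFun, Diffeomorph.apply_symm_apply]
      t_toFun := fun x => by rw [X.t_i, σ.s_toFun] }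

lemma mul_apply (σ τ : X.Bisection) (x : X₀) :
    (σ * τ).toFun x = X.m ⟨(σ.toFun (X.t (τ.toFun x)), τ.toFun x), σ.s_toFun _⟩ := rfl

lemma one_apply (x : X₀) : (1 : X.Bisection).toFun x = X.u x := rfl

lemma inv_apply (σ : X.Bisection) (x : X₀) :
    (σ⁻¹).toFun x = X.i (σ.toFun (σ.base.symm x)) := rfl

instance : Group X.Bisection :=
  Group.ofLeftAxioms
    (fun σ τ κ => by
      ext x
      simp only [mul_apply]
      rw [X.m_assoc _ _ _ (σ.s_toFun _) (τ.s_toFun _)]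
      exact X.m_congr (by rw [X.t_m]) rfl)
    (fun σ => by
      ext x
      simp only [mul_apply, one_apply]
      exact X.u_m _)
    (fun σ => by
      ext x
      simp only [mul_apply, one_apply, inv_apply]
      refine (X.m_congr (h' := X.s_i _) ?_ rfl).trans ((X.i_m (σ.toFun x)).trans ?_)
      · rw [σ.t_toFun, Diffeomorph.symm_apply_apply]
      · rw [σ.s_toFun])

lemma base_mul (σ τ : X.Bisection) (x : X₀) : (σ * τ).base x = σ.base (τ.base x) := rfl

lemma base_inv (σ : X.Bisection) : (σ⁻¹).base = σ.base.symm := rfl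

end Bisection

namespace Aut

@[ext]
lemma ext {Φ Ψ : X.Aut} (h : ∀ p, Φ.arrows p = Ψ.arrows p) : Φ = Ψ := by
  have ha : Φ.arrows = Ψ.arrows := Diffeomorph.ext h
  have hb : Φ.objects = Ψ.objects := by
    apply Diffeomorph.ext
    intro x
    have := Φ.s_arrows (X.u x)
    rw [X.s_u] at this
    rw [← this, h, Ψ.s_arrows, X.s_u]
  cases Φ; cases Ψ
  cases ha; cases hb
  rfl

instance : Mul X.Aut where
  mul Φ Ψ :=
    { arrows := Ψ.arrows.trans Φ.arrows
      objects := Ψ.objects.trans Φ.objects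
      s_arrows := fun p => by simp [Φ.s_arrows, Ψ.s_arrows]
      t_arrows := fun p => by simp [Φ.t_arrows, Ψ.t_arrows]
      m_arrows := fun z => by
        simp only [Diffeomorph.coe_trans, Function.comp_apply]
        rw [Ψ.m_arrows, Φ.m_arrows] }

instance : One X.Aut where
  one :=
    { arrows := Diffeomorph.refl _ _ _
      objects := Diffeomorph.refl _ _ _
      s_arrows := fun _ => rfl
      t_arrows := fun _ => rfl
      m_arrows := fun _ => rfl }

instance : Inv X.Aut where
  inv Φ :=
    { arrows := Φ.arrows.symm
      objects := Φ.objects.symm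
      s_arrows := fun p => by
        rw [← Φ.objects.symm_apply_apply (X.s (Φ.arrows.symm p)), ← Φ.s_arrows,
          Φ.arrows.apply_symm_apply]
      t_arrows := fun p => by
        rw [← Φ.objects.symm_apply_apply (X.t (Φ.arrows.symm p)), ← Φ.t_arrows,
          Φ.arrows.apply_symm_apply]
      m_arrows := fun z => by
        apply Φ.arrows.injective
        refine (Φ.arrows.apply_symm_apply _).trans (Eq.trans ?_ (Φ.m_arrows _).symm)
        exact (X.m_congr (h' := z.2) (Φ.arrows.apply_symm_apply _)
          (Φ.arrows.apply_symm_apply _)).symm }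

lemma mul_apply (Φ Ψ : X.Aut) (p : X₁) : (Φ * Ψ).arrows p = Φ.arrows (Ψ.arrows p) := rfl

lemma one_apply (p : X₁) : (1 : X.Aut).arrows p = p := rfl

lemma inv_apply (Φ : X.Aut) (p : X₁) : (Φ⁻¹).arrows p = Φ.arrows.symm p := rfl

instance : Group X.Aut :=
  Group.ofLeftAxioms (fun _ _ _ => rfl) (fun _ => rfl)
    (fun Φ => by ext p; rw [mul_apply, inv_apply, Φ.arrows.symm_apply_apply, one_apply])

lemma objects_mul (Φ Ψ : X.Aut) (x : X₀) : (Φ * Ψ).objects x = Φ.objects (Ψ.objects x) := rfl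

lemma objects_inv (Φ : X.Aut) : (Φ⁻¹).objects = Φ.objects.symm := rfl

lemma arrows_u (Φ : X.Aut) (x : X₀) : Φ.arrows (X.u x) = X.u (Φ.objects x) := by
  have h0 : X.s (X.u x) = X.t (X.u x) := by rw [X.s_u, X.t_u]
  have h1 : X.s (Φ.arrows (X.u x)) = X.t (Φ.arrows (X.u x)) := by
    rw [Φ.s_arrows, Φ.t_arrows, h0]
  have h2 : X.s (Φ.arrows (X.u x)) = X.t (X.u (Φ.objects x)) := by
    rw [Φ.s_arrows, X.s_u, X.t_u]
  apply X.m_left_cancel (p := Φ.arrows (X.u x)) (h := h1) (h' := h2)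
  have e1 := Φ.m_arrows ⟨(X.u x, X.u x), h0⟩
  have e2 : X.m ⟨(X.u x, X.u x), h0⟩ = X.u x :=
    (X.m_congr (h' := (X.t_u _).symm) rfl (by rw [X.s_u])).trans (X.m_u (X.u x))
  rw [e2] at e1
  rw [← e1]
  refine ((X.m_congr (h' := (X.t_u _).symm) rfl ?_).trans (X.m_u _)).symm
  rw [Φ.s_arrows, X.s_u]

lemma arrows_i (Φ : X.Aut) (p : X₁) : Φ.arrows (X.i p) = X.i (Φ.arrows p) := by
  have h1 : X.s (Φ.arrows p) = X.t (Φ.arrows (X.i p)) := by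
    rw [Φ.s_arrows, Φ.t_arrows, X.t_i]
  apply X.m_left_cancel (p := Φ.arrows p) (h := h1) (h' := (X.t_i _).symm)
  have e1 := Φ.m_arrows ⟨(p, X.i p), (X.t_i p).symm⟩
  rw [X.m_i, Φ.arrows_u] at e1
  rw [X.m_i, Φ.t_arrows, ← e1.symm]

end Aut

/-- The function `p ↦ σ(t p) * p * σ(s p)⁻¹`. -/
def innerFun (σ : X.Bisection) (p : X₁) : X₁ :=
  X.m ⟨(X.m ⟨(σ.toFun (X.t p), p), σ.s_toFun _⟩, X.i (σ.toFun (X.s p))),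
    (X.s_m _).trans ((σ.s_toFun _).symm.trans (X.t_i _).symm)⟩

lemma s_innerFun (σ : X.Bisection) (p : X₁) : X.s (innerFun σ p) = σ.base (X.s p) := by
  rw [innerFun, X.s_m, X.s_i, σ.t_toFun]

lemma t_innerFun (σ : X.Bisection) (p : X₁) : X.t (innerFun σ p) = σ.base (X.t p) := by
  rw [innerFun, X.t_m, X.t_m, σ.t_toFun]

lemma innerFun_smooth (σ : X.Bisection) : ContMDiff (𝓡 n₁) (𝓡 n₁) ∞ (innerFun σ) :=
  X.m_comp_smooth (X.m_comp_smooth (σ.smooth.comp X.t_smooth) contMDiff_id _)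
    (X.i_smooth.comp (σ.smooth.comp X.s_smooth)) _

/-- The defining equation `I_σ(p) * σ(s p) = σ(t p) * p`. -/
lemma innerFun_spec (σ : X.Bisection) (p : X₁) :
    X.m ⟨(innerFun σ p, σ.toFun (X.s p)), (s_innerFun σ p).trans (σ.t_toFun _).symm⟩
      = X.m ⟨(σ.toFun (X.t p), p), σ.s_toFun _⟩ := by
  simp only [innerFun]
  rw [X.m_assoc _ _ _ _ (X.s_i _)]
  refine (X.m_congr (h' := (X.t_u _).symm) rfl ?_).trans (X.m_u _)
  rw [X.i_m, X.s_m, σ.s_toFun]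

lemma m_right_cancel {p p' q : X₁} {h : X.s p = X.t q} {h' : X.s p' = X.t q}
    (e : X.m ⟨(p, q), h⟩ = X.m ⟨(p', q), h'⟩) : p = p' := by
  have key : ∀ r (k : X.s r = X.t q),
      X.m ⟨(X.m ⟨(r, q), k⟩, X.i q), (X.s_m _).trans (X.t_i q).symm⟩ = r := fun r k => by
    rw [X.m_assoc _ _ _ k (X.t_i q).symm]
    exact (X.m_congr (h' := (X.t_u _).symm) rfl ((X.m_i q).trans (by rw [k]))).trans (X.m_u r)
  rw [← key p h, ← key p' h']
  exact X.m_congr e rfl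

lemma innerFun_unique (σ : X.Bisection) (p r : X₁) (h : X.s r = X.t (σ.toFun (X.s p)))
    (e : X.m ⟨(r, σ.toFun (X.s p)), h⟩ = X.m ⟨(σ.toFun (X.t p), p), σ.s_toFun _⟩) :
    r = innerFun σ p :=
  X.m_right_cancel (e.trans (innerFun_spec σ p).symm)

lemma innerFun_mul (σ τ : X.Bisection) (p : X₁) :
    innerFun (σ * τ) p = innerFun σ (innerFun τ p) := by
  symm
  have hs : X.s (innerFun σ (innerFun τ p)) = X.t ((σ * τ).toFun (X.s p)) := by
    rw [s_innerFun, s_innerFun, (σ * τ).t_toFun, Bisection.base_mul]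
  apply innerFun_unique _ _ _ hs
  have hb : X.s (innerFun τ p) = X.t (τ.toFun (X.s p)) := by rw [s_innerFun, τ.t_toFun]
  have hb' : X.t (innerFun τ p) = X.t (τ.toFun (X.t p)) := by rw [t_innerFun, τ.t_toFun]
  have h1 := innerFun_spec σ (innerFun τ p)
  have h2 := innerFun_spec τ p
  have hc : X.s (innerFun σ (innerFun τ p)) = X.t (σ.toFun (X.s (innerFun τ p))) := by
    rw [s_innerFun, σ.t_toFun]
  have hd : X.s (σ.toFun (X.s (innerFun τ p))) = X.t (τ.toFun (X.s p)) := by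
    rw [σ.s_toFun, hb]
  calc X.m ⟨(innerFun σ (innerFun τ p), (σ * τ).toFun (X.s p)), hs⟩
      = X.m ⟨(innerFun σ (innerFun τ p), X.m ⟨(σ.toFun (X.s (innerFun τ p)), τ.toFun (X.s p)),
          hd⟩), X.comp_left hc hd⟩ := X.m_congr rfl (X.m_congr (by rw [hb]) rfl)
    _ = X.m ⟨(X.m ⟨(σ.toFun (X.t (innerFun τ p)), innerFun τ p), σ.s_toFun _⟩, τ.toFun (X.s p)),
          (X.s_m _).trans hb⟩ := by
        rw [← X.m_assoc _ _ _ hc hd]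
        exact X.m_congr h1 rfl
    _ = X.m ⟨(σ.toFun (X.t (innerFun τ p)), X.m ⟨(τ.toFun (X.t p), p), τ.s_toFun _⟩),
          X.comp_left ((σ.s_toFun _).trans hb') (τ.s_toFun _)⟩ := by
        rw [X.m_assoc _ _ _ (σ.s_toFun _) hb]
        exact X.m_congr rfl h2
    _ = X.m ⟨((σ * τ).toFun (X.t p), p), (σ * τ).s_toFun _⟩ := by
        rw [← X.m_assoc _ _ _ ((σ.s_toFun _).trans hb') (τ.s_toFun _)]
        exact X.m_congr (X.m_congr (by rw [hb']) rfl) rfl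

lemma innerFun_one (p : X₁) : innerFun (1 : X.Bisection) p = p := by
  symm
  have h : X.s p = X.t ((1 : X.Bisection).toFun (X.s p)) := by
    rw [Bisection.one_apply, X.t_u]
  apply innerFun_unique _ _ _ h
  exact (X.m_u p).trans (X.u_m p).symm

/-- The inner automorphism `I_σ(p) = σ(t p) * p * σ(s p)⁻¹`. -/
def innerAut (σ : X.Bisection) : X.Aut where
  arrows :=
    { toFun := innerFun σ
      invFun := innerFun σ⁻¹
      left_inv := fun p => by rw [← innerFun_mul, inv_mul_cancel, innerFun_one]
      right_inv := fun p => by rw [← innerFun_mul, mul_inv_cancel, innerFun_one]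
      contMDiff_toFun := innerFun_smooth σ
      contMDiff_invFun := innerFun_smooth σ⁻¹ }
  objects := σ.base
  s_arrows := s_innerFun σ
  t_arrows := t_innerFun σ
  m_arrows := fun z => by
    obtain ⟨⟨p, q⟩, hz⟩ := z
    change X.s p = X.t q at hz
    have hpq : X.s (innerFun σ p) = X.t (innerFun σ q) := by
      rw [s_innerFun, t_innerFun, hz]
    change innerFun σ (X.m ⟨(p, q), hz⟩) = X.m ⟨(innerFun σ p, innerFun σ q), hpq⟩
    symm
    have hq : X.s (innerFun σ q) = X.t (σ.toFun (X.s q)) := by rw [s_innerFun, σ.t_toFun]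
    have hp : X.s (innerFun σ p) = X.t (σ.toFun (X.s p)) := by rw [s_innerFun, σ.t_toFun]
    have hm : X.s (σ.toFun (X.s p)) = X.t q := (σ.s_toFun _).trans hz
    have h : X.s (X.m ⟨(innerFun σ p, innerFun σ q), hpq⟩)
        = X.t (σ.toFun (X.s (X.m ⟨(p, q), hz⟩))) := by
      rw [X.s_m, X.s_m, hq]
    apply innerFun_unique _ _ _ h
    calc X.m ⟨(X.m ⟨(innerFun σ p, innerFun σ q), hpq⟩, σ.toFun (X.s (X.m ⟨(p, q), hz⟩))), h⟩
        = X.m ⟨(X.m ⟨(innerFun σ p, innerFun σ q), hpq⟩, σ.toFun (X.s q)),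
            (X.s_m _).trans hq⟩ := X.m_congr rfl (by rw [X.s_m])
      _ = X.m ⟨(innerFun σ p, X.m ⟨(σ.toFun (X.s p), q), hm⟩), X.comp_left hp hm⟩ := by
          rw [X.m_assoc _ _ _ hpq hq]
          exact X.m_congr rfl ((innerFun_spec σ q).trans (X.m_congr (by rw [hz]) rfl))
      _ = X.m ⟨(X.m ⟨(σ.toFun (X.t p), p), σ.s_toFun _⟩, q), (X.s_m _).trans hz⟩ := by
          rw [← X.m_assoc _ _ _ hp hm]
          exact X.m_congr (innerFun_spec σ p) rfl
      _ = X.m ⟨(σ.toFun (X.t (X.m ⟨(p, q), hz⟩)), X.m ⟨(p, q), hz⟩), σ.s_toFun _⟩ := by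
          rw [X.m_assoc _ _ _ (σ.s_toFun _) hz]
          exact X.m_congr (by rw [X.t_m]) rfl

/-- `α_Φ(σ) = Φ ∘ σ ∘ φ⁻¹`. -/
def autBis (Φ : X.Aut) (σ : X.Bisection) : X.Bisection where
  toFun := fun x => Φ.arrows (σ.toFun (Φ.objects.symm x))
  smooth := Φ.arrows.contMDiff.comp (σ.smooth.comp Φ.objects.symm.contMDiff)
  base := (Φ.objects.symm.trans σ.base).trans Φ.objects
  s_toFun := fun x => by rw [Φ.s_arrows, σ.s_toFun, Φ.objects.apply_symm_apply]
  t_toFun := fun x => by rw [Φ.t_arrows, σ.t_toFun]; rfl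

lemma autBis_apply (Φ : X.Aut) (σ : X.Bisection) (x : X₀) :
    (autBis Φ σ).toFun x = Φ.arrows (σ.toFun (Φ.objects.symm x)) := rfl

variable (X)

/-- The crossed module of automorphisms `(Aut(X), Bis(X), I, α)`. -/
def autCrossedModule : CrossedModule X.Aut X.Bisection where
  map :=
    { toFun := innerAut
      map_one' := Aut.ext innerFun_one
      map_mul' := fun σ τ => Aut.ext (innerFun_mul σ τ) }
  action :=
    { toFun := fun Φ =>
        { toFun := autBis Φ
          invFun := autBis Φ⁻¹
          left_inv := fun σ => by
            ext x
            simp only [autBis_apply, Aut.inv_apply, Aut.objects_inv,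
              Φ.arrows.symm_apply_apply]
            exact congrArg σ.toFun (Φ.objects.symm_apply_apply x)
          right_inv := fun σ => by
            ext x
            simp only [autBis_apply, Aut.inv_apply, Aut.objects_inv, Φ.arrows.apply_symm_apply]
            exact congrArg σ.toFun (Φ.objects.apply_symm_apply x)
          map_mul' := fun σ τ => by
            ext x
            simp only [autBis_apply, Bisection.mul_apply]
            rw [Φ.m_arrows]
            exact X.m_congr (by rw [Φ.t_arrows, Φ.objects.symm_apply_apply]) rfl }
      map_one' := by ext σ x; rfl
      map_mul' := fun Φ Ψ => by ext σ x; rfl }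
  map_action := fun Φ σ => by
    rw [eq_mul_inv_iff_mul_eq]
    ext p
    change innerFun (autBis Φ σ) (Φ.arrows p) = Φ.arrows (innerFun σ p)
    symm
    have h : X.s (Φ.arrows (innerFun σ p)) = X.t ((autBis Φ σ).toFun (X.s (Φ.arrows p))) := by
      rw [Φ.s_arrows, s_innerFun, autBis_apply, Φ.t_arrows, σ.t_toFun, Φ.s_arrows,
        Φ.objects.symm_apply_apply]
    apply innerFun_unique _ _ _ h
    have e := congrArg Φ.arrows (innerFun_spec σ p)
    rw [Φ.m_arrows, Φ.m_arrows] at e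
    refine (X.m_congr rfl ?_).trans (e.trans (X.m_congr ?_ rfl))
    · rw [autBis_apply, Φ.s_arrows, Φ.objects.symm_apply_apply]
    · rw [autBis_apply, Φ.t_arrows, Φ.objects.symm_apply_apply]
  peiffer := fun σ τ => by
    rw [eq_mul_inv_iff_mul_eq]
    ext x
    change X.m ⟨(innerFun σ (τ.toFun (σ.base.symm (X.t (σ.toFun x)))), σ.toFun x), _⟩
      = X.m ⟨(σ.toFun (X.t (τ.toFun x)), τ.toFun x), _⟩
    refine (X.m_congr ?_ ?_).trans (innerFun_spec σ (τ.toFun x))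
    · rw [σ.t_toFun, Diffeomorph.symm_apply_apply]
    · rw [τ.s_toFun]


end LieGroupoid

/-! ### Riemannian metrics -/

section Riemannian

variable {k n : ℕ} {M N : Type*}
  [TopologicalSpace M] [ChartedSpace (EuclideanSpace ℝ (Fin k)) M] [IsManifold (𝓡 k) ∞ M]
  [TopologicalSpace N] [ChartedSpace (EuclideanSpace ℝ (Fin n)) N] [IsManifold (𝓡 n) ∞ N]

/-- Smooth Riemannian metrics on a manifold. -/
abbrev SmoothMetric (k : ℕ) (M : Type*) [TopologicalSpace M]
    [ChartedSpace (EuclideanSpace ℝ (Fin k)) M] [IsManifold (𝓡 k) ∞ M] :=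
  ContMDiffRiemannianMetric (𝓡 k) ∞ (EuclideanSpace ℝ (Fin k))
    (fun x : M => TangentSpace (𝓡 k) x)

/-- `f^* η = η`. -/
def PreservesMetric (η : SmoothMetric k M) (f : M → M) : Prop :=
  ∀ (x : M) (v w : TangentSpace (𝓡 k) x),
    η.inner (f x) (mfderiv (𝓡 k) (𝓡 k) f x v) (mfderiv (𝓡 k) (𝓡 k) f x w) = η.inner x v w

/-- `v` is orthogonal to the fibre of `f` through `x`. -/
def IsHorizontal (η : SmoothMetric k M) (f : M → N) (x : M) (v : TangentSpace (𝓡 k) x) : Prop :=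
  ∀ w : TangentSpace (𝓡 k) x, mfderiv (𝓡 k) (𝓡 n) f x w = 0 → η.inner x v w = 0

/-- `η` is transverse to the submersion `f`: along each fibre, the identifications of the
horizontal spaces with the tangent space of the base induce the same inner product there. -/
def IsTransverse (η : SmoothMetric k M) (f : M → N) : Prop :=
  ∀ (x x' : M), f x = f x' → ∀ (v w : TangentSpace (𝓡 k) x) (v' w' : TangentSpace (𝓡 k) x'),
    IsHorizontal (n := n) η f x v → IsHorizontal (n := n) η f x w →
    IsHorizontal (n := n) η f x' v' → IsHorizontal (n := n) η f x' w' →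
    (mfderiv (𝓡 k) (𝓡 n) f x v : EuclideanSpace ℝ (Fin n)) = mfderiv (𝓡 k) (𝓡 n) f x' v' →
    (mfderiv (𝓡 k) (𝓡 n) f x w : EuclideanSpace ℝ (Fin n)) = mfderiv (𝓡 k) (𝓡 n) f x' w' →
    η.inner x v w = η.inner x' v' w'

/-- `ηN` is the push-forward metric of `η` along the surjective submersion `f`. -/
def IsPushforward (η : SmoothMetric k M) (f : M → N) (ηN : SmoothMetric n N) : Prop :=
  ∀ (x : M) (v w : TangentSpace (𝓡 k) x), IsHorizontal (n := n) η f x v →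
    IsHorizontal (n := n) η f x w →
    ηN.inner (f x) (mfderiv (𝓡 k) (𝓡 n) f x v) (mfderiv (𝓡 k) (𝓡 n) f x w) = η.inner x v w

lemma PreservesMetric.comp {η : SmoothMetric k M} {f g : M → M} (hf : PreservesMetric η f)
    (hg : PreservesMetric η g) (sf : ContMDiff (𝓡 k) (𝓡 k) ∞ f)
    (sg : ContMDiff (𝓡 k) (𝓡 k) ∞ g) : PreservesMetric η (f ∘ g) := by
  intro x v w
  rw [mfderiv_comp x ((sf (g x)).mdifferentiableAt (by simp))
    ((sg x).mdifferentiableAt (by simp))]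
  exact (hf (g x) _ _).trans (hg x v w)

lemma PreservesMetric.symm {η : SmoothMetric k M} {f : M ≃ₘ^∞⟮𝓡 k, 𝓡 k⟯ M}
    (hf : PreservesMetric η f) : PreservesMetric η f.symm := by
  intro x v w
  have e : mfderiv (𝓡 k) (𝓡 k) (f ∘ f.symm) x = ContinuousLinearMap.id ℝ _ := by
    have : (f ∘ f.symm : M → M) = id := funext f.apply_symm_apply
    rw [this]; exact mfderiv_id
  rw [mfderiv_comp x ((f.contMDiff _).mdifferentiableAt (by simp))
    ((f.symm.contMDiff x).mdifferentiableAt (by simp))] at e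
  have hv : ∀ v, mfderiv (𝓡 k) (𝓡 k) f (f.symm x) (mfderiv (𝓡 k) (𝓡 k) f.symm x v) = v :=
    fun v => congrArg (fun L : TangentSpace (𝓡 k) x →L[ℝ] TangentSpace (𝓡 k) x => L v) e
  have h := hf (f.symm x) (mfderiv (𝓡 k) (𝓡 k) f.symm x v) (mfderiv (𝓡 k) (𝓡 k) f.symm x w)
  rw [hv, hv] at h
  rw [← h]
  have : ∀ y (_ : y = x) (a b : EuclideanSpace ℝ (Fin k)),
      η.inner y (a : EuclideanSpace ℝ (Fin k)) (b : EuclideanSpace ℝ (Fin k))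
        = η.inner x (a : EuclideanSpace ℝ (Fin k)) (b : EuclideanSpace ℝ (Fin k)) := by
    rintro y rfl a b; rfl
  exact this _ (f.apply_symm_apply x) v w

/-- Smooth vector fields. -/
def IsSmoothField (V : Π x : M, TangentSpace (𝓡 k) x) : Prop :=
  ContMDiff (𝓡 k) (𝓡 k).tangent ∞ (fun x => (⟨x, V x⟩ : TangentBundle (𝓡 k) M))

/-- Killing vector fields: smooth vector fields `V` with `L_V η = 0`, that is,
`V(η(Y,Z)) = η([V,Y],Z) + η(Y,[V,Z])` for all smooth vector fields `Y`, `Z`. -/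
def IsKilling (η : SmoothMetric k M) (V : Π x : M, TangentSpace (𝓡 k) x) : Prop :=
  IsSmoothField V ∧ ∀ Y Z : Π x : M, TangentSpace (𝓡 k) x, IsSmoothField Y → IsSmoothField Z →
    ∀ x, mfderiv (𝓡 k) 𝓘(ℝ, ℝ) (fun y => η.inner y (Y y) (Z y)) x (V x)
      = η.inner x (mlieBracket (𝓡 k) V Y x) (Z x) + η.inner x (Y x) (mlieBracket (𝓡 k) V Z x)

end Riemannian

namespace LieGroupoid

variable {n₀ n₁ : ℕ} {X₀ X₁ : Type*}
  [TopologicalSpace X₀] [ChartedSpace (EuclideanSpace ℝ (Fin n₀)) X₀] [IsManifold (𝓡 n₀) ∞ X₀]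
  [TopologicalSpace X₁] [ChartedSpace (EuclideanSpace ℝ (Fin n₁)) X₁] [IsManifold (𝓡 n₁) ∞ X₁]
  (X : LieGroupoid n₀ n₁ X₀ X₁)

/-- The transposition `(p, q) ↦ (q⁻¹, p⁻¹)` of the vertices `t p` and `s q` of the commutative
triangle `(p, q)`. -/
def flip₀₂ (z : X.Comp) : X.Comp :=
  ⟨(X.i z.1.2, X.i z.1.1), by rw [X.s_i, X.t_i]; exact z.2.symm⟩

/-- The transposition `(p, q) ↦ (p⁻¹, p * q)` of the vertices `t p` and `s p = t q`. -/
def flip₀₁ (z : X.Comp) : X.Comp :=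
  ⟨(X.i z.1.1, X.m z), by rw [X.s_i, X.t_m]⟩

/-- The transposition `(p, q) ↦ (p * q, q⁻¹)` of the vertices `s p = t q` and `s q`. -/
def flip₁₂ (z : X.Comp) : X.Comp :=
  ⟨(X.m z, X.i z.1.2), by rw [X.s_m, X.t_i]⟩

/-- Riemannian groupoid structures on `X`: a metric `η₂` on `X₂` which is invariant under the action
of the symmetric group `S₃` (generated by the three transpositions) and transverse to the
composition. The metrics `η₁` on `X₁` and `η₀` on `X₀` are the induced ones; they are uniquely
determined by `η₂`. -/
structure GroupoidMetric where
  η₂ : SmoothMetric X.n₂ X.Comp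
  invariant₀₂ : PreservesMetric η₂ X.flip₀₂
  invariant₀₁ : PreservesMetric η₂ X.flip₀₁
  invariant₁₂ : PreservesMetric η₂ X.flip₁₂
  transverse : IsTransverse (n := n₁) η₂ X.m
  η₁ : SmoothMetric n₁ X₁
  pushforward_m : IsPushforward η₂ X.m η₁
  η₀ : SmoothMetric n₀ X₀
  pushforward_s : IsPushforward η₁ X.s η₀

variable {X}

/-- `Iso(X, η)`: automorphisms covering an isometry of `(X₀, η)`. -/
def Iso (η : SmoothMetric n₀ X₀) : Subgroup X.Aut where
  carrier := {Φ | PreservesMetric η Φ.objects}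
  one_mem' := fun x v w => by
    change η.inner x (mfderiv (𝓡 n₀) (𝓡 n₀) id x v) (mfderiv (𝓡 n₀) (𝓡 n₀) id x w) = _
    rw [mfderiv_id]; rfl
  mul_mem' := fun {Φ Ψ} h h' => h.comp h' Φ.objects.contMDiff Ψ.objects.contMDiff
  inv_mem' := fun h => h.symm

/-- `Bis_η(X)`: bisections `σ` for which `ι_σ = t ∘ σ` is an isometry of `(X₀, η)`. -/
def isometricBis (η : SmoothMetric n₀ X₀) : Subgroup X.Bisection where
  carrier := {σ | PreservesMetric η (fun x => X.t (σ.toFun x))}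
  one_mem' := fun x v w => by
    have : (fun x => X.t ((1 : X.Bisection).toFun x)) = id := funext X.t_u
    rw [this, mfderiv_id]; rfl
  mul_mem' := fun {σ τ} h h' => by
    have e : ∀ σ : X.Bisection, (fun x => X.t (σ.toFun x)) = σ.base := fun σ => funext σ.t_toFun
    simp only [Set.mem_ofPred_eq, e] at h h' ⊢
    exact h.comp h' σ.base.contMDiff τ.base.contMDiff
  inv_mem' := fun {σ} h => by
    have e : ∀ σ : X.Bisection, (fun x => X.t (σ.toFun x)) = σ.base := fun σ => funext σ.t_toFun
    simp only [Set.mem_ofPred_eq, e] at h ⊢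
    exact h.symm

lemma mem_isometricBis {η : SmoothMetric n₀ X₀} {σ : X.Bisection} :
    σ ∈ isometricBis η ↔ PreservesMetric η σ.base := by
  have e : (fun x => X.t (σ.toFun x)) = σ.base := funext σ.t_toFun
  rw [← e]; rfl

variable (X)

/-- The crossed module of strong isometries `(Iso(X, η), Bis_η(X), I, α)`. -/
def isoCrossedModule (η : SmoothMetric n₀ X₀) :
    CrossedModule (Iso (X := X) η) (isometricBis (X := X) η) :=
  X.autCrossedModule.restrict (Iso η) (isometricBis η)
    (fun _ hσ => mem_isometricBis.1 hσ)
    (fun Φ hΦ σ hσ => by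
      have h1 : PreservesMetric η (σ.base ∘ Φ.objects.symm) :=
        (mem_isometricBis.1 hσ).comp (PreservesMetric.symm hΦ) σ.base.contMDiff
          Φ.objects.symm.contMDiff
      exact mem_isometricBis.2 (PreservesMetric.comp (f := Φ.objects) hΦ h1 Φ.objects.contMDiff
        (σ.base.contMDiff.comp Φ.objects.symm.contMDiff)))

/-! ### Multiplicative vector fields and sections of the Lie algebroid

Points that are only propositionally equal, such as `X.m (X.u (X.t p), p)` and `p`, have the same
tangent space, since `TangentSpace` is a constant family of vector spaces. -/

open Classical in
/-- The composition of the tangent groupoid `TX₁ ⇉ TX₀`: the image under `dm` of the vector tangent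
to `X₂` at `z` with components `v` and `w` (and `0` if `v` and `w` are not composable). -/
def tangentMul (z : X.Comp) (v : TangentSpace (𝓡 n₁) z.1.1) (w : TangentSpace (𝓡 n₁) z.1.2) :
    TangentSpace (𝓡 n₁) (X.m z) :=
  if h : ∃ ζ : TangentSpace (𝓡 X.n₂) z,
      mfderiv (𝓡 X.n₂) (𝓡 n₁) (fun z : X.Comp => z.1.1) z ζ = v ∧
      mfderiv (𝓡 X.n₂) (𝓡 n₁) (fun z : X.Comp => z.1.2) z ζ = w
  then mfderiv (𝓡 X.n₂) (𝓡 n₁) X.m z h.choose else 0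

/-- Pairs `(ξ, v)` of vector fields on `X₁` and `X₀`. -/
abbrev FieldPair (_X : LieGroupoid n₀ n₁ X₀ X₁) :=
  (Π p : X₁, TangentSpace (𝓡 n₁) p) × (Π x : X₀, TangentSpace (𝓡 n₀) x)

/-- Vector fields along the units. -/
abbrev UnitField := Π x : X₀, TangentSpace (𝓡 n₁) (X.u x)

/-- `𝔛_m(X)`: pairs `(ξ, v)` of smooth vector fields forming a groupoid morphism `X → TX`. -/
def multiplicativeFields : Set X.FieldPair :=
  {ξ | IsSmoothField ξ.1 ∧ IsSmoothField ξ.2 ∧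
    (∀ p, mfderiv (𝓡 n₁) (𝓡 n₀) X.s p (ξ.1 p) = ξ.2 (X.s p)) ∧
    (∀ p, mfderiv (𝓡 n₁) (𝓡 n₀) X.t p (ξ.1 p) = ξ.2 (X.t p)) ∧
    ∀ z : X.Comp, ξ.1 (X.m z) = X.tangentMul z (ξ.1 z.1.1) (ξ.1 z.1.2)}

/-- `Γ(A_X)`: smooth sections of the Lie algebroid `A_X = ker(ds)|_{X₀}`. -/
def algebroidSections : Set X.UnitField :=
  {α | ContMDiff (𝓡 n₀) (𝓡 n₁).tangent ∞ (fun x => (⟨X.u x, α x⟩ : TangentBundle (𝓡 n₁) X₁)) ∧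
    ∀ x, mfderiv (𝓡 n₁) (𝓡 n₀) X.s (X.u x) (α x) = 0}

/-- The anchor `ρ(α) = dt ∘ α`. -/
def anchor (α : X.UnitField) : Π x : X₀, TangentSpace (𝓡 n₀) x :=
  fun x => (mfderiv (𝓡 n₁) (𝓡 n₀) X.t (X.u x) (α x) : EuclideanSpace ℝ (Fin n₀))

/-- The right-invariant vector field `α^r(p) = dR_p(α(t p))`. -/
def rightField (α : X.UnitField) : Π p : X₁, TangentSpace (𝓡 n₁) p :=
  fun p => (X.tangentMul ⟨(X.u (X.t p), p), X.s_u _⟩ (α (X.t p)) 0 : EuclideanSpace ℝ (Fin n₁))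

/-- The left-invariant vector field `α^l(p) = -dL_p(di(α(s p)))`. -/
def leftField (α : X.UnitField) : Π p : X₁, TangentSpace (𝓡 n₁) p :=
  fun p => -(X.tangentMul ⟨(p, X.u (X.s p)), (X.t_u _).symm⟩ 0
    (mfderiv (𝓡 n₁) (𝓡 n₁) X.i (X.u (X.s p)) (α (X.s p)) : EuclideanSpace ℝ (Fin n₁))
      : EuclideanSpace ℝ (Fin n₁))

end LieGroupoid

/-! ### Crossed modules of Lie algebras -/

/-- `S` is a Lie algebra: a linear subspace of `V` on which `br` restricts to a Lie bracket. -/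
structure IsLieAlgebraOn {V : Type*} [AddCommGroup V] [Module ℝ V] (S : Set V)
    (br : V → V → V) : Prop where
  zero_mem : 0 ∈ S
  add_mem : ∀ x ∈ S, ∀ y ∈ S, x + y ∈ S
  smul_mem : ∀ (c : ℝ), ∀ x ∈ S, c • x ∈ S
  br_mem : ∀ x ∈ S, ∀ y ∈ S, br x y ∈ S
  add_br : ∀ x ∈ S, ∀ y ∈ S, ∀ z ∈ S, br (x + y) z = br x z + br y z
  br_add : ∀ x ∈ S, ∀ y ∈ S, ∀ z ∈ S, br x (y + z) = br x y + br x z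
  smul_br : ∀ (c : ℝ), ∀ x ∈ S, ∀ y ∈ S, br (c • x) y = c • br x y
  br_smul : ∀ (c : ℝ), ∀ x ∈ S, ∀ y ∈ S, br x (c • y) = c • br x y
  br_self : ∀ x ∈ S, br x x = 0
  jacobi : ∀ x ∈ S, ∀ y ∈ S, ∀ z ∈ S, br x (br y z) = br (br x y) z + br y (br x z)

/-- `f` restricts to a linear map from `S` to `S'`. -/
structure IsLinearOn {V V' : Type*} [AddCommGroup V] [Module ℝ V] [AddCommGroup V'] [Module ℝ V']
    (S : Set V) (S' : Set V') (f : V → V') : Prop where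
  maps_to : ∀ x ∈ S, f x ∈ S'
  map_add : ∀ x ∈ S, ∀ y ∈ S, f (x + y) = f x + f y
  map_smul : ∀ (c : ℝ), ∀ x ∈ S, f (c • x) = c • f x

/-- `f` restricts to a homomorphism of Lie algebras from `S` to `S'`. -/
structure IsLieHomOn {V V' : Type*} [AddCommGroup V] [Module ℝ V] [AddCommGroup V'] [Module ℝ V']
    (S : Set V) (br : V → V → V) (S' : Set V') (br' : V' → V' → V') (f : V → V') : Prop
    extends IsLinearOn S S' f where
  map_br : ∀ x ∈ S, ∀ y ∈ S, f (br x y) = br' (f x) (f y)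

/-- The data of a crossed module `(𝔤, 𝔥, δ, D)` of Lie algebras, with `𝔤` and `𝔥` realized inside
vector spaces `V` and `W`. -/
structure LieCrossedModuleData (V W : Type*) where
  𝔤 : Set V
  𝔥 : Set W
  brG : V → V → V
  brH : W → W → W
  δ : W → V
  D : V → W → W

/-- The axioms of a crossed module of Lie algebras. -/
structure LieCrossedModuleData.IsCrossedModule {V W : Type*} [AddCommGroup V] [Module ℝ V]
    [AddCommGroup W] [Module ℝ W] (C : LieCrossedModuleData V W) : Prop where
  lieG : IsLieAlgebraOn C.𝔤 C.brG
  lieH : IsLieAlgebraOn C.𝔥 C.brH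
  lieHom_δ : IsLieHomOn C.𝔥 C.brH C.𝔤 C.brG C.δ
  linear_D : ∀ x ∈ C.𝔤, IsLinearOn C.𝔥 C.𝔥 (C.D x)
  derivation_D : ∀ x ∈ C.𝔤, ∀ y ∈ C.𝔥, ∀ z ∈ C.𝔥,
    C.D x (C.brH y z) = C.brH (C.D x y) z + C.brH y (C.D x z)
  add_D : ∀ x ∈ C.𝔤, ∀ x' ∈ C.𝔤, ∀ y ∈ C.𝔥, C.D (x + x') y = C.D x y + C.D x' y
  smul_D : ∀ (c : ℝ), ∀ x ∈ C.𝔤, ∀ y ∈ C.𝔥, C.D (c • x) y = c • C.D x y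
  br_D : ∀ x ∈ C.𝔤, ∀ x' ∈ C.𝔤, ∀ y ∈ C.𝔥,
    C.D (C.brG x x') y = C.D x (C.D x' y) - C.D x' (C.D x y)
  δ_D : ∀ x ∈ C.𝔤, ∀ y ∈ C.𝔥, C.δ (C.D x y) = C.brG x (C.δ y)
  peiffer : ∀ y ∈ C.𝔥, ∀ y' ∈ C.𝔥, C.D (C.δ y) y' = C.brH y y'

/-- `(f₁, f₀)` restricts to a morphism of crossed modules of Lie algebras. -/
structure LieCrossedModuleData.IsMorphism {V W V' W' : Type*} [AddCommGroup V] [Module ℝ V]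
    [AddCommGroup W] [Module ℝ W] [AddCommGroup V'] [Module ℝ V'] [AddCommGroup W'] [Module ℝ W']
    (C : LieCrossedModuleData V W) (C' : LieCrossedModuleData V' W') (f₁ : W → W') (f₀ : V → V') :
    Prop where
  source : C.IsCrossedModule
  target : C'.IsCrossedModule
  lieHom₀ : IsLieHomOn C.𝔤 C.brG C'.𝔤 C'.brG f₀
  lieHom₁ : IsLieHomOn C.𝔥 C.brH C'.𝔥 C'.brH f₁
  map_δ : ∀ y ∈ C.𝔥, f₀ (C.δ y) = C'.δ (f₁ y)
  map_D : ∀ x ∈ C.𝔤, ∀ y ∈ C.𝔥, f₁ (C.D x y) = C'.D (f₀ x) (f₁ y)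

/-- The crossed module `(𝔬_m(X), Γ_η(A_X), δ, D)` of strong multiplicative Killing vector fields:
`𝔬_m(X)` consists of the multiplicative `(ξ, v)` with `v` Killing, `Γ_η(A_X)` of the sections with
Killing anchor, `[α, β] = [α^r, β^r]|_{X₀}`, `δ(α) = α^r - α^l` (covering `ρ(α)`), and
`D_{(ξ,v)} α = [ξ, α^r]|_{X₀}`. -/
def LieGroupoid.killingCrossedModule {n₀ n₁ : ℕ} {X₀ X₁ : Type*}
    [TopologicalSpace X₀] [ChartedSpace (EuclideanSpace ℝ (Fin n₀)) X₀] [IsManifold (𝓡 n₀) ∞ X₀]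
    [TopologicalSpace X₁] [ChartedSpace (EuclideanSpace ℝ (Fin n₁)) X₁] [IsManifold (𝓡 n₁) ∞ X₁]
    (X : LieGroupoid n₀ n₁ X₀ X₁) (η : SmoothMetric n₀ X₀) :
    LieCrossedModuleData X.FieldPair X.UnitField where
  𝔤 := {ξ | ξ ∈ X.multiplicativeFields ∧ IsKilling η ξ.2}
  𝔥 := {α | α ∈ X.algebroidSections ∧ IsKilling η (X.anchor α)}
  brG := fun ξ ζ => (mlieBracket (𝓡 n₁) ξ.1 ζ.1, mlieBracket (𝓡 n₀) ξ.2 ζ.2)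
  brH := fun α β x => mlieBracket (𝓡 n₁) (X.rightField α) (X.rightField β) (X.u x)
  δ := fun α => (X.rightField α - X.leftField α, X.anchor α)
  D := fun ξ α x => mlieBracket (𝓡 n₁) ξ.1 (X.rightField α) (X.u x)

/-! ### Lie 2-groups and their actions -/

/-- Lie 2-groups: Lie groupoids `G₁ ⇉ G₀` of Lie groups with homomorphic structure maps. -/
structure LieTwoGroup (k₀ k₁ : ℕ) (G₀ G₁ : Type*)
    [TopologicalSpace G₀] [ChartedSpace (EuclideanSpace ℝ (Fin k₀)) G₀] [Group G₀]
    [LieGroup (𝓡 k₀) ∞ G₀]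
    [TopologicalSpace G₁] [ChartedSpace (EuclideanSpace ℝ (Fin k₁)) G₁] [Group G₁]
    [LieGroup (𝓡 k₁) ∞ G₁]
    extends LieGroupoid k₀ k₁ G₀ G₁ where
  s_mul : ∀ g h, s (g * h) = s g * s h
  t_mul : ∀ g h, t (g * h) = t g * t h
  u_mul : ∀ g h, u (g * h) = u g * u h
  i_mul_hom : ∀ g h, i (g * h) = i g * i h
  m_mul : ∀ a b c : ComposablePairs s t, c.1 = a.1 * b.1 → m c = m a * m b

namespace LieTwoGroup

variable {k₀ k₁ : ℕ} {G₀ G₁ : Type*}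
  [TopologicalSpace G₀] [ChartedSpace (EuclideanSpace ℝ (Fin k₀)) G₀] [Group G₀]
  [LieGroup (𝓡 k₀) ∞ G₀]
  [TopologicalSpace G₁] [ChartedSpace (EuclideanSpace ℝ (Fin k₁)) G₁] [Group G₁]
  [LieGroup (𝓡 k₁) ∞ G₁]
  (G : LieTwoGroup k₀ k₁ G₀ G₁)

/-- The source as a group homomorphism. -/
def sHom : G₁ →* G₀ := MonoidHom.mk' G.s G.s_mul

/-- The target as a group homomorphism. -/
def tHom : G₁ →* G₀ := MonoidHom.mk' G.t G.t_mul

/-- The unit map as a group homomorphism. -/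
def uHom : G₀ →* G₁ := MonoidHom.mk' G.u G.u_mul

/-- `H = ker(s)`. -/
abbrev H : Subgroup G₁ := G.sHom.ker

lemma comm_ker {h k : G₁} (hh : G.s h = 1) (hk : G.t k = 1) : h * k = k * h := by
  have hs1 : G.s 1 = 1 := G.sHom.map_one
  have ht1 : G.t 1 = 1 := G.tHom.map_one
  have hu1 : G.u 1 = 1 := G.uHom.map_one
  have e1 : G.m ⟨(h, 1), hh.trans ht1.symm⟩ = h :=
    (G.m_congr (h' := (G.t_u _).symm) rfl (by rw [hh, hu1])).trans (G.m_u h)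
  have e2 : G.m ⟨(1, k), hs1.trans hk.symm⟩ = k :=
    (G.m_congr (h' := G.s_u _) (by rw [hk, hu1]) rfl).trans (G.u_m k)
  have a := G.m_mul ⟨(h, 1), hh.trans ht1.symm⟩ ⟨(1, k), hs1.trans hk.symm⟩
    ⟨(h, k), hh.trans hk.symm⟩ (by simp)
  have b := G.m_mul ⟨(1, k), hs1.trans hk.symm⟩ ⟨(h, 1), hh.trans ht1.symm⟩
    ⟨(h, k), hh.trans hk.symm⟩ (by simp)
  rw [e1, e2] at a b
  exact a.symm.trans b

/-- The crossed module `(G, H, ρ, α)` of a Lie 2-group: `G = G₀`, `H = ker(s)`, `ρ = t|_H`, and `g`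
acts by conjugation by `1_g`. -/
def crossedModule : CrossedModule G₀ G.H where
  map := G.tHom.comp G.H.subtype
  action := (MulAut.conjNormal : G₁ →* MulAut G.H).comp G.uHom
  map_action := fun g h => by
    change G.tHom (G.u g * h * (G.u g)⁻¹) = g * G.tHom h * g⁻¹
    rw [map_mul, map_mul, map_inv]
    change G.t (G.u g) * _ * (G.t (G.u g))⁻¹ = _
    rw [G.t_u]
  peiffer := fun h h' => by
    apply Subtype.ext
    change G.u (G.t h) * h' * (G.u (G.t h))⁻¹ = (h : G₁) * h' * (h : G₁)⁻¹
    have hk : G.t ((G.u (G.t h))⁻¹ * h) = 1 := by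
      change G.tHom ((G.u (G.t h))⁻¹ * h) = 1
      rw [map_mul, map_inv]
      change (G.t (G.u (G.t h)))⁻¹ * G.t h = 1
      rw [G.t_u, inv_mul_cancel]
    have c := G.comm_ker (h := h') h'.2 hk
    generalize G.u (G.t h) = U at c ⊢
    rw [mul_inv_eq_iff_eq_mul, ← mul_right_inj U⁻¹, ← mul_left_inj (U⁻¹ * (h : G₁))]
    calc U⁻¹ * (U * (h' : G₁)) * (U⁻¹ * h) = h' * (U⁻¹ * h) := by group
      _ = U⁻¹ * h * h' := c
      _ = _ := by group

/-- The differential `ζ ↦ 1_ζ` of the unit map, `Lie(G₀) → Lie(G₁)`. -/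
def unitLie (ζ : GroupLieAlgebra (𝓡 k₀) G₀) : GroupLieAlgebra (𝓡 k₁) G₁ :=
  (mfderiv (𝓡 k₀) (𝓡 k₁) G.u (1 : G₀) ζ : EuclideanSpace ℝ (Fin k₁))

/-- The crossed module `(𝔤, 𝔥, ∂, 𝓛)` of the Lie 2-algebra `Lie(G₁) ⇉ Lie(G₀)`:
`𝔤 = Lie(G₀)`, `𝔥 = ker(ds)`, `∂ = dt|_𝔥` and `𝓛_ζ = ad(1_ζ)`. -/
def lieCrossedModule :
    LieCrossedModuleData (GroupLieAlgebra (𝓡 k₀) G₀) (GroupLieAlgebra (𝓡 k₁) G₁) where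
  𝔤 := Set.univ
  𝔥 := {ξ | mfderiv (𝓡 k₁) (𝓡 k₀) G.s (1 : G₁) ξ = 0}
  brG := fun ζ ζ' => ⁅ζ, ζ'⁆
  brH := fun ξ ξ' => ⁅ξ, ξ'⁆
  δ := fun ξ => (mfderiv (𝓡 k₁) (𝓡 k₀) G.t (1 : G₁) ξ : EuclideanSpace ℝ (Fin k₀))
  D := fun ζ ξ => ⁅G.unitLie ζ, ξ⁆

end LieTwoGroup

/-- Right 2-actions of a Lie 2-group on a Lie groupoid: a pair of smooth right actions forming a
morphism from the product groupoid `X₁ × G₁ ⇉ X₀ × G₀` to `X₁ ⇉ X₀`. -/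
structure RightTwoAction {k₀ k₁ n₀ n₁ : ℕ} {G₀ G₁ X₀ X₁ : Type*}
    [TopologicalSpace G₀] [ChartedSpace (EuclideanSpace ℝ (Fin k₀)) G₀] [Group G₀]
    [LieGroup (𝓡 k₀) ∞ G₀]
    [TopologicalSpace G₁] [ChartedSpace (EuclideanSpace ℝ (Fin k₁)) G₁] [Group G₁]
    [LieGroup (𝓡 k₁) ∞ G₁]
    [TopologicalSpace X₀] [ChartedSpace (EuclideanSpace ℝ (Fin n₀)) X₀] [IsManifold (𝓡 n₀) ∞ X₀]
    [TopologicalSpace X₁] [ChartedSpace (EuclideanSpace ℝ (Fin n₁)) X₁] [IsManifold (𝓡 n₁) ∞ X₁]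
    (G : LieTwoGroup k₀ k₁ G₀ G₁) (X : LieGroupoid n₀ n₁ X₀ X₁) where
  act₁ : X₁ → G₁ → X₁
  act₀ : X₀ → G₀ → X₀
  smooth₁ : ContMDiff ((𝓡 n₁).prod (𝓡 k₁)) (𝓡 n₁) ∞ (fun a : X₁ × G₁ => act₁ a.1 a.2)
  smooth₀ : ContMDiff ((𝓡 n₀).prod (𝓡 k₀)) (𝓡 n₀) ∞ (fun a : X₀ × G₀ => act₀ a.1 a.2)
  act₁_one : ∀ p, act₁ p 1 = p
  act₁_mul : ∀ p g h, act₁ p (g * h) = act₁ (act₁ p g) h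
  act₀_one : ∀ x, act₀ x 1 = x
  act₀_mul : ∀ x g h, act₀ x (g * h) = act₀ (act₀ x g) h
  s_act : ∀ p g, X.s (act₁ p g) = act₀ (X.s p) (G.s g)
  t_act : ∀ p g, X.t (act₁ p g) = act₀ (X.t p) (G.t g)
  m_act : ∀ (z : X.Comp) (a : G.Comp), act₁ (X.m z) (G.m a) =
    X.m ⟨(act₁ z.1.1 a.1.1, act₁ z.1.2 a.1.2), by rw [s_act, t_act, z.2, a.2]⟩

namespace RightTwoAction

variable {k₀ k₁ n₀ n₁ : ℕ} {G₀ G₁ X₀ X₁ : Type*}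
  [TopologicalSpace G₀] [ChartedSpace (EuclideanSpace ℝ (Fin k₀)) G₀] [Group G₀]
  [LieGroup (𝓡 k₀) ∞ G₀]
  [TopologicalSpace G₁] [ChartedSpace (EuclideanSpace ℝ (Fin k₁)) G₁] [Group G₁]
  [LieGroup (𝓡 k₁) ∞ G₁]
  [TopologicalSpace X₀] [ChartedSpace (EuclideanSpace ℝ (Fin n₀)) X₀] [IsManifold (𝓡 n₀) ∞ X₀]
  [TopologicalSpace X₁] [ChartedSpace (EuclideanSpace ℝ (Fin n₁)) X₁] [IsManifold (𝓡 n₁) ∞ X₁]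
  {G : LieTwoGroup k₀ k₁ G₀ G₁} {X : LieGroupoid n₀ n₁ X₀ X₁} (θ : RightTwoAction G X)

/-- The induced action of `G₂` on `X₂`. -/
def act₂ (z : X.Comp) (a : G.Comp) : X.Comp :=
  ⟨(θ.act₁ z.1.1 a.1.1, θ.act₁ z.1.2 a.1.2), by rw [θ.s_act, θ.t_act, z.2, a.2]⟩

/-- The 2-action is isometric if `G₂` acts by isometries on `(X₂, η₂)`. -/
def IsIsometric (η : X.GroupoidMetric) : Prop :=
  ∀ a : G.Comp, PreservesMetric η.η₂ (fun z => θ.act₂ z a)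

/-- The fundamental vector field on `X₁` of `ξ ∈ Lie(G₁)`. -/
def fundamental₁ (ξ : GroupLieAlgebra (𝓡 k₁) G₁) : Π p : X₁, TangentSpace (𝓡 n₁) p :=
  fun p => (mfderiv (𝓡 k₁) (𝓡 n₁) (fun g => θ.act₁ p g) (1 : G₁) ξ : EuclideanSpace ℝ (Fin n₁))

/-- The fundamental vector field on `X₀` of `ζ ∈ Lie(G₀)`. -/
def fundamental₀ (ζ : GroupLieAlgebra (𝓡 k₀) G₀) : Π x : X₀, TangentSpace (𝓡 n₀) x :=
  fun x => (mfderiv (𝓡 k₀) (𝓡 n₀) (fun g => θ.act₀ x g) (1 : G₀) ζ : EuclideanSpace ℝ (Fin n₀))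

end RightTwoAction

/-- Smoothness of a pair of maps `Σ : G₀ → Aut(X)` and `σ : H → Bis(X)`, in the sense of the
functional diffeologies: the evaluation maps `(g, p) ↦ Σ_g(p)`, `(g, x) ↦ Σ_g(x)` and
`(h, x) ↦ σ_h(x)` are smooth. A map into the embedded submanifold `H` of `G₁` is smooth if and only
if it is smooth as a map into `G₁`, and smoothness on `H` is tested on smooth maps `ℝʲ → H`. -/
def IsSmoothPair {k₀ k₁ n₀ n₁ : ℕ} {G₀ G₁ X₀ X₁ : Type*}
    [TopologicalSpace G₀] [ChartedSpace (EuclideanSpace ℝ (Fin k₀)) G₀] [Group G₀]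
    [LieGroup (𝓡 k₀) ∞ G₀]
    [TopologicalSpace G₁] [ChartedSpace (EuclideanSpace ℝ (Fin k₁)) G₁] [Group G₁]
    [LieGroup (𝓡 k₁) ∞ G₁]
    [TopologicalSpace X₀] [ChartedSpace (EuclideanSpace ℝ (Fin n₀)) X₀] [IsManifold (𝓡 n₀) ∞ X₀]
    [TopologicalSpace X₁] [ChartedSpace (EuclideanSpace ℝ (Fin n₁)) X₁] [IsManifold (𝓡 n₁) ∞ X₁]
    {G : LieTwoGroup k₀ k₁ G₀ G₁} {X : LieGroupoid n₀ n₁ X₀ X₁}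
    (S : G₀ → X.Aut) (σ : G.H → X.Bisection) : Prop :=
  ContMDiff ((𝓡 k₀).prod (𝓡 n₁)) (𝓡 n₁) ∞ (fun a : G₀ × X₁ => (S a.1).arrows a.2) ∧
  ContMDiff ((𝓡 k₀).prod (𝓡 n₀)) (𝓡 n₀) ∞ (fun a : G₀ × X₀ => (S a.1).objects a.2) ∧
  ∀ (j : ℕ) (c : EuclideanSpace ℝ (Fin j) → G.H),
    ContMDiff (𝓡 j) (𝓡 k₁) ∞ (fun e => (c e : G₁)) →
    ContMDiff ((𝓡 j).prod (𝓡 n₀)) (𝓡 n₁) ∞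
      (fun a : EuclideanSpace ℝ (Fin j) × X₀ => (σ (c a.1)).toFun a.2)

end

/-!
**Groups.** For `g ∈ G₀` the isometry of `X₂` given by the pair `(1_g, 1_g)` covers `p ↦ p 1_g`
along the composition, and this map covers `x ↦ x g` along the source. A diffeomorphism that is
covered by an isometry preserves the push-forward metric (`PreservesMetric.of_isPushforward`),
because the isometry permutes the horizontal vectors; so `G₀` acts on `(X₀, η₀)` by isometries
(`RightTwoAction.IsIsometric.preservesMetric_act₀`). The remaining identities are formal
consequences of the interchange law `(p * q)(a * b) = (p a) * (q b)`: with `h = 1_{t(h)} * h = h *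
1` it gives `(p 1_{t(h)}) * σ_h(s p) = p h = σ_h(t p) * p`, from which the compatibility of `(σ,
Σ)` with all structure maps follows (`RightTwoAction.isoHom`). Inversion turns a morphism into the
opposite crossed module into one into the crossed module itself.

**Lie algebras.** The central notion is `LieGroupoid.IsMulRelated A B C`: three vector fields on
`X₁` such that `(A, B, C)` is tangent to the graph of the composition. Such triples lift to `X₂`
and are therefore closed under brackets (`LieGroupoid.IsMulRelated.mbr`). A field `ξ` is
multiplicative when `(ξ, ξ, ξ)` is such a triple, right-invariant when `(ξ, 0, ξ)` is, and
left-invariant when `(0, ξ, ξ)` is; hence brackets of right-invariant fields, and of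
multiplicative with right-invariant ones, are right-invariant, and right-invariant fields commute
with left-invariant ones. With the Jacobi identity this makes the strong multiplicative Killing
fields a crossed module (`LieGroupoid.killing_isCrossedModule`). Lifting to `X₂` rests on the
tangent groupoid, whose laws are obtained by differentiating those of `X`. As `s` is a submersion,
`X₁ × X₁` retracts smoothly onto `X₂` near every composable pair
(`LieGroupoid.exists_retraction`), so that composable tangent vectors are exactly the components
of vectors tangent to `X₂`.

Differentiating the interchange law shows that composable elements `ξ`, `χ` of the Lie algebra
have related fundamental fields (`RightTwoAction.fund_isMulRelated`). In particular `ξ̃` is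
right-invariant for `ξ ∈ ker(ds)`, and the fundamental field of `1_ζ` is multiplicative. For a
right action `ζ ↦ ζ̃` is a homomorphism (`IsSmoothRightAction.mbr_fund`), since orbit maps relate
left-invariant fields to fundamental fields; and if the action is isometric then `ζ̃` is Killing
(`IsSmoothRightAction.isKilling_fund`). The relation `1_{dt(ξ)} = ξ + di(ξ)` on `ker(ds)` gives
the compatibility with `δ`. Applied to the action of the Lie 2-group on itself by right
multiplication, the same facts show that its Lie 2-algebra is a crossed module
(`LieTwoGroup.lieCrossedModule_isCrossedModule`).
-/

noncomputable section

open scoped Topology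
open Filter

/-! ### Derivatives and Lie brackets

Tangent spaces are read as the model space throughout: they form a constant family, so that vectors
at points which are only propositionally equal can be compared. -/

lemma two_le_infty : (2 : WithTop ℕ∞) ≤ ∞ := WithTop.coe_le_coe.2 (le_top : (2 : ℕ∞) ≤ ⊤)

section Calculus

variable {E H M E' H' M' E'' H'' N : Type*}
  [NormedAddCommGroup E''] [NormedSpace ℝ E''] [TopologicalSpace H'']
  {J : ModelWithCorners ℝ E'' H''} [TopologicalSpace N] [ChartedSpace H'' N]
  [NormedAddCommGroup E] [NormedSpace ℝ E] [TopologicalSpace H] {I : ModelWithCorners ℝ E H}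
  [TopologicalSpace M] [ChartedSpace H M]
  [NormedAddCommGroup E'] [NormedSpace ℝ E'] [TopologicalSpace H'] {I' : ModelWithCorners ℝ E' H'}
  [TopologicalSpace M'] [ChartedSpace H' M']

variable (I I') in
/-- The derivative of a map of manifolds, as a linear map of the model spaces. -/
def mder (f : M → M') (x : M) : E →L[ℝ] E' := mfderiv I I' f x

variable (I) in
/-- The Lie bracket of vector fields, read in the model space. -/
def mbr (V W : M → E) : M → E := mlieBracket I V W

lemma mder_comp {g : M → M'} {f : N → M} {x : N} (hg : MDifferentiableAt I I' g (f x))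
    (hf : MDifferentiableAt J I f x) (v : E'') :
    mder J I' (fun y => g (f y)) x v = mder I I' g (f x) (mder J I f x v) := by
  have := mfderiv_comp x hg hf
  exact congrArg (fun L : E'' →L[ℝ] E' => L v) this

lemma mder_congr {f g : M → M'} {x : M} (h : f =ᶠ[𝓝 x] g) : mder I I' f x = mder I I' g x :=
  h.mfderiv_eq

lemma mder_const (c : M') (x : M) (v : E) : mder I I' (fun _ : M => c) x v = 0 := by
  have := mfderiv_const (I := I) (I' := I') (x := x) (c := c)
  exact congrArg (fun L : E →L[ℝ] E' => L v) this

lemma mder_id (x : M) (v : E) : mder I I (fun y : M => y) x v = v := by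
  have := mfderiv_id (I := I) (x := x)
  exact congrArg (fun L : E →L[ℝ] E => L v) this

lemma mder_prodMk {f : N → M} {g : N → M'} {x : N} (hf : MDifferentiableAt J I f x)
    (hg : MDifferentiableAt J I' g x) (v : E'') :
    mder J (I.prod I') (fun y => (f y, g y)) x v = (mder J I f x v, mder J I' g x v) := by
  have := mfderiv_prodMk hf hg
  exact congrArg (fun L : E'' →L[ℝ] E × E' => L v) this

lemma mder_fst (x : M × M') (v : E × E') :
    mder (I.prod I') I (fun y : M × M' => y.1) x v = v.1 := by
  have := mfderiv_fst (I := I) (I' := I') (x := x)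
  exact congrArg (fun L : E × E' →L[ℝ] E => L v) this

lemma mder_snd (x : M × M') (v : E × E') :
    mder (I.prod I') I' (fun y : M × M' => y.2) x v = v.2 := by
  have := mfderiv_snd (I := I) (I' := I') (x := x)
  exact congrArg (fun L : E × E' →L[ℝ] E' => L v) this

section
variable [IsManifold I ∞ M] [IsManifold I' ∞ M']

variable (J I) in
/-- `v` is smooth at `x` as a vector field along the map `b`, that is, as a map to the tangent
bundle. For `b` the identity these are the smooth vector fields. -/
def SmoothAlong (b : N → M) (v : N → E) (x : N) : Prop :=
  ContMDiffAt J I.tangent ∞ (fun y => (⟨b y, v y⟩ : TangentBundle I M)) x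

lemma SmoothAlong.mder {f : M → M'} {b : N → M} {v : N → E} {x : N}
    (hv : SmoothAlong J I b v x) (hf : ContMDiffAt I I' ∞ f (b x)) :
    SmoothAlong J I' (fun y => f (b y)) (fun y => mder I I' f (b y) (v y)) x := by
  have hb : ContMDiffAt J I ∞ b x := (Bundle.contMDiffAt_totalSpace.1 hv).1
  exact ContMDiffAt.clm_apply_of_inCoordinates (b₁ := b) (b₂ := fun y => f (b y))
    (ϕ := fun y => mfderiv I I' f (b y)) (v := v)
    ((hf.mfderiv_const (m := ∞) (by simp)).comp x hb) hv (hf.comp x hb)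

lemma SmoothAlong.base {b : N → M} {v : N → E} {x : N} (hv : SmoothAlong J I b v x) :
    ContMDiffAt J I ∞ b x := (Bundle.contMDiffAt_totalSpace.1 hv).1

lemma smoothAlong_vectorSpace {b : N → E} {v : N → E} {x : N}
    (hv : SmoothAlong J 𝓘(ℝ, E) b v x) : ContMDiffAt J 𝓘(ℝ, E) ∞ v x :=
  (contMDiff_snd_tangentBundle_modelSpace E 𝓘(ℝ, E)).contMDiffAt.comp x hv

/-- Smoothness along `b` is tested in a single chart around `b x`. -/
lemma smoothAlong_iff {b : N → M} {v : N → E} {x : N} :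
    SmoothAlong J I b v x ↔ ContMDiffAt J I ∞ b x ∧
      ContMDiffAt J 𝓘(ℝ, E) ∞ (fun y =>
        _root_.mder I 𝓘(ℝ, E) (extChartAt I (b x)) (b y) (v y)) x := by
  rw [SmoothAlong, Bundle.contMDiffAt_totalSpace]
  refine and_congr_right fun hb => ?_
  apply Filter.EventuallyEq.contMDiffAt_iff
  filter_upwards [hb.continuousAt (chart_source_mem_nhds H (b x))] with y hy
  have := TangentBundle.continuousLinearMapAt_trivializationAt (I := I) hy
  rw [mder, ← this]
  exact (congrFun (Bundle.Trivialization.coe_linearMapAt_of_mem (R := ℝ)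
    (trivializationAt E (TangentSpace I) (b x)) hy) (v y)).symm

lemma SmoothAlong.comp {P : Type*} [TopologicalSpace P] {F K : Type*} [NormedAddCommGroup F]
    [NormedSpace ℝ F] [TopologicalSpace K] {L : ModelWithCorners ℝ F K} [ChartedSpace K P]
    {b : N → M} {v : N → E} {c : P → N} {x : P} (hv : SmoothAlong J I b v (c x))
    (hc : ContMDiffAt L J ∞ c x) :
    SmoothAlong L I (fun y => b (c y)) (fun y => v (c y)) x :=
  ContMDiffAt.comp x (f := c) hv hc

lemma SmoothAlong.congr {b b' : N → M} {v v' : N → E} {x : N} (hv : SmoothAlong J I b v x)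
    (hb : b' =ᶠ[𝓝 x] b) (hv' : v' =ᶠ[𝓝 x] v) : SmoothAlong J I b' v' x := by
  refine ContMDiffAt.congr_of_eventuallyEq hv ?_
  filter_upwards [hb, hv'] with y h h'
  rw [h, h']

lemma smoothAlong_const (p : M) (v : E) (x : N) :
    SmoothAlong J I (fun _ => p) (fun _ => v) x := contMDiffAt_const

lemma SmoothAlong.add {b : N → M} {v w : N → E} {x : N} (hv : SmoothAlong J I b v x)
    (hw : SmoothAlong J I b w x) : SmoothAlong J I b (fun y => v y + w y) x := by
  rw [smoothAlong_iff] at *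
  refine ⟨hv.1, ?_⟩
  simp only [map_add]
  exact hv.2.add hw.2

lemma SmoothAlong.const_smul {b : N → M} {v : N → E} {x : N} (c : ℝ)
    (hv : SmoothAlong J I b v x) : SmoothAlong J I b (fun y => c • v y) x := by
  rw [smoothAlong_iff] at *
  refine ⟨hv.1, ?_⟩
  simp only [map_smul]
  exact (contMDiffAt_const : ContMDiffAt J 𝓘(ℝ, ℝ) ∞ (fun _ => c) x).smul hv.2

lemma smoothAlong_zero {b : N → M} {x : N} (hb : ContMDiffAt J I ∞ b x) :
    SmoothAlong J I b (fun _ => 0) x := by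
  rw [smoothAlong_iff]
  refine ⟨hb, ?_⟩
  simp only [map_zero]
  exact contMDiffAt_const

lemma SmoothAlong.prodMk {b : N → M} {v : N → E} {b' : N → M'} {v' : N → E'} {x : N}
    (hv : SmoothAlong J I b v x) (hv' : SmoothAlong J I' b' v' x) :
    SmoothAlong J (I.prod I') (fun y => (b y, b' y)) (fun y => (v y, v' y)) x :=
  ContMDiffAt.comp (f := fun y => ((⟨b y, v y⟩ : TangentBundle I M),
    (⟨b' y, v' y⟩ : TangentBundle I' M')))
    (g := (equivTangentBundleProd I M I' M').symm) x
    contMDiff_equivTangentBundleProd_symm.contMDiffAt (ContMDiffAt.prodMk hv hv')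

/-- A smooth vector along a constant map is a smooth function. -/
lemma SmoothAlong.of_const {p : M} {v : N → E} {x : N}
    (hv : SmoothAlong J I (fun _ => p) v x) : ContMDiffAt J 𝓘(ℝ, E) ∞ v x := by
  have h := (smoothAlong_iff.1 hv).2
  obtain ⟨e, he⟩ := isInvertible_mfderiv_extChartAt (I := I) (mem_extChartAt_source (I := I) p)
  let L : E →L[ℝ] E := (e.symm : TangentSpace 𝓘(ℝ, E) (extChartAt I p p) →L[ℝ] TangentSpace I p)
  refine (L.contMDiff.contMDiffAt.comp x h).congr_of_eventuallyEq
    (Eventually.of_forall fun y => ?_)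
  have h1 : _root_.mder I 𝓘(ℝ, E) (extChartAt I p) p (v y) = e (v y) :=
    congrArg (fun L : E →L[ℝ] E => L (v y)) he.symm
  have h2 : L (e (v y)) = v y := e.symm_apply_apply (v y)
  exact h2.symm.trans (congrArg L h1.symm)

lemma mder_extChartAt_injective (p : M) :
    Function.Injective (_root_.mder I 𝓘(ℝ, E) (extChartAt I p) p) := by
  obtain ⟨e, he⟩ := isInvertible_mfderiv_extChartAt (I := I) (mem_extChartAt_source (I := I) p)
  intro v w h
  exact e.injective ((congrArg (fun L : E →L[ℝ] E => L v) he).trans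
    (h.trans (congrArg (fun L : E →L[ℝ] E => L w) he).symm))

section Bracket

variable [I.Boundaryless] [CompleteSpace E]

/-- The derivative of a function along a Lie bracket is the commutator of the derivatives. -/
lemma mder_mbr {F : Type*} [NormedAddCommGroup F] [NormedSpace ℝ F] {f : M → F} {V W : M → E}
    {x : M} (hf : ContMDiffAt I 𝓘(ℝ, F) ∞ f x) (hV : SmoothAlong I I (fun y => y) V x)
    (hW : SmoothAlong I I (fun y => y) W x) :
    _root_.mder I 𝓘(ℝ, F) f x (mbr I V W x) =
      _root_.mder I 𝓘(ℝ, F) (fun y => _root_.mder I 𝓘(ℝ, F) f y (W y)) x (V x) -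
      _root_.mder I 𝓘(ℝ, F) (fun y => _root_.mder I 𝓘(ℝ, F) f y (V y)) x (W x) := by
  set φ := extChartAt I x with hφ
  have hr : Set.range I = Set.univ := I.range_eq_univ
  -- `V'` and `W'` represent `V` and `W` in the chart `φ`
  let S : E → (E →L[ℝ] E) := fun e => mfderiv 𝓘(ℝ, E) I φ.symm e
  let V' : E → E := fun e => (S e).inverse (V (φ.symm e))
  let W' : E → E := fun e => (S e).inverse (W (φ.symm e))
  have claim : ∀ (g : M → F), ∀ e ∈ φ.target, MDifferentiableAt I 𝓘(ℝ, F) g (φ.symm e) →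
      ∀ w : E, fderiv ℝ (fun e => g (φ.symm e)) e ((S e).inverse w)
        = _root_.mder I 𝓘(ℝ, F) g (φ.symm e) w := by
    intro g e he hg w
    have h1 : MDifferentiableAt 𝓘(ℝ, E) I φ.symm e := by
      have := mdifferentiableWithinAt_extChartAt_symm (I := I) he
      rwa [hr, mdifferentiableWithinAt_univ] at this
    have h2 : (S e).IsInvertible := by
      have := isInvertible_mfderivWithin_extChartAt_symm (I := I) he
      rwa [hr, mfderivWithin_univ] at this
    have h3 : S e ((S e).inverse w) = w := by
      have := h2.self_comp_inverse
      exact congrArg (fun L : E →L[ℝ] E => L w) this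
    have h4 := mder_comp hg h1 ((S e).inverse w)
    have h5 : _root_.mder 𝓘(ℝ, E) 𝓘(ℝ, F) (fun e => g (φ.symm e)) e
        = fderiv ℝ (fun e => g (φ.symm e)) e := mfderiv_eq_fderiv
    rw [← h5, h4]
    exact congrArg _ h3
  have hx : φ x ∈ φ.target := mem_extChartAt_target x
  have hxx : φ.symm (φ x) = x := extChartAt_to_inv x
  have hdiff : ∀ U : M → E, SmoothAlong I I (fun y => y) U x →
      DifferentiableAt ℝ (fun e => (S e).inverse (U (φ.symm e))) (φ x) := by
    intro U hU
    have h := MDifferentiableWithinAt.differentiableWithinAt_mpullbackWithin_vectorField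
      (I := I) (V := U) (x := x) (s := Set.univ)
      (ContMDiffAt.mdifferentiableAt hU (by simp)).mdifferentiableWithinAt
    rw [Set.preimage_univ, Set.univ_inter, hr] at h
    refine (differentiableWithinAt_univ.1 h).congr_of_eventuallyEq
      (Eventually.of_forall fun e => ?_)
    change (S e).inverse (U (φ.symm e)) =
      (mfderivWithin 𝓘(ℝ, E) I φ.symm Set.univ e).inverse (U (φ.symm e))
    rw [mfderivWithin_univ]
    rfl
  have hf' : ∀ᶠ e in 𝓝 (φ x), e ∈ φ.target ∧ MDifferentiableAt I 𝓘(ℝ, F) f (φ.symm e) := by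
    have h1 : ∀ᶠ y in 𝓝 x, ContMDiffAt I 𝓘(ℝ, F) 1 f y :=
      (contMDiffAt_iff_contMDiffAt_nhds (by simp)).1
        (ContMDiffAt.of_le (m := 1) hf (by simp))
    have h2 : Tendsto φ.symm (𝓝 (φ x)) (𝓝 x) := by
      have := continuousAt_extChartAt_symm (I := I) x
      rwa [ContinuousAt, hxx] at this
    filter_upwards [extChartAt_target_mem_nhds (I := I) x, h2.eventually h1] with e he he'
    exact ⟨he, he'.mdifferentiableAt (by simp)⟩
  have hfs : ContDiffAt ℝ ∞ (fun e => f (φ.symm e)) (φ x) := by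
    have h1 : ContMDiffAt 𝓘(ℝ, E) I ∞ φ.symm (φ x) := by
      have := contMDiffWithinAt_extChartAt_symm_range (I := I) (n := ∞) x hx
      rwa [hr, contMDiffWithinAt_univ] at this
    exact (ContMDiffAt.comp (φ x) (by rw [hxx]; exact hf) h1).contDiffAt
  -- the bracket is computed in the chart `φ`
  have hb : _root_.mder I 𝓘(ℝ, F) f x (mbr I V W x)
      = fderiv ℝ (fun e => f (φ.symm e)) (φ x) (lieBracket ℝ V' W' (φ x)) := by
    have h1 : _root_.mder I 𝓘(ℝ, E) φ x (mbr I V W x) = lieBracket ℝ V' W' (φ x) := by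
      have h2 : (mfderiv I 𝓘(ℝ, E) φ x).IsInvertible :=
        isInvertible_mfderiv_extChartAt (mem_extChartAt_source x)
      have h3 : mbr I V W x = (mfderiv I 𝓘(ℝ, E) φ x).inverse
          (lieBracket ℝ V' W' (φ x) : E) := by
        have h4 := mlieBracketWithin_apply (I := I) (V := V) (W := W) (s := Set.univ) (x₀ := x)
        refine h4.trans (congrArg _ ?_)
        rw [Set.preimage_univ, Set.univ_inter, hr, ← lieBracketWithin_univ]
        have h5 : ∀ U : M → E, mpullbackWithin 𝓘(ℝ, E) I φ.symm U Set.univ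
            = fun e => (S e).inverse (U (φ.symm e)) := fun U => by
          funext e
          change (mfderivWithin 𝓘(ℝ, E) I φ.symm Set.univ e).inverse (U (φ.symm e)) = _
          rw [mfderivWithin_univ]
          rfl
        exact congrArg₂ (fun A B => lieBracketWithin ℝ A B Set.univ (φ x)) (h5 V) (h5 W)
      rw [h3]
      exact congrArg (fun L : E →L[ℝ] E => L (lieBracket ℝ V' W' (φ x))) h2.self_comp_inverse
    rw [← h1]
    have h6 : f =ᶠ[𝓝 x] fun y => f (φ.symm (φ y)) := by
      filter_upwards [extChartAt_source_mem_nhds (I := I) x] with y hy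
      rw [φ.left_inv hy]
    rw [mder_congr h6]
    refine (mder_comp (I := 𝓘(ℝ, E)) (J := I) (I' := 𝓘(ℝ, F)) (g := fun e => f (φ.symm e)) (f := φ)
      (hfs.differentiableAt (by simp)).mdifferentiableAt
      (mdifferentiableAt_extChartAt (mem_chart_source H x)) _).trans ?_
    exact congrArg (fun L : E →L[ℝ] F => L _) mfderiv_eq_fderiv
  have hout : ∀ U U₂ : M → E, SmoothAlong I I (fun y => y) U x →
      _root_.mder I 𝓘(ℝ, F) (fun y => _root_.mder I 𝓘(ℝ, F) f y (U y)) x (U₂ x) =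
      fderiv ℝ (fun e => fderiv ℝ (fun e => f (φ.symm e)) e ((S e).inverse (U (φ.symm e)))) (φ x)
        ((S (φ x)).inverse (U₂ (φ.symm (φ x)))) := by
    intro U U₂ hU
    have h1 : MDifferentiableAt I 𝓘(ℝ, F) (fun y => _root_.mder I 𝓘(ℝ, F) f y (U y)) x :=
      (smoothAlong_vectorSpace (hU.mder hf)).mdifferentiableAt (by simp)
    have h2 := claim (fun y => _root_.mder I 𝓘(ℝ, F) f y (U y)) (φ x) hx (by rwa [hxx])
      (U₂ (φ.symm (φ x)))
    rw [hxx] at h2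
    rw [hxx, ← h2]
    congr 1
    apply Filter.EventuallyEq.fderiv_eq
    filter_upwards [hf'] with e he
    exact (claim f e he.1 he.2 _).symm
  rw [hb, fderiv_apply_lieBracket (n := ∞) hfs (by simpa using two_le_infty) (hdiff W hW)
    (hdiff V hV), hout W V hW, hout V W hV]

/-- Brackets of `f`-related vector fields are `f`-related. -/
lemma mder_mbr_of_related [I'.Boundaryless] [CompleteSpace E'] {f : M → M'} {V W : M → E}
    {V' W' : M' → E'} {x : M} (hf : ContMDiffAt I I' ∞ f x)
    (hV : SmoothAlong I I (fun y => y) V x) (hW : SmoothAlong I I (fun y => y) W x)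
    (hV' : SmoothAlong I' I' (fun y => y) V' (f x)) (hW' : SmoothAlong I' I' (fun y => y) W' (f x))
    (hVV' : ∀ᶠ y in 𝓝 x, _root_.mder I I' f y (V y) = V' (f y))
    (hWW' : ∀ᶠ y in 𝓝 x, _root_.mder I I' f y (W y) = W' (f y)) :
    _root_.mder I I' f x (mbr I V W x) = mbr I' V' W' (f x) := by
  apply mder_extChartAt_injective (I := I') (f x)
  set ψ := extChartAt I' (f x)
  have hψ : ContMDiffAt I' 𝓘(ℝ, E') ∞ ψ (f x) := contMDiffAt_extChartAt
  have hψf : ContMDiffAt I 𝓘(ℝ, E') ∞ (fun y => ψ (f y)) x := hψ.comp x hf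
  have hfd : ∀ᶠ y in 𝓝 x, MDifferentiableAt I I' f y := by
    filter_upwards [(contMDiffAt_iff_contMDiffAt_nhds (by simp)).1
      (ContMDiffAt.of_le (m := 1) hf (by simp))] with y hy
    exact hy.mdifferentiableAt (by simp)
  have hψd : ∀ᶠ y in 𝓝 x, MDifferentiableAt I' 𝓘(ℝ, E') ψ (f y) := by
    refine hf.continuousAt.eventually ?_
    filter_upwards [(contMDiffAt_iff_contMDiffAt_nhds (by simp)).1
      (ContMDiffAt.of_le (m := 1) hψ (by simp))] with y hy
    exact hy.mdifferentiableAt (by simp)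
  have hout : ∀ (U U₂ : M → E) (U' U₂' : M' → E'), SmoothAlong I' I' (fun y => y) U' (f x) →
      (∀ᶠ y in 𝓝 x, _root_.mder I I' f y (U y) = U' (f y)) →
      _root_.mder I I' f x (U₂ x) = U₂' (f x) →
      _root_.mder I 𝓘(ℝ, E') (fun y => _root_.mder I 𝓘(ℝ, E') (fun y => ψ (f y)) y (U y)) x (U₂ x)
      = _root_.mder I' 𝓘(ℝ, E') (fun z => _root_.mder I' 𝓘(ℝ, E') ψ z (U' z)) (f x)
        (U₂' (f x)) := by
    intro U U₂ U' U₂' hU' hUU' hU₂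
    have h1 : (fun y => _root_.mder I 𝓘(ℝ, E') (fun y => ψ (f y)) y (U y)) =ᶠ[𝓝 x]
        fun y => _root_.mder I' 𝓘(ℝ, E') ψ (f y) (U' (f y)) := by
      filter_upwards [hUU', hfd, hψd] with y h1 h2 h3
      rw [mder_comp h3 h2, h1]
    rw [mder_congr h1, ← hU₂]
    exact mder_comp (g := fun z => _root_.mder I' 𝓘(ℝ, E') ψ z (U' z))
      ((smoothAlong_vectorSpace (hU'.mder hψ)).mdifferentiableAt (by simp))
      (hf.mdifferentiableAt (by simp)) _
  rw [← mder_comp hψd.self_of_nhds hfd.self_of_nhds, mder_mbr hψf hV hW, mder_mbr hψ hV' hW',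
    hout W V W' V' hW' hWW' hVV'.self_of_nhds, hout V W V' W' hV' hVV' hWW'.self_of_nhds]

end Bracket
end

end Calculus

section SmoothFields

variable {k : ℕ} {M : Type*} [TopologicalSpace M] [ChartedSpace (EuclideanSpace ℝ (Fin k)) M]

local notation "𝔼" => EuclideanSpace ℝ (Fin k)

lemma mbr_swap (V W : M → 𝔼) (x : M) : mbr (𝓡 k) V W x = -mbr (𝓡 k) W V x :=
  mlieBracket_swap_apply

lemma mbr_self (V : M → 𝔼) (x : M) : mbr (𝓡 k) V V x = 0 :=
  congrFun mlieBracket_self x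

lemma mbr_zero_left (W : M → 𝔼) (x : M) : mbr (𝓡 k) (fun _ => 0) W x = 0 :=
  congrFun (mlieBracket_zero_left (I := 𝓡 k) (W := W)) x

lemma mbr_zero_right (W : M → 𝔼) (x : M) : mbr (𝓡 k) W (fun _ => 0) x = 0 :=
  congrFun (mlieBracket_zero_right (I := 𝓡 k) (W := W)) x

variable [IsManifold (𝓡 k) ∞ M]

lemma isManifold_minSmoothness : IsManifold (𝓡 k) (minSmoothness ℝ 3) M := by
  rw [minSmoothness_of_isRCLikeNormedField]; infer_instance

lemma IsSmoothField.add {V W : M → 𝔼} (hV : IsSmoothField (k := k) V)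
    (hW : IsSmoothField (k := k) W) : IsSmoothField (k := k) (fun x => V x + W x) :=
  fun x => SmoothAlong.add (hV x) (hW x)

lemma IsSmoothField.const_smul {V : M → 𝔼} (c : ℝ) (hV : IsSmoothField (k := k) V) :
    IsSmoothField (k := k) (fun x => c • V x) :=
  fun x => SmoothAlong.const_smul c (hV x)

lemma IsSmoothField.neg {V : M → 𝔼} (hV : IsSmoothField (k := k) V) :
    IsSmoothField (k := k) (fun x => -V x) := by
  simpa only [neg_one_smul] using hV.const_smul (-1)

lemma isSmoothField_zero : IsSmoothField (k := k) (fun _ : M => (0 : 𝔼)) :=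
  fun _ => smoothAlong_zero contMDiffAt_id

lemma IsSmoothField.mdiff {V : M → 𝔼} (hV : IsSmoothField (k := k) V) (x : M) :
    MDifferentiableAt (𝓡 k) (𝓡 k).tangent (fun y => (⟨y, V y⟩ : TangentBundle (𝓡 k) M)) x :=
  (hV x).mdifferentiableAt (by simp)

lemma IsSmoothField.mbr {V W : M → 𝔼} (hV : IsSmoothField (k := k) V)
    (hW : IsSmoothField (k := k) W) : IsSmoothField (k := k) (_root_.mbr (𝓡 k) V W) :=
  have : IsManifold (𝓡 k) (minSmoothness ℝ 3) M := isManifold_minSmoothness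
  have : IsManifold (𝓡 k) ((∞ : WithTop ℕ∞) + 1) M := inferInstanceAs (IsManifold (𝓡 k) ∞ M)
  fun x => ContMDiffAt.mlieBracket_vectorField (n := ⊤) (m := ⊤) (hV x) (hW x) (by simp)

lemma mbr_add_left {V V' W : M → 𝔼} (hV : IsSmoothField (k := k) V)
    (hV' : IsSmoothField (k := k) V') (x : M) :
    mbr (𝓡 k) (fun y => V y + V' y) W x = mbr (𝓡 k) V W x + mbr (𝓡 k) V' W x :=
  mlieBracket_add_left (hV.mdiff x) (hV'.mdiff x)

lemma mbr_add_right {V W W' : M → 𝔼} (hW : IsSmoothField (k := k) W)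
    (hW' : IsSmoothField (k := k) W') (x : M) :
    mbr (𝓡 k) V (fun y => W y + W' y) x = mbr (𝓡 k) V W x + mbr (𝓡 k) V W' x :=
  mlieBracket_add_right (hW.mdiff x) (hW'.mdiff x)

lemma mbr_smul_left {V W : M → 𝔼} (c : ℝ) (hV : IsSmoothField (k := k) V) (x : M) :
    mbr (𝓡 k) (fun y => c • V y) W x = c • mbr (𝓡 k) V W x :=
  mlieBracket_const_smul_left (hV.mdiff x)

lemma mbr_smul_right {V W : M → 𝔼} (c : ℝ) (hW : IsSmoothField (k := k) W) (x : M) :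
    mbr (𝓡 k) V (fun y => c • W y) x = c • mbr (𝓡 k) V W x :=
  mlieBracket_const_smul_right (hW.mdiff x)

lemma mbr_jacobi {U V W : M → 𝔼} (hU : IsSmoothField (k := k) U) (hV : IsSmoothField (k := k) V)
    (hW : IsSmoothField (k := k) W) (x : M) :
    mbr (𝓡 k) U (mbr (𝓡 k) V W) x
      = mbr (𝓡 k) (mbr (𝓡 k) U V) W x + mbr (𝓡 k) V (mbr (𝓡 k) U W) x := by
  have h : minSmoothness ℝ 2 ≤ (∞ : WithTop ℕ∞) := by simpa using two_le_infty
  have : IsManifold (𝓡 k) (minSmoothness ℝ 3) M := isManifold_minSmoothness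
  exact leibniz_identity_mlieBracket_apply ((hU x).of_le h) ((hV x).of_le h) ((hW x).of_le h)

end SmoothFields

/-! ### The manifold of composable pairs -/

section Submersion

variable {E H M E' H' M' F : Type*}
  [NormedAddCommGroup E] [NormedSpace ℝ E] [TopologicalSpace H] {I : ModelWithCorners ℝ E H}
  [TopologicalSpace M] [ChartedSpace H M]
  [NormedAddCommGroup E'] [NormedSpace ℝ E'] [TopologicalSpace H'] {I' : ModelWithCorners ℝ E' H'}
  [TopologicalSpace M'] [ChartedSpace H' M'] [NormedAddCommGroup F] [NormedSpace ℝ F]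

/-- A submersion `f` can be solved for its value near `p`: there is a smooth `l` with
`f (l (p', y)) = y` and `l (p', f p') = p'`. -/
lemma exists_fiber_adjustment [I.Boundaryless] [IsManifold I ∞ M] [IsManifold I' ∞ M'] {f : M → M'}
    {p : M} (hf : Manifold.IsSubmersionAtOfComplement F I I' ∞ f p) :
    ∃ l : M × M' → M, ContMDiffAt (I.prod I') I ∞ l (p, f p) ∧
      (∀ᶠ a in 𝓝 (p, f p), f (l a) = a.2) ∧ ∀ᶠ p' in 𝓝 p, l (p', f p') = p' := by
  set Φ := hf.domChart.extend I with hΦ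
  set Ψ := hf.codChart.extend I' with hΨ
  set e := hf.equiv
  have hpΦ : p ∈ Φ.source := by
    rw [hΦ, OpenPartialHomeomorph.extend_source]; exact hf.mem_domChart_source
  have hΦs : ContMDiffAt I 𝓘(ℝ, E) ∞ Φ p :=
    OpenPartialHomeomorph.contMDiffAt_extend hf.domChart_mem_maximalAtlas hf.mem_domChart_source
  have hΨs : ContMDiffAt I' 𝓘(ℝ, E') ∞ Ψ (f p) :=
    OpenPartialHomeomorph.contMDiffAt_extend hf.codChart_mem_maximalAtlas hf.mem_codChart_source
  have hto : IsOpen Φ.target := hf.domChart.isOpen_extend_target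
  have hΦt : ContMDiffAt 𝓘(ℝ, E) I ∞ Φ.symm (Φ p) :=
    (contMDiffOn_extend_symm hf.domChart_mem_maximalAtlas).contMDiffAt (by
      rw [← hf.domChart.extend_target']
      exact hto.mem_nhds (Φ.map_source hpΦ))
  have hval : ∀ p' ∈ Φ.source, Ψ (f p') = (e (Φ p')).1 := fun p' hp' => by
    have := hf.writtenInCharts (Φ.map_source hp')
    simp only [Function.comp_apply] at this
    rw [← this]
    change _ = Ψ (f (Φ.symm (Φ p')))
    rw [Φ.left_inv hp']
  let w : M × M' → E := fun a => e.symm (Ψ a.2, (e (Φ a.1)).2)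
  have hw0 : w (p, f p) = Φ p := by
    simp only [w]
    rw [hval p hpΦ, Prod.mk.eta, e.symm_apply_apply]
  have hws : ContMDiffAt (I.prod I') 𝓘(ℝ, E) ∞ w (p, f p) := by
    have h1 : ContMDiffAt (I.prod I') 𝓘(ℝ, E') ∞ (fun a : M × M' => Ψ a.2) (p, f p) :=
      ContMDiffAt.comp (p, f p) (g := Ψ) hΨs contMDiffAt_snd
    have h2 : ContMDiffAt (I.prod I') 𝓘(ℝ, E) ∞ (fun a : M × M' => Φ a.1) (p, f p) :=
      ContMDiffAt.comp (p, f p) (g := Φ) hΦs contMDiffAt_fst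
    have h3 : ContMDiffAt (I.prod I') 𝓘(ℝ, F) ∞ (fun a : M × M' => (e (Φ a.1)).2) (p, f p) :=
      ((ContinuousLinearMap.snd ℝ E' F).comp (e : E →L[ℝ] E' × F)).contMDiff.contMDiffAt.comp _ h2
    exact (e.symm : E' × F →L[ℝ] E).contMDiff.contMDiffAt.comp _ (h1.prodMk_space h3)
  have hwt : ∀ᶠ a in 𝓝 (p, f p), w a ∈ Φ.target :=
    hws.continuousAt.eventually (by rw [hw0]; exact hto.mem_nhds (Φ.map_source hpΦ))
  refine ⟨fun a => Φ.symm (w a), ContMDiffAt.comp (p, f p) (by rw [hw0]; exact hΦt) hws, ?_, ?_⟩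
  · have h1 : ∀ᶠ a in 𝓝 (p, f p), a.2 ∈ Ψ.source := by
      refine continuousAt_snd.eventually ?_
      rw [hΨ, OpenPartialHomeomorph.extend_source]
      exact hf.codChart.open_source.mem_nhds hf.mem_codChart_source
    filter_upwards [hwt, h1] with a ha ha'
    have h2 : Φ.symm (w a) ∈ Φ.source := Φ.map_target ha
    apply Ψ.injOn _ ha'
    · rw [hval _ h2, Φ.right_inv ha]
      simp [w]
    · rw [hΨ, OpenPartialHomeomorph.extend_source]
      rw [hΦ, OpenPartialHomeomorph.extend_source] at h2
      exact hf.source_subset_preimage_source h2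
  · have h1 : ∀ᶠ p' in 𝓝 p, p' ∈ Φ.source := by
      rw [hΦ, OpenPartialHomeomorph.extend_source]
      exact hf.domChart.open_source.mem_nhds hf.mem_domChart_source
    filter_upwards [h1] with p' hp'
    simp only [w]
    rw [hval p' hp', Prod.mk.eta, e.symm_apply_apply, Φ.left_inv hp']

end Submersion

namespace LieGroupoid

variable {n₀ n₁ : ℕ} {X₀ X₁ : Type*}
  [TopologicalSpace X₀] [ChartedSpace (EuclideanSpace ℝ (Fin n₀)) X₀] [IsManifold (𝓡 n₀) ∞ X₀]
  [TopologicalSpace X₁] [ChartedSpace (EuclideanSpace ℝ (Fin n₁)) X₁] [IsManifold (𝓡 n₁) ∞ X₁]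
  (X : LieGroupoid n₀ n₁ X₀ X₁)

local notation "𝔼₀" => EuclideanSpace ℝ (Fin n₀)
local notation "𝔼₁" => EuclideanSpace ℝ (Fin n₁)

/-- The derivative of the source map. -/
def ds (p : X₁) : 𝔼₁ →L[ℝ] 𝔼₀ := mder (𝓡 n₁) (𝓡 n₀) X.s p
/-- The derivative of the target map. -/
def dt (p : X₁) : 𝔼₁ →L[ℝ] 𝔼₀ := mder (𝓡 n₁) (𝓡 n₀) X.t p
/-- The derivative of the inversion. -/
def di (p : X₁) : 𝔼₁ →L[ℝ] 𝔼₁ := mder (𝓡 n₁) (𝓡 n₁) X.i p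
/-- The derivative of the unit map. -/
def du (x : X₀) : 𝔼₀ →L[ℝ] 𝔼₁ := mder (𝓡 n₀) (𝓡 n₁) X.u x
/-- The first component of a vector tangent to `X₂`. -/
def dpr₁ (z : X.Comp) : EuclideanSpace ℝ (Fin X.n₂) →L[ℝ] 𝔼₁ :=
  mder (𝓡 X.n₂) (𝓡 n₁) (fun z : X.Comp => z.1.1) z
/-- The second component of a vector tangent to `X₂`. -/
def dpr₂ (z : X.Comp) : EuclideanSpace ℝ (Fin X.n₂) →L[ℝ] 𝔼₁ :=
  mder (𝓡 X.n₂) (𝓡 n₁) (fun z : X.Comp => z.1.2) z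

open Classical in
/-- The composition of arrows, extended by the junk value `p` to pairs that are not composable. -/
def pmul (p q : X₁) : X₁ := if h : X.s p = X.t q then X.m ⟨(p, q), h⟩ else p

open Classical in
/-- The composition of the tangent groupoid at a pair of arrows, with junk value `0` if these are
not composable. -/
def tmul (p q : X₁) (v w : 𝔼₁) : 𝔼₁ :=
  if h : X.s p = X.t q then X.tangentMul ⟨(p, q), h⟩ v w else 0

variable {X}

lemma pmul_eq {p q : X₁} (h : X.s p = X.t q) : X.pmul p q = X.m ⟨(p, q), h⟩ := dif_pos h

lemma tmul_eq {p q : X₁} (h : X.s p = X.t q) (v w : 𝔼₁) :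
    X.tmul p q v w = X.tangentMul ⟨(p, q), h⟩ v w := dif_pos h

lemma mdiff_s (p : X₁) : MDifferentiableAt (𝓡 n₁) (𝓡 n₀) X.s p :=
  (X.s_smooth p).mdifferentiableAt (by simp)
lemma mdiff_t (p : X₁) : MDifferentiableAt (𝓡 n₁) (𝓡 n₀) X.t p :=
  (X.t_smooth p).mdifferentiableAt (by simp)
lemma mdiff_i (p : X₁) : MDifferentiableAt (𝓡 n₁) (𝓡 n₁) X.i p :=
  (X.i_smooth p).mdifferentiableAt (by simp)
lemma mdiff_u (x : X₀) : MDifferentiableAt (𝓡 n₀) (𝓡 n₁) X.u x :=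
  (X.u_smooth x).mdifferentiableAt (by simp)
lemma mdiff_m (z : X.Comp) : MDifferentiableAt (𝓡 X.n₂) (𝓡 n₁) X.m z :=
  (X.m_smooth z).mdifferentiableAt (by simp)

lemma contMDiff_val : ContMDiff (𝓡 X.n₂) ((𝓡 n₁).prod (𝓡 n₁)) ∞
    (Subtype.val : X.Comp → X₁ × X₁) := X.embedding₂.isImmersion.contMDiff
lemma contMDiff_pr₁ : ContMDiff (𝓡 X.n₂) (𝓡 n₁) ∞ (fun z : X.Comp => z.1.1) :=
  contMDiff_fst.comp contMDiff_val
lemma contMDiff_pr₂ : ContMDiff (𝓡 X.n₂) (𝓡 n₁) ∞ (fun z : X.Comp => z.1.2) :=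
  contMDiff_snd.comp contMDiff_val
lemma mdiff_pr₁ (z : X.Comp) :
    MDifferentiableAt (𝓡 X.n₂) (𝓡 n₁) (fun z : X.Comp => z.1.1) z :=
  (contMDiff_pr₁ z).mdifferentiableAt (by simp)
lemma mdiff_pr₂ (z : X.Comp) :
    MDifferentiableAt (𝓡 X.n₂) (𝓡 n₁) (fun z : X.Comp => z.1.2) z :=
  (contMDiff_pr₂ z).mdifferentiableAt (by simp)

open Classical in
/-- The family of composable pairs `(f y, g y)`, with junk value `z₀` where these are not
composable. -/
def pairOr {N : Type*} (z₀ : X.Comp) (f g : N → X₁) (y : N) : X.Comp :=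
  if h : X.s (f y) = X.t (g y) then ⟨(f y, g y), h⟩ else z₀

lemma pairOr_val {N : Type*} {z₀ : X.Comp} {f g : N → X₁} {y : N} (h : X.s (f y) = X.t (g y)) :
    pairOr z₀ f g y = ⟨(f y, g y), h⟩ := dif_pos h

section Families

variable {E H N : Type*} [NormedAddCommGroup E] [NormedSpace ℝ E] [TopologicalSpace H]
    {J : ModelWithCorners ℝ E H} [TopologicalSpace N] [ChartedSpace H N]

lemma contMDiffAt_pairOr (z₀ : X.Comp) {f g : N → X₁} {y : N}
    (hf : ContMDiffAt J (𝓡 n₁) ∞ f y) (hg : ContMDiffAt J (𝓡 n₁) ∞ g y)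
    (h : ∀ᶠ y' in 𝓝 y, X.s (f y') = X.t (g y')) :
    ContMDiffAt J (𝓡 X.n₂) ∞ (pairOr z₀ f g) y := by
  have h1 : (fun y' => (pairOr z₀ f g y').1) =ᶠ[𝓝 y] fun y' => (f y', g y') := by
    filter_upwards [h] with y' hy'
    rw [pairOr_val hy']
  have h2 : ContMDiffAt J ((𝓡 n₁).prod (𝓡 n₁)) ∞ (fun y' => (pairOr z₀ f g y').1) y :=
    (hf.prodMk hg).congr_of_eventuallyEq h1
  rw [ContMDiffAt.iff_comp_isImmersionAt (X.embedding₂.isImmersion.isImmersionAt _)]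
  exact ⟨X.embedding₂.isEmbedding.isInducing.continuousAt_iff.2 h2.continuousAt, h2⟩

end Families

/-- Near a composable pair, `X₁ × X₁` retracts smoothly onto `X₂`, by changing the first arrow
of a pair only. -/
lemma exists_retraction (z₀ : X.Comp) :
    ∃ R : X₁ × X₁ → X.Comp, ContMDiffAt ((𝓡 n₁).prod (𝓡 n₁)) (𝓡 X.n₂) ∞ R z₀.1 ∧
      (∀ᶠ a in 𝓝 z₀.1, (R a).1.2 = a.2) ∧ (∀ᶠ z : X.Comp in 𝓝 z₀, R z.1 = z) ∧
      ∀ v w : 𝔼₁, X.ds z₀.1.1 v = X.dt z₀.1.2 w →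
        mder ((𝓡 n₁).prod (𝓡 n₁)) (𝓡 n₁) (fun a => (R a).1.1) z₀.1 (v, w) = v := by
  obtain ⟨F, _, _, hF⟩ := X.s_submersion.isSubmersionAt z₀.1.1
  obtain ⟨l, hl, hl1, hl2⟩ := exists_fiber_adjustment hF
  have hc : (z₀.1.1, X.s z₀.1.1) = (z₀.1.1, X.t z₀.1.2) := by rw [z₀.2]
  have hp : ContMDiffAt ((𝓡 n₁).prod (𝓡 n₁)) ((𝓡 n₁).prod (𝓡 n₀)) ∞
      (fun a : X₁ × X₁ => (a.1, X.t a.2)) z₀.1 :=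
    contMDiffAt_fst.prodMk (X.t_smooth.contMDiffAt.comp z₀.1 contMDiffAt_snd)
  have hf : ContMDiffAt ((𝓡 n₁).prod (𝓡 n₁)) (𝓡 n₁) ∞ (fun a : X₁ × X₁ => l (a.1, X.t a.2))
      z₀.1 := ContMDiffAt.comp z₀.1 (g := l) (by rw [← hc]; exact hl) hp
  have hcomp : ∀ᶠ a : X₁ × X₁ in 𝓝 z₀.1, X.s (l (a.1, X.t a.2)) = X.t a.2 := by
    have h1 := hp.continuousAt
    rw [ContinuousAt, ← hc] at h1
    exact h1.eventually hl1
  refine ⟨pairOr z₀ (fun a : X₁ × X₁ => l (a.1, X.t a.2)) (fun a => a.2),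
    contMDiffAt_pairOr z₀ hf contMDiffAt_snd hcomp, ?_, ?_, ?_⟩
  · filter_upwards [hcomp] with a ha
    rw [pairOr_val ha]
  · have h1 : Tendsto (fun z : X.Comp => z.1.1) (𝓝 z₀) (𝓝 z₀.1.1) :=
      (continuous_fst.comp continuous_subtype_val).continuousAt
    filter_upwards [h1.eventually hl2] with z hz
    have h2 : l (z.1.1, X.t z.1.2) = z.1.1 := by rw [← z.2]; exact hz
    have h3 : X.s (l (z.1.1, X.t z.1.2)) = X.t z.1.2 := by rw [h2]; exact z.2
    rw [pairOr_val h3]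
    apply Subtype.ext
    exact Prod.ext h2 rfl
  · intro v w hvw
    have h1 : (fun a => (pairOr z₀ (fun a : X₁ × X₁ => l (a.1, X.t a.2)) (fun a => a.2) a).1.1)
        =ᶠ[𝓝 z₀.1] fun a => l (a.1, X.t a.2) := by
      filter_upwards [hcomp] with a ha
      rw [pairOr_val ha]
    have hld : MDifferentiableAt ((𝓡 n₁).prod (𝓡 n₀)) (𝓡 n₁) l (z₀.1.1, X.s z₀.1.1) :=
      hl.mdifferentiableAt (by simp)
    rw [mder_congr h1]
    rw [mder_comp (g := l) (f := fun a : X₁ × X₁ => (a.1, X.t a.2)) (by rw [← hc]; exact hld)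
      (hp.mdifferentiableAt (by simp)),
      mder_prodMk (f := fun a : X₁ × X₁ => a.1) (g := fun a : X₁ × X₁ => X.t a.2)
        mdifferentiableAt_fst ((mdiff_t _).comp z₀.1 mdifferentiableAt_snd), mder_fst]
    change mder _ _ l _ (v, mder _ _ (fun a : X₁ × X₁ => X.t a.2) _ (v, w)) = v
    rw [mder_comp (g := X.t) (f := fun a : X₁ × X₁ => a.2) (mdiff_t _) mdifferentiableAt_snd,
      mder_snd]
    change mder _ _ l _ (v, X.dt z₀.1.2 w) = v
    rw [← hvw, ← hc]
    have h2 := mder_congr (I := 𝓡 n₁) (I' := 𝓡 n₁) hl2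
    have h3 := mder_comp (g := l) (f := fun p : X₁ => (p, X.s p)) hld
      (mdifferentiableAt_id.prodMk (mdiff_s _)) v
    rw [h2, mder_prodMk (f := fun p : X₁ => p) (g := X.s) mdifferentiableAt_id (mdiff_s _),
      mder_id] at h3
    exact h3.symm

/-! ### The tangent groupoid -/

variable (X) in
/-- The derivative of the composition. -/
def dm (z : X.Comp) : EuclideanSpace ℝ (Fin X.n₂) →L[ℝ] 𝔼₁ := mder (𝓡 X.n₂) (𝓡 n₁) X.m z

lemma ds_dpr₁ (z : X.Comp) (ζ) : X.ds z.1.1 (X.dpr₁ z ζ) = X.dt z.1.2 (X.dpr₂ z ζ) := by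
  have h : (fun z : X.Comp => X.s z.1.1) = fun z : X.Comp => X.t z.1.2 := funext fun z => z.2
  have h1 := mder_comp (g := X.s) (f := fun z : X.Comp => z.1.1) (mdiff_s _) (mdiff_pr₁ z) ζ
  have h2 := mder_comp (g := X.t) (f := fun z : X.Comp => z.1.2) (mdiff_t _) (mdiff_pr₂ z) ζ
  rw [h] at h1
  exact h1.symm.trans h2

/-- Tangent vectors of `X₂` near `z₀` are recovered from their components by a retraction. -/
lemma eventually_mder_retraction {z₀ : X.Comp} {R : X₁ × X₁ → X.Comp}
    (hR : ContMDiffAt ((𝓡 n₁).prod (𝓡 n₁)) (𝓡 X.n₂) ∞ R z₀.1) (hR' : ∀ᶠ z in 𝓝 z₀, R z.1 = z) :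
    ∀ᶠ z in 𝓝 z₀, ∀ ζ, mder ((𝓡 n₁).prod (𝓡 n₁)) (𝓡 X.n₂) R z.1 (X.dpr₁ z ζ, X.dpr₂ z ζ) = ζ := by
  have h1 : ∀ᶠ a in 𝓝 z₀.1, ContMDiffAt ((𝓡 n₁).prod (𝓡 n₁)) (𝓡 X.n₂) 1 R a :=
    (contMDiffAt_iff_contMDiffAt_nhds (by simp)).1 (ContMDiffAt.of_le (m := 1) hR (by simp))
  have h2 : Tendsto (fun z : X.Comp => z.1) (𝓝 z₀) (𝓝 z₀.1) := continuous_subtype_val.continuousAt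
  filter_upwards [h2.eventually h1, eventually_eventually_nhds.2 hR'] with z hz hz' ζ
  have h3 := mder_comp (I := (𝓡 n₁).prod (𝓡 n₁)) (g := R) (f := fun z : X.Comp => z.1)
    (hz.mdifferentiableAt (by simp)) ((contMDiff_val z).mdifferentiableAt (by simp)) ζ
  rw [mder_congr hz', mder_id] at h3
  refine Eq.trans (congrArg _ ?_) h3.symm
  exact (mder_prodMk (f := fun z : X.Comp => z.1.1) (g := fun z : X.Comp => z.1.2)
    (mdiff_pr₁ z) (mdiff_pr₂ z) ζ).symm

lemma dpr_injective {z : X.Comp} {ζ ζ'} (h₁ : X.dpr₁ z ζ = X.dpr₁ z ζ')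
    (h₂ : X.dpr₂ z ζ = X.dpr₂ z ζ') : ζ = ζ' := by
  obtain ⟨R, hR, -, hR', -⟩ := exists_retraction z
  have h := (eventually_mder_retraction hR hR').self_of_nhds
  rw [← h ζ, h₁, h₂, h ζ']

/-- Composable tangent vectors are the components of a vector tangent to `X₂`. -/
lemma exists_lift {z : X.Comp} {v w : 𝔼₁} (h : X.ds z.1.1 v = X.dt z.1.2 w) :
    ∃ ζ, X.dpr₁ z ζ = v ∧ X.dpr₂ z ζ = w := by
  obtain ⟨R, hR, hR₂, hR', hR₁⟩ := exists_retraction z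
  have hz : R z.1 = z := hR'.self_of_nhds
  have hRd := hR.mdifferentiableAt (by simp : (∞ : WithTop ℕ∞) ≠ 0)
  refine ⟨mder ((𝓡 n₁).prod (𝓡 n₁)) (𝓡 X.n₂) R z.1 (v, w), ?_, ?_⟩
  · have h1 := mder_comp (g := fun z : X.Comp => z.1.1) (f := R) (mdiff_pr₁ _) hRd (v, w)
    rw [hR₁ v w h, hz] at h1
    exact h1.symm
  · have h1 := mder_comp (g := fun z : X.Comp => z.1.2) (f := R) (mdiff_pr₂ _) hRd (v, w)
    rw [mder_congr hR₂, mder_snd, hz] at h1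
    exact h1.symm

lemma tangentMul_dpr (z : X.Comp) (ζ) :
    X.tangentMul z (X.dpr₁ z ζ) (X.dpr₂ z ζ) = X.dm z ζ := by
  have h : ∃ ζ' : TangentSpace (𝓡 X.n₂) z,
      mfderiv (𝓡 X.n₂) (𝓡 n₁) (fun z : X.Comp => z.1.1) z ζ' = X.dpr₁ z ζ ∧
      mfderiv (𝓡 X.n₂) (𝓡 n₁) (fun z : X.Comp => z.1.2) z ζ' = X.dpr₂ z ζ := ⟨ζ, rfl, rfl⟩
  refine (dif_pos h).trans ?_
  exact congrArg (X.dm z) (dpr_injective h.choose_spec.1 h.choose_spec.2)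

lemma exists_tmul_eq {p q : X₁} (h : X.s p = X.t q) {v w : 𝔼₁} (hvw : X.ds p v = X.dt q w) :
    ∃ ζ, X.dpr₁ ⟨(p, q), h⟩ ζ = v ∧ X.dpr₂ ⟨(p, q), h⟩ ζ = w ∧
      X.tmul p q v w = X.dm ⟨(p, q), h⟩ ζ := by
  obtain ⟨ζ, rfl, rfl⟩ := exists_lift (z := ⟨(p, q), h⟩) hvw
  exact ⟨ζ, rfl, rfl, (tmul_eq h _ _).trans (tangentMul_dpr _ ζ)⟩

lemma tmul_dpr (z : X.Comp) (ζ) :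
    X.tmul z.1.1 z.1.2 (X.dpr₁ z ζ) (X.dpr₂ z ζ) = X.dm z ζ :=
  (tmul_eq z.2 _ _).trans (tangentMul_dpr z ζ)

lemma tmul_add {p q : X₁} (h : X.s p = X.t q) {v w v' w' : 𝔼₁} (hvw : X.ds p v = X.dt q w)
    (hvw' : X.ds p v' = X.dt q w') :
    X.tmul p q (v + v') (w + w') = X.tmul p q v w + X.tmul p q v' w' := by
  obtain ⟨ζ, rfl, rfl, h1⟩ := exists_tmul_eq h hvw
  obtain ⟨ζ', rfl, rfl, h2⟩ := exists_tmul_eq h hvw'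
  rw [h1, h2, ← map_add, ← map_add, ← map_add]
  exact tmul_dpr ⟨(p, q), h⟩ (ζ + ζ')

lemma tmul_smul {p q : X₁} (h : X.s p = X.t q) {v w : 𝔼₁} (hvw : X.ds p v = X.dt q w) (c : ℝ) :
    X.tmul p q (c • v) (c • w) = c • X.tmul p q v w := by
  obtain ⟨ζ, rfl, rfl, h1⟩ := exists_tmul_eq h hvw
  rw [h1, ← map_smul, ← map_smul, ← map_smul]
  exact tmul_dpr ⟨(p, q), h⟩ (c • ζ)

lemma tmul_zero {p q : X₁} (h : X.s p = X.t q) : X.tmul p q 0 0 = 0 := by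
  have := tmul_smul h (v := 0) (w := 0) (by simp) 0
  simpa using this

lemma s_pmul {p q : X₁} (h : X.s p = X.t q) : X.s (X.pmul p q) = X.s q := by
  rw [pmul_eq h, X.s_m]

lemma t_pmul {p q : X₁} (h : X.s p = X.t q) : X.t (X.pmul p q) = X.t p := by
  rw [pmul_eq h, X.t_m]

lemma pmul_assoc {p q r : X₁} (h : X.s p = X.t q) (h' : X.s q = X.t r) :
    X.pmul (X.pmul p q) r = X.pmul p (X.pmul q r) := by
  rw [pmul_eq ((s_pmul h).trans h'), pmul_eq (h.trans (t_pmul h').symm)]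
  exact (X.m_congr (pmul_eq h) rfl).trans
    ((X.m_assoc p q r h h').trans (X.m_congr rfl (pmul_eq h').symm))

variable (X) in
lemma u_pmul (p : X₁) : X.pmul (X.u (X.t p)) p = p := (pmul_eq (X.s_u _)).trans (X.u_m p)
variable (X) in
lemma pmul_u (p : X₁) : X.pmul p (X.u (X.s p)) = p := (pmul_eq (X.t_u _).symm).trans (X.m_u p)
variable (X) in
lemma pmul_i (p : X₁) : X.pmul p (X.i p) = X.u (X.t p) :=
  (pmul_eq (X.t_i _).symm).trans (X.m_i p)
variable (X) in
lemma i_pmul_self (p : X₁) : X.pmul (X.i p) p = X.u (X.s p) := (pmul_eq (X.s_i _)).trans (X.i_m p)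

lemma i_pmul {p q : X₁} (h : X.s p = X.t q) : X.i (X.pmul p q) = X.pmul (X.i q) (X.i p) := by
  rw [pmul_eq h, X.i_mul, pmul_eq]

variable (X) in
lemma i_i (p : X₁) : X.i (X.i p) = p := by
  apply X.m_left_cancel (p := X.i p) (h := (X.t_i _).symm) (h' := X.s_i p)
  rw [X.m_i, X.i_m, X.t_i]

lemma ds_tmul {p q : X₁} (h : X.s p = X.t q) {v w : 𝔼₁} (hvw : X.ds p v = X.dt q w) :
    X.ds (X.pmul p q) (X.tmul p q v w) = X.ds q w := by
  obtain ⟨ζ, rfl, rfl, h1⟩ := exists_tmul_eq h hvw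
  rw [h1, pmul_eq h]
  have e : (fun z : X.Comp => X.s (X.m z)) = fun z : X.Comp => X.s z.1.2 := funext X.s_m
  have h2 := mder_comp (g := X.s) (f := X.m) (mdiff_s _) (mdiff_m ⟨(p, q), h⟩) ζ
  have h3 := mder_comp (g := X.s) (f := fun z : X.Comp => z.1.2) (mdiff_s _)
    (mdiff_pr₂ ⟨(p, q), h⟩) ζ
  rw [e] at h2
  exact h2.symm.trans h3

lemma dt_tmul {p q : X₁} (h : X.s p = X.t q) {v w : 𝔼₁} (hvw : X.ds p v = X.dt q w) :
    X.dt (X.pmul p q) (X.tmul p q v w) = X.dt p v := by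
  obtain ⟨ζ, rfl, rfl, h1⟩ := exists_tmul_eq h hvw
  rw [h1, pmul_eq h]
  have e : (fun z : X.Comp => X.t (X.m z)) = fun z : X.Comp => X.t z.1.1 := funext X.t_m
  have h2 := mder_comp (g := X.t) (f := X.m) (mdiff_t _) (mdiff_m ⟨(p, q), h⟩) ζ
  have h3 := mder_comp (g := X.t) (f := fun z : X.Comp => z.1.1) (mdiff_t _)
    (mdiff_pr₁ ⟨(p, q), h⟩) ζ
  rw [e] at h2
  exact h2.symm.trans h3

section Products

variable {E H N : Type*} [NormedAddCommGroup E] [NormedSpace ℝ E] [TopologicalSpace H]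
    {J : ModelWithCorners ℝ E H} [TopologicalSpace N] [ChartedSpace H N] {f g : N → X₁} {y : N}

lemma pmul_eventuallyEq (z₀ : X.Comp) (h : ∀ᶠ y' in 𝓝 y, X.s (f y') = X.t (g y')) :
    (fun y' => X.pmul (f y') (g y')) =ᶠ[𝓝 y] fun y' => X.m (pairOr z₀ f g y') := by
  filter_upwards [h] with y' hy'
  rw [pmul_eq hy', pairOr_val hy']

lemma contMDiffAt_pmul (hf : ContMDiffAt J (𝓡 n₁) ∞ f y) (hg : ContMDiffAt J (𝓡 n₁) ∞ g y)
    (h : ∀ᶠ y' in 𝓝 y, X.s (f y') = X.t (g y')) :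
    ContMDiffAt J (𝓡 n₁) ∞ (fun y' => X.pmul (f y') (g y')) y :=
  (X.m_smooth.contMDiffAt.comp y
    (contMDiffAt_pairOr ⟨(f y, g y), h.self_of_nhds⟩ hf hg h)).congr_of_eventuallyEq
    (pmul_eventuallyEq _ h)

/-- The derivative of a product of arrows is the product of the derivatives in the tangent
groupoid. -/
lemma mder_pmul (hf : ContMDiffAt J (𝓡 n₁) ∞ f y) (hg : ContMDiffAt J (𝓡 n₁) ∞ g y)
    (h : ∀ᶠ y' in 𝓝 y, X.s (f y') = X.t (g y')) (v : E) :
    mder J (𝓡 n₁) (fun y' => X.pmul (f y') (g y')) y v =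
      X.tmul (f y) (g y) (mder J (𝓡 n₁) f y v) (mder J (𝓡 n₁) g y v) := by
  have hy := h.self_of_nhds
  let z₀ : X.Comp := ⟨(f y, g y), hy⟩
  have hP := (contMDiffAt_pairOr z₀ hf hg h).mdifferentiableAt (by simp : (∞ : WithTop ℕ∞) ≠ 0)
  have hz : pairOr z₀ f g y = z₀ := pairOr_val hy
  rw [mder_congr (pmul_eventuallyEq z₀ h), mder_comp (g := X.m) (mdiff_m _) hP]
  have h1 : (fun y' => (pairOr z₀ f g y').1.1) =ᶠ[𝓝 y] f := by
    filter_upwards [h] with y' hy'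
    rw [pairOr_val hy']
  have h2 : (fun y' => (pairOr z₀ f g y').1.2) =ᶠ[𝓝 y] g := by
    filter_upwards [h] with y' hy'
    rw [pairOr_val hy']
  rw [← mder_congr h1, ← mder_congr h2,
    mder_comp (g := fun z : X.Comp => z.1.1) (mdiff_pr₁ _) hP,
    mder_comp (g := fun z : X.Comp => z.1.2) (mdiff_pr₂ _) hP, hz]
  exact (tmul_dpr z₀ _).symm

end Products

lemma tmul_u_left (p : X₁) (v : 𝔼₁) :
    X.tmul (X.u (X.t p)) p (X.du (X.t p) (X.dt p v)) v = v := by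
  have h := mder_pmul (J := 𝓡 n₁) (f := fun p => X.u (X.t p)) (g := fun p => p)
    ((X.u_smooth.comp X.t_smooth) p) contMDiffAt_id (Eventually.of_forall fun p => X.s_u _) v
  have e : (fun p => X.pmul (X.u (X.t p)) p) = fun p => p := funext X.u_pmul
  rw [e, mder_id, mder_comp (g := X.u) (f := X.t) (mdiff_u _) (mdiff_t _)] at h
  exact h.symm

lemma tmul_u_right (p : X₁) (v : 𝔼₁) :
    X.tmul p (X.u (X.s p)) v (X.du (X.s p) (X.ds p v)) = v := by
  have h := mder_pmul (J := 𝓡 n₁) (f := fun p => p) (g := fun p => X.u (X.s p))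
    contMDiffAt_id ((X.u_smooth.comp X.s_smooth) p)
    (Eventually.of_forall fun p => (X.t_u _).symm) v
  have e : (fun p => X.pmul p (X.u (X.s p))) = fun p => p := funext X.pmul_u
  rw [e, mder_id, mder_comp (g := X.u) (f := X.s) (mdiff_u _) (mdiff_s _)] at h
  exact h.symm

lemma tmul_i_right (p : X₁) (v : 𝔼₁) :
    X.tmul p (X.i p) v (X.di p v) = X.du (X.t p) (X.dt p v) := by
  have h := mder_pmul (J := 𝓡 n₁) (f := fun p => p) (g := X.i)
    contMDiffAt_id (X.i_smooth p) (Eventually.of_forall fun p => (X.t_i _).symm) v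
  have e : (fun p => X.pmul p (X.i p)) = fun p => X.u (X.t p) := funext X.pmul_i
  rw [e, mder_id, mder_comp (g := X.u) (f := X.t) (mdiff_u _) (mdiff_t _)] at h
  exact h.symm

lemma tmul_i_left (p : X₁) (v : 𝔼₁) :
    X.tmul (X.i p) p (X.di p v) v = X.du (X.s p) (X.ds p v) := by
  have h := mder_pmul (J := 𝓡 n₁) (f := X.i) (g := fun p => p)
    (X.i_smooth p) contMDiffAt_id (Eventually.of_forall fun p => X.s_i _) v
  have e : (fun p => X.pmul (X.i p) p) = fun p => X.u (X.s p) := funext X.i_pmul_self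
  rw [e, mder_id, mder_comp (g := X.u) (f := X.s) (mdiff_u _) (mdiff_s _)] at h
  exact h.symm

lemma ds_du (x : X₀) (v : 𝔼₀) : X.ds (X.u x) (X.du x v) = v := by
  have h := mder_comp (g := X.s) (f := X.u) (mdiff_s _) (mdiff_u x) v
  rw [show (fun x => X.s (X.u x)) = fun x => x from funext X.s_u, mder_id] at h
  exact h.symm

lemma dt_du (x : X₀) (v : 𝔼₀) : X.dt (X.u x) (X.du x v) = v := by
  have h := mder_comp (g := X.t) (f := X.u) (mdiff_t _) (mdiff_u x) v
  rw [show (fun x => X.t (X.u x)) = fun x => x from funext X.t_u, mder_id] at h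
  exact h.symm

lemma ds_di (p : X₁) (v : 𝔼₁) : X.ds (X.i p) (X.di p v) = X.dt p v := by
  have h := mder_comp (g := X.s) (f := X.i) (mdiff_s _) (mdiff_i p) v
  rw [show (fun x => X.s (X.i x)) = X.t from funext X.s_i] at h
  exact h.symm

lemma dt_di (p : X₁) (v : 𝔼₁) : X.dt (X.i p) (X.di p v) = X.ds p v := by
  have h := mder_comp (g := X.t) (f := X.i) (mdiff_t _) (mdiff_i p) v
  rw [show (fun x => X.t (X.i x)) = X.s from funext X.t_i] at h
  exact h.symm

lemma di_tmul {p q : X₁} (h : X.s p = X.t q) {v w : 𝔼₁} (hvw : X.ds p v = X.dt q w) :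
    X.di (X.pmul p q) (X.tmul p q v w) = X.tmul (X.i q) (X.i p) (X.di q w) (X.di p v) := by
  obtain ⟨ζ, rfl, rfl, h1⟩ := exists_tmul_eq h hvw
  rw [h1, pmul_eq h]
  have h2 := mder_comp (g := X.i) (f := X.m) (mdiff_i _) (mdiff_m ⟨(p, q), h⟩) ζ
  have e : (fun z : X.Comp => X.i (X.m z)) = fun z : X.Comp => X.pmul (X.i z.1.2) (X.i z.1.1) :=
    funext fun z => by rw [← i_pmul z.2, pmul_eq z.2]
  have h3 := mder_pmul (J := 𝓡 X.n₂) (f := fun z : X.Comp => X.i z.1.2)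
    (g := fun z : X.Comp => X.i z.1.1) (y := ⟨(p, q), h⟩)
    ((X.i_smooth.comp contMDiff_pr₂) _) ((X.i_smooth.comp contMDiff_pr₁) _)
    (Eventually.of_forall fun z => by rw [X.s_i, X.t_i, z.2]) ζ
  rw [e, h3, mder_comp (g := X.i) (f := fun z : X.Comp => z.1.1) (mdiff_i _) (mdiff_pr₁ _),
    mder_comp (g := X.i) (f := fun z : X.Comp => z.1.2) (mdiff_i _) (mdiff_pr₂ _)] at h2
  exact h2.symm

/-- The composition of tangent vectors is associative: near a point over `(p, q, r)`, a composable
triple of tangent vectors is the velocity of a family of composable triples of arrows, obtained by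
retracting `X₁ × X₂` with the help of `exists_retraction`. -/
lemma tmul_assoc {p q r : X₁} (h : X.s p = X.t q) (h' : X.s q = X.t r) {a b c : 𝔼₁}
    (hab : X.ds p a = X.dt q b) (hbc : X.ds q b = X.dt r c) :
    X.tmul (X.pmul p q) r (X.tmul p q a b) c = X.tmul p (X.pmul q r) a (X.tmul q r b c) := by
  obtain ⟨ζ, hb, hc⟩ := exists_lift (z := ⟨(q, r), h'⟩) hbc
  obtain ⟨R, hR, hR₂, hR', hR₁⟩ := exists_retraction ⟨(p, q), h⟩
  let J := (𝓡 n₁).prod (𝓡 X.n₂)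
  let y : X₁ × X.Comp := (p, ⟨(q, r), h'⟩)
  let e : X₁ × X.Comp → X₁ × X₁ := fun y => (y.1, y.2.1.1)
  let f : X₁ × X.Comp → X₁ := fun y => (R (e y)).1.1
  let g : X₁ × X.Comp → X₁ := fun y => y.2.1.1
  let k : X₁ × X.Comp → X₁ := fun y => y.2.1.2
  have hg : ContMDiff J (𝓡 n₁) ∞ g := contMDiff_pr₁.comp contMDiff_snd
  have hk : ContMDiff J (𝓡 n₁) ∞ k := contMDiff_pr₂.comp contMDiff_snd
  have he : ContMDiff J ((𝓡 n₁).prod (𝓡 n₁)) ∞ e := contMDiff_fst.prodMk hg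
  have hRd : ContMDiffAt ((𝓡 n₁).prod (𝓡 n₁)) (𝓡 n₁) ∞ (fun a => (R a).1.1) (e y) :=
    contMDiff_pr₁.contMDiffAt.comp (e y) hR
  have hf : ContMDiffAt J (𝓡 n₁) ∞ f y := ContMDiffAt.comp y (f := e) hRd (he y)
  have hfg : ∀ᶠ y' in 𝓝 y, X.s (f y') = X.t (g y') := by
    filter_upwards [(he y).continuousAt.eventually hR₂] with y' hy'
    exact (R (e y')).2.trans (congrArg X.t hy')
  have hgk : ∀ y', X.s (g y') = X.t (k y') := fun y' => y'.2.2
  have hfy : f y = p := congrArg (fun z : X.Comp => z.1.1) hR'.self_of_nhds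
  have dg : mder J (𝓡 n₁) g y (a, ζ) = b := by
    rw [← hb]
    refine (mder_comp (g := fun z : X.Comp => z.1.1) (f := fun y : X₁ × X.Comp => y.2)
      (mdiff_pr₁ _) mdifferentiableAt_snd (a, ζ)).trans ?_
    rw [mder_snd]
    rfl
  have dk : mder J (𝓡 n₁) k y (a, ζ) = c := by
    rw [← hc]
    refine (mder_comp (g := fun z : X.Comp => z.1.2) (f := fun y : X₁ × X.Comp => y.2)
      (mdiff_pr₂ _) mdifferentiableAt_snd (a, ζ)).trans ?_
    rw [mder_snd]
    rfl
  have df : mder J (𝓡 n₁) f y (a, ζ) = a := by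
    refine (mder_comp (g := fun a => (R a).1.1) (f := e)
      (hRd.mdifferentiableAt (by simp)) ((he y).mdifferentiableAt (by simp)) (a, ζ)).trans ?_
    rw [mder_prodMk (f := fun y : X₁ × X.Comp => y.1) (g := g) mdifferentiableAt_fst
      ((hg y).mdifferentiableAt (by simp)), mder_fst, dg]
    exact hR₁ a b hab
  have e1 : (fun y => X.pmul (X.pmul (f y) (g y)) (k y)) =ᶠ[𝓝 y]
      fun y => X.pmul (f y) (X.pmul (g y) (k y)) := by
    filter_upwards [hfg] with y' hy'
    exact pmul_assoc hy' (hgk y')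
  have h1 := mder_pmul (J := J) (f := fun y => X.pmul (f y) (g y)) (g := k) (y := y)
    (contMDiffAt_pmul hf (hg y) hfg) (hk y)
    (by filter_upwards [hfg] with y' hy'; exact (s_pmul hy').trans (hgk y')) (a, ζ)
  have h2 := mder_pmul (J := J) (f := f) (g := fun y => X.pmul (g y) (k y)) (y := y)
    hf (contMDiffAt_pmul (hg y) (hk y) (Eventually.of_forall hgk))
    (by filter_upwards [hfg] with y' hy'; exact hy'.trans (t_pmul (hgk y')).symm) (a, ζ)
  rw [mder_congr e1, h2, mder_pmul hf (hg y) hfg, mder_pmul (hg y) (hk y)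
    (Eventually.of_forall hgk), df, dg, dk, hfy] at h1
  exact h1.symm

section SmoothLift

variable {E H N : Type*} [NormedAddCommGroup E] [NormedSpace ℝ E] [TopologicalSpace H]
    {J : ModelWithCorners ℝ E H} [TopologicalSpace N] [ChartedSpace H N]

/-- A vector field along a map to `X₂` is smooth if its components are. -/
lemma smoothAlong_lift {z : N → X.Comp} {ζ : N → EuclideanSpace ℝ (Fin X.n₂)} {y : N}
    (hz : ContinuousAt z y)
    (h₁ : SmoothAlong J (𝓡 n₁) (fun y => (z y).1.1) (fun y => X.dpr₁ (z y) (ζ y)) y)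
    (h₂ : SmoothAlong J (𝓡 n₁) (fun y => (z y).1.2) (fun y => X.dpr₂ (z y) (ζ y)) y) :
    SmoothAlong J (𝓡 X.n₂) z ζ y := by
  obtain ⟨R, hR, -, hR', -⟩ := exists_retraction (z y)
  have h3 := (SmoothAlong.prodMk h₁ h₂).mder (f := R) hR
  refine h3.congr ?_ ?_
  · filter_upwards [hz.eventually hR'] with y' hy'
    exact hy'.symm
  · filter_upwards [hz.eventually (eventually_mder_retraction hR hR')] with y' hy'
    exact (hy' _).symm

/-- The product of composable smooth vector fields along maps is smooth. -/
lemma SmoothAlong.tmul {b b' : N → X₁} {v v' : N → 𝔼₁} {y : N}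
    (h : SmoothAlong J (𝓡 n₁) b v y) (h' : SmoothAlong J (𝓡 n₁) b' v' y)
    (hb : ∀ᶠ y' in 𝓝 y, X.s (b y') = X.t (b' y'))
    (hv : ∀ᶠ y' in 𝓝 y, X.ds (b y') (v y') = X.dt (b' y') (v' y')) :
    SmoothAlong J (𝓡 n₁) (fun y => X.pmul (b y) (b' y))
      (fun y => X.tmul (b y) (b' y) (v y) (v' y)) y := by
  have hP := contMDiffAt_pairOr ⟨(b y, b' y), hb.self_of_nhds⟩ h.base h'.base hb
  set z := pairOr ⟨(b y, b' y), hb.self_of_nhds⟩ b b' with hz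
  -- the vector tangent to `X₂` with components `v y'` and `v' y'`, where these are composable
  have key : ∀ y', ∃ ζ, (X.s (b y') = X.t (b' y') ∧ X.ds (b y') (v y') = X.dt (b' y') (v' y')) →
      X.dpr₁ (z y') ζ = v y' ∧ X.dpr₂ (z y') ζ = v' y' ∧
      X.tmul (b y') (b' y') (v y') (v' y') = X.dm (z y') ζ := fun y' => by
    by_cases h1 : X.s (b y') = X.t (b' y') ∧ X.ds (b y') (v y') = X.dt (b' y') (v' y')
    · obtain ⟨ζ, h2⟩ := exists_tmul_eq h1.1 h1.2
      refine ⟨ζ, fun _ => ?_⟩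
      rw [hz, pairOr_val h1.1]
      exact h2
    · exact ⟨0, fun h2 => (h1 h2).elim⟩
  choose ζ hζ using key
  have h1 : SmoothAlong J (𝓡 X.n₂) z ζ y := by
    apply smoothAlong_lift hP.continuousAt
    · refine h.congr ?_ ?_
      · filter_upwards [hb] with y' hy'
        rw [hz, pairOr_val hy']
      · filter_upwards [hb, hv] with y' hy' hy''
        exact (hζ y' ⟨hy', hy''⟩).1
    · refine h'.congr ?_ ?_
      · filter_upwards [hb] with y' hy'
        rw [hz, pairOr_val hy']
      · filter_upwards [hb, hv] with y' hy' hy''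
        exact (hζ y' ⟨hy', hy''⟩).2.1
  refine (h1.mder (X.m_smooth _)).congr (pmul_eventuallyEq _ hb) ?_
  filter_upwards [hb, hv] with y' hy' hy''
  exact (hζ y' ⟨hy', hy''⟩).2.2

end SmoothLift

/-! ### Multiplicatively related vector fields -/

variable (X) in
/-- The triple of vector fields `(A, B, C)` on `X₁` is tangent to the graph of the composition:
`A` and `B` are composable along `X₂` and their product is `C`. -/
structure IsMulRelated (A B C : X₁ → 𝔼₁) : Prop where
  comp : ∀ p q, X.s p = X.t q → X.ds p (A p) = X.dt q (B q)
  mul : ∀ p q, X.s p = X.t q → X.tmul p q (A p) (B q) = C (X.pmul p q)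

/-- Related fields lift to a smooth field on `X₂` that projects to `A`, `B` and `C`. -/
lemma IsMulRelated.exists_field {A B C : X₁ → 𝔼₁} (h : X.IsMulRelated A B C)
    (hA : IsSmoothField (k := n₁) A) (hB : IsSmoothField (k := n₁) B) :
    ∃ Z : X.Comp → EuclideanSpace ℝ (Fin X.n₂), IsSmoothField (k := X.n₂) Z ∧
      ∀ z, X.dpr₁ z (Z z) = A z.1.1 ∧ X.dpr₂ z (Z z) = B z.1.2 ∧ X.dm z (Z z) = C (X.m z) := by
  have key : ∀ z : X.Comp, ∃ ζ, X.dpr₁ z ζ = A z.1.1 ∧ X.dpr₂ z ζ = B z.1.2 ∧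
      X.dm z ζ = C (X.m z) := fun z => by
    obtain ⟨ζ, h1, h2, h3⟩ := exists_tmul_eq z.2 (h.comp _ _ z.2)
    exact ⟨ζ, h1, h2, h3.symm.trans ((h.mul _ _ z.2).trans (congrArg C (pmul_eq z.2)))⟩
  choose Z hZ using key
  refine ⟨Z, fun z => smoothAlong_lift continuousAt_id ?_ ?_, hZ⟩
  · simp only [(hZ _).1]
    exact SmoothAlong.comp (b := fun p => p) (v := A) (hA _) (contMDiff_pr₁ z)
  · simp only [(hZ _).2.1]
    exact SmoothAlong.comp (b := fun p => p) (v := B) (hB _) (contMDiff_pr₂ z)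

/-- Multiplicative relations are closed under brackets. -/
lemma IsMulRelated.mbr {A B C A' B' C' : X₁ → 𝔼₁} (h : X.IsMulRelated A B C)
    (h' : X.IsMulRelated A' B' C') (hA : IsSmoothField (k := n₁) A)
    (hB : IsSmoothField (k := n₁) B) (hC : IsSmoothField (k := n₁) C)
    (hA' : IsSmoothField (k := n₁) A') (hB' : IsSmoothField (k := n₁) B')
    (hC' : IsSmoothField (k := n₁) C') :
    X.IsMulRelated (mbr (𝓡 n₁) A A') (mbr (𝓡 n₁) B B') (mbr (𝓡 n₁) C C') := by
  obtain ⟨Z, hZ, hZr⟩ := h.exists_field hA hB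
  obtain ⟨Z', hZ', hZr'⟩ := h'.exists_field hA' hB'
  have key : ∀ z : X.Comp, X.dpr₁ z (_root_.mbr (𝓡 X.n₂) Z Z' z) = _root_.mbr (𝓡 n₁) A A' z.1.1 ∧
      X.dpr₂ z (_root_.mbr (𝓡 X.n₂) Z Z' z) = _root_.mbr (𝓡 n₁) B B' z.1.2 ∧
      X.dm z (_root_.mbr (𝓡 X.n₂) Z Z' z) = _root_.mbr (𝓡 n₁) C C' (X.m z) := fun z =>
    ⟨mder_mbr_of_related (contMDiff_pr₁ z) (hZ z) (hZ' z) (hA _) (hA' _)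
        (Eventually.of_forall fun z => (hZr z).1) (Eventually.of_forall fun z => (hZr' z).1),
      mder_mbr_of_related (contMDiff_pr₂ z) (hZ z) (hZ' z) (hB _) (hB' _)
        (Eventually.of_forall fun z => (hZr z).2.1) (Eventually.of_forall fun z => (hZr' z).2.1),
      mder_mbr_of_related (X.m_smooth z) (hZ z) (hZ' z) (hC _) (hC' _)
        (Eventually.of_forall fun z => (hZr z).2.2) (Eventually.of_forall fun z => (hZr' z).2.2)⟩
  refine ⟨fun p q hpq => ?_, fun p q hpq => ?_⟩
  · obtain ⟨h1, h2, -⟩ := key ⟨(p, q), hpq⟩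
    rw [← h1, ← h2]
    exact ds_dpr₁ ⟨(p, q), hpq⟩ _
  · obtain ⟨h1, h2, h3⟩ := key ⟨(p, q), hpq⟩
    rw [← h1, ← h2, pmul_eq hpq, ← h3]
    exact tmul_dpr ⟨(p, q), hpq⟩ _

end LieGroupoid

/-! ### Killing vector fields -/

section Killing

variable {k : ℕ} {M : Type*} [TopologicalSpace M] [ChartedSpace (EuclideanSpace ℝ (Fin k)) M]
  [IsManifold (𝓡 k) ∞ M] (η : SmoothMetric k M)

local notation "𝔼" => EuclideanSpace ℝ (Fin k)

/-- The metric as a bilinear form on the model space. -/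
def SmoothMetric.form (x : M) : 𝔼 →L[ℝ] 𝔼 →L[ℝ] ℝ := η.inner x

variable {η}

lemma SmoothMetric.contMDiffAt_form {E H N : Type*} [NormedAddCommGroup E] [NormedSpace ℝ E]
    [TopologicalSpace H] {J : ModelWithCorners ℝ E H} [TopologicalSpace N] [ChartedSpace H N]
    {b : N → M} {v w : N → 𝔼} {y : N} (hv : SmoothAlong J (𝓡 k) b v y)
    (hw : SmoothAlong J (𝓡 k) b w y) :
    ContMDiffAt J 𝓘(ℝ, ℝ) ∞ (fun y => SmoothMetric.form η (b y) (v y) (w y)) y := by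
  have h : ContMDiffAt J ((𝓡 k).prod 𝓘(ℝ, ℝ)) ∞
      (fun y => TotalSpace.mk' ℝ (E := Bundle.Trivial M ℝ) (b y)
        (η.inner (b y) (v y) (w y))) y := by
    apply ContMDiffAt.clm_bundle_apply₂ (F₁ := 𝔼) (F₂ := 𝔼)
    · exact ContMDiffAt.comp (g := fun b => TotalSpace.mk' (𝔼 →L[ℝ] 𝔼 →L[ℝ] ℝ) b (η.inner b))
        y η.contMDiff.contMDiffAt hv.base
    · exact hv
    · exact hw
  simp only [contMDiffAt_totalSpace] at h
  exact h.2

lemma SmoothMetric.mdiff_form {Y Z : M → 𝔼} (hY : IsSmoothField (k := k) Y)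
    (hZ : IsSmoothField (k := k) Z) (x : M) :
    MDifferentiableAt (𝓡 k) 𝓘(ℝ, ℝ) (fun y => SmoothMetric.form η y (Y y) (Z y)) x :=
  (SmoothMetric.contMDiffAt_form (hY x) (hZ x)).mdifferentiableAt (by simp)

lemma isKilling_iff {V : M → 𝔼} : IsKilling (k := k) η V ↔ IsSmoothField (k := k) V ∧
    ∀ Y Z : M → 𝔼, IsSmoothField (k := k) Y → IsSmoothField (k := k) Z → ∀ x,
      mder (𝓡 k) 𝓘(ℝ, ℝ) (fun y => SmoothMetric.form η y (Y y) (Z y)) x (V x) =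
      SmoothMetric.form η x (mbr (𝓡 k) V Y x) (Z x) +
        SmoothMetric.form η x (Y x) (mbr (𝓡 k) V Z x) := Iff.rfl

lemma isKilling_zero : IsKilling (k := k) η (fun _ => (0 : 𝔼)) := by
  refine isKilling_iff.2 ⟨isSmoothField_zero, fun Y Z _ _ x => ?_⟩
  rw [mbr_zero_left, mbr_zero_left]
  simp

lemma IsKilling.add {V W : M → 𝔼} (hV : IsKilling (k := k) η V) (hW : IsKilling (k := k) η W) :
    IsKilling (k := k) η (fun x => V x + W x) := by
  rw [isKilling_iff] at *
  refine ⟨hV.1.add hW.1, fun Y Z hY hZ x => ?_⟩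
  rw [mbr_add_left hV.1 hW.1, mbr_add_left hV.1 hW.1]
  simp only [map_add, add_apply]
  rw [hV.2 Y Z hY hZ, hW.2 Y Z hY hZ]
  ring

lemma IsKilling.const_smul {V : M → 𝔼} (c : ℝ) (hV : IsKilling (k := k) η V) :
    IsKilling (k := k) η (fun x => c • V x) := by
  rw [isKilling_iff] at *
  refine ⟨hV.1.const_smul c, fun Y Z hY hZ x => ?_⟩
  rw [mbr_smul_left c hV.1, mbr_smul_left c hV.1]
  simp only [map_smul, smul_apply]
  rw [hV.2 Y Z hY hZ]
  simp only [smul_eq_mul]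
  ring

/-- Killing fields are closed under brackets, by the Jacobi identity. -/
lemma IsKilling.mbr {V W : M → 𝔼} (hV : IsKilling (k := k) η V) (hW : IsKilling (k := k) η W) :
    IsKilling (k := k) η (mbr (𝓡 k) V W) := by
  rw [isKilling_iff] at *
  refine ⟨hV.1.mbr hW.1, fun Y Z hY hZ x => ?_⟩
  -- the derivative of `η(Y, Z)` along two Killing fields in succession
  have key : ∀ U U' : M → 𝔼, (IsSmoothField (k := k) U ∧ ∀ Y Z : M → 𝔼,
      IsSmoothField (k := k) Y → IsSmoothField (k := k) Z → ∀ x,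
      mder (𝓡 k) 𝓘(ℝ, ℝ) (fun y => SmoothMetric.form η y (Y y) (Z y)) x (U x) =
      SmoothMetric.form η x (_root_.mbr (𝓡 k) U Y x) (Z x) +
        SmoothMetric.form η x (Y x) (_root_.mbr (𝓡 k) U Z x)) →
      (IsSmoothField (k := k) U' ∧ ∀ Y Z : M → 𝔼,
      IsSmoothField (k := k) Y → IsSmoothField (k := k) Z → ∀ x,
      mder (𝓡 k) 𝓘(ℝ, ℝ) (fun y => SmoothMetric.form η y (Y y) (Z y)) x (U' x) =
      SmoothMetric.form η x (_root_.mbr (𝓡 k) U' Y x) (Z x) +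
        SmoothMetric.form η x (Y x) (_root_.mbr (𝓡 k) U' Z x)) →
      mder (𝓡 k) 𝓘(ℝ, ℝ) (fun y => mder (𝓡 k) 𝓘(ℝ, ℝ)
        (fun y => SmoothMetric.form η y (Y y) (Z y)) y (U' y)) x (U x) =
      SmoothMetric.form η x (_root_.mbr (𝓡 k) U (_root_.mbr (𝓡 k) U' Y) x) (Z x) +
      SmoothMetric.form η x (_root_.mbr (𝓡 k) U' Y x) (_root_.mbr (𝓡 k) U Z x) +
      (SmoothMetric.form η x (_root_.mbr (𝓡 k) U Y x) (_root_.mbr (𝓡 k) U' Z x) +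
      SmoothMetric.form η x (Y x) (_root_.mbr (𝓡 k) U (_root_.mbr (𝓡 k) U' Z) x)) := by
    intro U U' hU hU'
    have h1 : (fun y => mder (𝓡 k) 𝓘(ℝ, ℝ)
        (fun y => SmoothMetric.form η y (Y y) (Z y)) y (U' y)) =
        (fun y => SmoothMetric.form η y (_root_.mbr (𝓡 k) U' Y y) (Z y)) +
        (fun y => SmoothMetric.form η y (Y y) (_root_.mbr (𝓡 k) U' Z y)) :=
      funext fun y => hU'.2 Y Z hY hZ y
    rw [h1, ← hU.2 _ _ (hU'.1.mbr hY) hZ, ← hU.2 _ _ hY (hU'.1.mbr hZ)]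
    have h2 := mfderiv_add (SmoothMetric.mdiff_form (η := η) (hU'.1.mbr hY) hZ x)
      (SmoothMetric.mdiff_form (η := η) hY (hU'.1.mbr hZ) x)
    exact congrArg (fun L : 𝔼 →L[ℝ] ℝ => L (U x)) h2
  rw [mder_mbr (SmoothMetric.contMDiffAt_form (hY x) (hZ x)) (hV.1 x) (hW.1 x), key V W hV hW,
    key W V hW hV, mbr_jacobi hV.1 hW.1 hY, mbr_jacobi hV.1 hW.1 hZ]
  simp only [map_add, add_apply]
  ring

end Killing

namespace LieGroupoid

variable {n₀ n₁ : ℕ} {X₀ X₁ : Type*}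
  [TopologicalSpace X₀] [ChartedSpace (EuclideanSpace ℝ (Fin n₀)) X₀] [IsManifold (𝓡 n₀) ∞ X₀]
  [TopologicalSpace X₁] [ChartedSpace (EuclideanSpace ℝ (Fin n₁)) X₁] [IsManifold (𝓡 n₁) ∞ X₁]
  {X : LieGroupoid n₀ n₁ X₀ X₁}

local notation "𝔼₀" => EuclideanSpace ℝ (Fin n₀)
local notation "𝔼₁" => EuclideanSpace ℝ (Fin n₁)

/-! ### Invariant vector fields -/

lemma IsMulRelated.congr {A B C A' B' C' : X₁ → 𝔼₁} (h : X.IsMulRelated A B C)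
    (hA : ∀ p, A p = A' p) (hB : ∀ p, B p = B' p) (hC : ∀ p, C p = C' p) :
    X.IsMulRelated A' B' C' := by
  rwa [← funext hA, ← funext hB, ← funext hC]

lemma IsMulRelated.add {A B C A' B' C' : X₁ → 𝔼₁} (h : X.IsMulRelated A B C)
    (h' : X.IsMulRelated A' B' C') :
    X.IsMulRelated (fun p => A p + A' p) (fun p => B p + B' p) (fun p => C p + C' p) where
  comp p q hpq := by rw [map_add, map_add, h.comp p q hpq, h'.comp p q hpq]
  mul p q hpq := by
    rw [tmul_add hpq (h.comp p q hpq) (h'.comp p q hpq), h.mul p q hpq, h'.mul p q hpq]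

lemma IsMulRelated.const_smul {A B C : X₁ → 𝔼₁} (c : ℝ) (h : X.IsMulRelated A B C) :
    X.IsMulRelated (fun p => c • A p) (fun p => c • B p) (fun p => c • C p) where
  comp p q hpq := by rw [map_smul, map_smul, h.comp p q hpq]
  mul p q hpq := by rw [tmul_smul hpq (h.comp p q hpq), h.mul p q hpq]

lemma isMulRelated_zero : X.IsMulRelated (fun _ => 0) (fun _ => 0) (fun _ => 0) where
  comp p q _ := by rw [map_zero, map_zero]
  mul p q hpq := tmul_zero hpq

variable (X) in
/-- The push-forward of a vector field along the inversion. -/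
def invField (A : X₁ → 𝔼₁) (p : X₁) : 𝔼₁ := X.di (X.i p) (A (X.i p))

lemma di_eq_invField (A : X₁ → 𝔼₁) (p : X₁) : X.di p (A p) = X.invField A (X.i p) := by
  rw [invField, X.i_i]

lemma invField_smooth {A : X₁ → 𝔼₁} (hA : IsSmoothField (k := n₁) A) :
    IsSmoothField (k := n₁) (X.invField A) := fun p => by
  have h := SmoothAlong.mder (SmoothAlong.comp (b := fun p => p) (v := A) (hA (X.i p))
    (X.i_smooth p)) (X.i_smooth (X.i p))
  refine SmoothAlong.congr h (Eventually.of_forall fun p => (X.i_i p).symm)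
    (Eventually.of_forall fun p => rfl)

lemma invField_mbr {A B : X₁ → 𝔼₁} (hA : IsSmoothField (k := n₁) A)
    (hB : IsSmoothField (k := n₁) B) (p : X₁) :
    X.invField (mbr (𝓡 n₁) A B) p = mbr (𝓡 n₁) (X.invField A) (X.invField B) p := by
  have h := mder_mbr_of_related (X.i_smooth (X.i p)) (hA (X.i p)) (hB (X.i p))
    (invField_smooth (X := X) hA _) (invField_smooth (X := X) hB _)
    (Eventually.of_forall fun y => di_eq_invField A y)
    (Eventually.of_forall fun y => di_eq_invField B y)
  rw [X.i_i] at h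
  exact h

lemma IsMulRelated.inv {A B C : X₁ → 𝔼₁} (h : X.IsMulRelated A B C) :
    X.IsMulRelated (X.invField B) (X.invField A) (X.invField C) := by
  have hc : ∀ p q, X.s p = X.t q → X.s (X.i q) = X.t (X.i p) := fun p q hpq => by
    rw [X.s_i, X.t_i, hpq]
  refine ⟨fun p q hpq => ?_, fun p q hpq => ?_⟩
  · have h1 := h.comp _ _ (hc p q hpq)
    have h2 := ds_di (X := X) (X.i p) (B (X.i p))
    have h3 := dt_di (X := X) (X.i q) (A (X.i q))
    rw [X.i_i] at h2 h3
    exact h2.trans (h1.symm.trans h3.symm)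
  · have h1 := di_tmul (hc p q hpq) (h.comp _ _ (hc p q hpq))
    rw [h.mul _ _ (hc p q hpq), ← i_pmul hpq, X.i_i, X.i_i] at h1
    exact h1.symm

/-- Right-invariant and left-invariant vector fields commute: `(A, 0, A)` and `(0, B, B)` are
related triples, hence so is `(0, 0, [A, B])`. -/
lemma IsMulRelated.mbr_eq_zero {A B : X₁ → 𝔼₁} (hA : X.IsMulRelated A (fun _ => 0) A)
    (hB : X.IsMulRelated (fun _ => 0) B B) (sA : IsSmoothField (k := n₁) A)
    (sB : IsSmoothField (k := n₁) B) (p : X₁) : _root_.mbr (𝓡 n₁) A B p = 0 := by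
  have h := hA.mbr hB sA isSmoothField_zero sA isSmoothField_zero sB sB
  have h1 := h.mul p (X.u (X.s p)) (X.t_u _).symm
  rw [mbr_zero_left, mbr_zero_right, tmul_zero (X.t_u _).symm, X.pmul_u] at h1
  exact h1.symm

variable (X) in
/-- The right-invariant vector field of a section, read in the model space. -/
def rightInv (α : X₀ → 𝔼₁) (p : X₁) : 𝔼₁ := X.rightField α p

variable (X) in
/-- The left-invariant vector field of a section, read in the model space. -/
def leftInv (α : X₀ → 𝔼₁) (p : X₁) : 𝔼₁ := X.leftField α p

variable (X) in
/-- The anchor of a section, read in the model space. -/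
def rho (α : X₀ → 𝔼₁) (x : X₀) : 𝔼₀ := X.dt (X.u x) (α x)

lemma rightInv_eq (α : X₀ → 𝔼₁) (p : X₁) :
    X.rightInv α p = X.tmul (X.u (X.t p)) p (α (X.t p)) 0 := (tmul_eq (X.s_u _) _ _).symm

lemma leftInv_eq_neg_tmul (α : X₀ → 𝔼₁) (p : X₁) :
    X.leftInv α p = -X.tmul p (X.u (X.s p)) 0 (X.di (X.u (X.s p)) (α (X.s p))) :=
  congrArg Neg.neg (tmul_eq (X.t_u _).symm _ _).symm

section Sections

variable {α β : X₀ → EuclideanSpace ℝ (Fin n₁)}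

lemma mem_algebroidSections : α ∈ X.algebroidSections ↔
    (∀ x, SmoothAlong (𝓡 n₀) (𝓡 n₁) X.u α x) ∧ ∀ x, X.ds (X.u x) (α x) = 0 := Iff.rfl

lemma rightInv_isMulRelated (hα : ∀ x, X.ds (X.u x) (α x) = 0) :
    X.IsMulRelated (X.rightInv α) (fun _ => 0) (X.rightInv α) := by
  have hc : ∀ p, X.ds (X.u (X.t p)) (α (X.t p)) = X.dt p 0 := fun p => by rw [hα, map_zero]
  refine ⟨fun p q hpq => ?_, fun p q hpq => ?_⟩
  · rw [rightInv_eq, map_zero]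
    have h := ds_tmul (X.s_u _) (hc p)
    rwa [X.u_pmul, map_zero] at h
  · rw [rightInv_eq, rightInv_eq, t_pmul hpq]
    have h := tmul_assoc (X.s_u _) hpq (hc p) (c := 0) (by rw [map_zero, map_zero])
    rwa [X.u_pmul, tmul_zero hpq] at h

/-- A vector field `A` with `A(p * q) = dR_q(A(p))` is determined by its values at the units. -/
lemma IsMulRelated.rightInv_eq {A : X₁ → 𝔼₁} (h : X.IsMulRelated A (fun _ => 0) A) (p : X₁) :
    X.rightInv (fun x => A (X.u x)) p = A p := by
  have h1 := h.mul (X.u (X.t p)) p (X.s_u _)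
  rw [X.u_pmul] at h1
  exact (LieGroupoid.rightInv_eq _ p).trans h1

lemma IsMulRelated.ds_eq_zero {A : X₁ → 𝔼₁} (h : X.IsMulRelated A (fun _ => 0) A) (p : X₁) :
    X.ds p (A p) = 0 := by
  rw [h.comp p (X.u (X.s p)) (X.t_u _).symm, map_zero]

lemma dt_rightInv (hα : ∀ x, X.ds (X.u x) (α x) = 0) (p : X₁) :
    X.dt p (X.rightInv α p) = X.rho α (X.t p) := by
  have h := dt_tmul (X.s_u _) (v := α (X.t p)) (w := 0) (show _ = X.dt p 0 by rw [hα, map_zero])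
  rw [X.u_pmul] at h
  rw [rightInv_eq]
  exact h

lemma rightInv_smooth (hα : α ∈ X.algebroidSections) :
    IsSmoothField (k := n₁) (X.rightInv α) := fun p => by
  rw [mem_algebroidSections] at hα
  have h := LieGroupoid.SmoothAlong.tmul (X := X) (SmoothAlong.comp (hα.1 (X.t p)) (X.t_smooth p))
    (smoothAlong_zero (I := 𝓡 n₁) (b := fun p : X₁ => p) contMDiffAt_id)
    (Eventually.of_forall fun p => X.s_u _)
    (Eventually.of_forall fun p => by rw [hα.2, map_zero])
  exact SmoothAlong.congr h (Eventually.of_forall fun p => (X.u_pmul p).symm)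
    (Eventually.of_forall fun p => rightInv_eq α p)

lemma rightInv_add (hα : ∀ x, X.ds (X.u x) (α x) = 0) (hβ : ∀ x, X.ds (X.u x) (β x) = 0) :
    X.rightInv (fun x => α x + β x) = fun p => X.rightInv α p + X.rightInv β p := funext fun p => by
  rw [rightInv_eq, rightInv_eq, rightInv_eq, ← tmul_add (X.s_u _), add_zero] <;>
    simp [hα, hβ]

lemma rightInv_smul (c : ℝ) (hα : ∀ x, X.ds (X.u x) (α x) = 0) :
    X.rightInv (fun x => c • α x) = fun p => c • X.rightInv α p := funext fun p => by
  rw [rightInv_eq, rightInv_eq, ← tmul_smul (X.s_u _), smul_zero]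
  simp [hα]

/-- The left-invariant field is the negative of the image of the right-invariant field under the
inversion. -/
lemma leftInv_eq (hα : ∀ x, X.ds (X.u x) (α x) = 0) (p : X₁) :
    X.leftInv α p = -X.invField (X.rightInv α) p := by
  have h := di_tmul (X.s_u _) (v := α (X.t (X.i p))) (w := 0)
    (show _ = X.dt (X.i p) 0 by rw [hα, map_zero])
  rw [X.u_pmul, X.i_i, X.i_u, X.t_i, map_zero] at h
  rw [leftInv_eq_neg_tmul, invField, rightInv_eq, X.t_i, h]

lemma leftInv_smooth (hα : α ∈ X.algebroidSections) :
    IsSmoothField (k := n₁) (X.leftInv α) := by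
  rw [show X.leftInv α = fun p => -X.invField (X.rightInv α) p from
    funext (leftInv_eq hα.2)]
  exact (invField_smooth (rightInv_smooth hα)).neg

lemma leftInv_isMulRelated (hα : ∀ x, X.ds (X.u x) (α x) = 0) :
    X.IsMulRelated (fun _ => 0) (X.leftInv α) (X.leftInv α) := by
  have h := (rightInv_isMulRelated hα).inv.const_smul (-1)
  refine h.congr (fun p => ?_) (fun p => ?_) (fun p => ?_)
  · rw [invField, map_zero, smul_zero]
  all_goals rw [neg_one_smul, leftInv_eq hα]

lemma dt_leftInv (hα : ∀ x, X.ds (X.u x) (α x) = 0) (p : X₁) :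
    X.dt p (X.leftInv α p) = 0 := by
  rw [← (leftInv_isMulRelated hα).comp (X.u (X.t p)) p (X.s_u _), map_zero]

lemma ds_leftInv (hα : ∀ x, X.ds (X.u x) (α x) = 0) (p : X₁) :
    X.ds p (X.leftInv α p) = -X.rho α (X.s p) := by
  have h := ds_di (X := X) (X.i p) (X.rightInv α (X.i p))
  rw [X.i_i, dt_rightInv hα, X.t_i] at h
  rw [leftInv_eq hα, map_neg, invField, h]

/-- Opposite contributions of a section to a product `p * q`, at the end of `p` and at the
beginning of `q`, cancel. -/
lemma isMulRelated_left_right (hα : ∀ x, X.ds (X.u x) (α x) = 0) :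
    X.IsMulRelated (fun p => -X.leftInv α p) (X.rightInv α) (fun _ => 0) := by
  refine ⟨fun p q hpq => ?_, fun p q hpq => ?_⟩
  · rw [map_neg, ds_leftInv hα, dt_rightInv hα, neg_neg, hpq]
  · set x := X.t q with hx
    have hi : X.dt (X.u x) (X.di (X.u x) (α x)) = 0 := by
      have h := dt_di (X := X) (X.u x) (α x)
      rwa [hα, X.i_u] at h
    have hi' : X.ds (X.u x) (X.di (X.u x) (α x)) = X.dt (X.u x) (α x) := by
      have h := ds_di (X := X) (X.u x) (α x)
      rwa [X.i_u] at h
    have h1 : -X.leftInv α p = X.tmul p (X.u x) 0 (X.di (X.u x) (α x)) := by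
      rw [leftInv_eq_neg_tmul, hpq, neg_neg]
    have h2 : X.dt q (0 : 𝔼₁) = 0 := map_zero _
    have h3 : X.s (X.u x) = X.t q := X.s_u x
    have h4 : X.s p = X.t (X.u x) := hpq.trans (X.t_u x).symm
    have huu : X.s (X.u x) = X.t (X.u x) := (X.s_u x).trans (X.t_u x).symm
    have h5 : X.pmul p (X.u x) = p := by
      have := X.pmul_u p
      rwa [hpq] at this
    have h6 : X.pmul (X.u x) q = q := X.u_pmul q
    have h7 : X.pmul (X.u x) (X.u x) = X.u x := by
      have := X.u_pmul (X.u x)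
      rwa [X.t_u] at this
    -- the product of `α⁻¹` and `α` at the unit of `x`
    have h8 : X.tmul (X.u x) (X.u x) (X.di (X.u x) (α x)) (α x) = 0 := by
      have h := tmul_i_left (X := X) (X.u x) (α x)
      rwa [X.i_u, hα, map_zero] at h
    have h9 := tmul_assoc huu h3 (c := 0) hi' ((hα x).trans h2.symm)
    rw [h7, h6, h8, tmul_zero h3] at h9
    have h10 := tmul_assoc h4 (q := X.u x) (r := q) h3 (a := 0) (b := X.di (X.u x) (α x))
      (c := X.tmul (X.u x) q (α x) 0) (by rw [hi, map_zero])
      (by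
        have h := dt_tmul h3 ((hα x).trans h2.symm)
        rw [h6] at h
        rw [h, hi'])
    rw [h5, h6, ← h9, tmul_zero hpq] at h10
    rw [h1, rightInv_eq]
    exact h10

/-- The field `α^r - α^l` is multiplicative, being the sum of the related triples `(α^r, 0, α^r)`,
`(-α^l, α^r, 0)` and `(0, -α^l, -α^l)`. -/
lemma right_sub_left_isMulRelated (hα : ∀ x, X.ds (X.u x) (α x) = 0) :
    X.IsMulRelated (fun p => X.rightInv α p - X.leftInv α p)
      (fun p => X.rightInv α p - X.leftInv α p)
      (fun p => X.rightInv α p - X.leftInv α p) := by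
  have h := ((rightInv_isMulRelated hα).add (isMulRelated_left_right hα)).add
    ((leftInv_isMulRelated hα).const_smul (-1))
  refine h.congr (fun p => ?_) (fun p => ?_) (fun p => ?_)
  all_goals
    rw [neg_one_smul ℝ]
    abel

end Sections

/-! ### Multiplicative vector fields -/

lemma tmul_left_cancel {p q : X₁} (h : X.s p = X.t q) {a b b' : 𝔼₁} (hb : X.ds p a = X.dt q b)
    (hb' : X.ds p a = X.dt q b') (e : X.tmul p q a b = X.tmul p q a b') : b = b' := by
  have key : ∀ c, X.ds p a = X.dt q c →
      X.tmul (X.i p) (X.pmul p q) (X.di p a) (X.tmul p q a c) = c := fun c hc => by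
    rw [← tmul_assoc (X.s_i p) h (ds_di p a) hc, X.i_pmul_self, tmul_i_left, hc, h, tmul_u_left]
  rw [← key b hb, ← key b' hb', e]

/-- A multiplicative vector field is invariant under inversion. -/
lemma IsMulRelated.invField_eq {ξ : X₁ → 𝔼₁} (h : X.IsMulRelated ξ ξ ξ) (p : X₁) :
    X.invField ξ p = ξ p := by
  have hu : ∀ x, ξ (X.u x) = X.du x (X.ds (X.u x) (ξ (X.u x))) := fun x => by
    have hx : X.s (X.u x) = X.t (X.u x) := (X.s_u x).trans (X.t_u x).symm
    have h1 := tmul_u_right (X := X) (X.u x) (ξ (X.u x))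
    have h2 := h.mul _ _ hx
    have h3 := X.pmul_u (X.u x)
    rw [X.s_u] at h1 h3
    rw [h3] at h2
    exact tmul_left_cancel hx (h.comp _ _ hx) (dt_du (X := X) _ _).symm (h2.trans h1.symm)
  suffices h0 : ∀ p, ξ (X.i p) = X.di p (ξ p) by
    rw [invField, ← h0, X.i_i]
  intro p
  refine tmul_left_cancel (p := p) (X.t_i p).symm (h.comp _ _ (X.t_i p).symm) (dt_di p _).symm ?_
  rw [h.mul _ _ (X.t_i p).symm, tmul_i_right, X.pmul_i, hu, h.comp _ _ (X.s_u (X.t p))]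

lemma mem_multiplicativeFields {ξ : X₁ → 𝔼₁} {v : X₀ → 𝔼₀} :
    (show X.FieldPair from (ξ, v)) ∈ X.multiplicativeFields ↔
      IsSmoothField (k := n₁) ξ ∧ IsSmoothField (k := n₀) v ∧
      (∀ p, X.ds p (ξ p) = v (X.s p)) ∧ (∀ p, X.dt p (ξ p) = v (X.t p)) ∧
      X.IsMulRelated ξ ξ ξ := by
  refine ⟨fun h => ⟨h.1, h.2.1, h.2.2.1, h.2.2.2.1, ⟨fun p q hpq => ?_, fun p q hpq => ?_⟩⟩,
    fun h => ⟨h.1, h.2.1, h.2.2.1, h.2.2.2.1, fun z => ?_⟩⟩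
  · exact (h.2.2.1 p).trans ((congrArg v hpq).trans (h.2.2.2.1 q).symm)
  · rw [tmul_eq hpq, pmul_eq hpq]
    exact (h.2.2.2.2 ⟨(p, q), hpq⟩).symm
  · have h1 := h.2.2.2.2.mul z.1.1 z.1.2 z.2
    rw [tmul_eq z.2, pmul_eq z.2] at h1
    exact h1.symm

end LieGroupoid

namespace LieGroupoid

variable {n₀ n₁ : ℕ} {X₀ X₁ : Type*}
  [TopologicalSpace X₀] [ChartedSpace (EuclideanSpace ℝ (Fin n₀)) X₀] [IsManifold (𝓡 n₀) ∞ X₀]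
  [TopologicalSpace X₁] [ChartedSpace (EuclideanSpace ℝ (Fin n₁)) X₁] [IsManifold (𝓡 n₁) ∞ X₁]
  {X : LieGroupoid n₀ n₁ X₀ X₁} {η : SmoothMetric n₀ X₀}

local notation "𝔼₀" => EuclideanSpace ℝ (Fin n₀)
local notation "𝔼₁" => EuclideanSpace ℝ (Fin n₁)
local notation "𝔽" => (X₁ → EuclideanSpace ℝ (Fin n₁)) × (X₀ → EuclideanSpace ℝ (Fin n₀))

/-! ### The crossed module of multiplicative Killing fields -/

lemma IsMulRelated.mem_algebroidSections {A : X₁ → 𝔼₁} (h : X.IsMulRelated A (fun _ => 0) A)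
    (sA : IsSmoothField (k := n₁) A) :
    (show X.UnitField from fun x => A (X.u x)) ∈ X.algebroidSections :=
  ⟨fun x => SmoothAlong.comp (b := fun p => p) (v := A) (sA _) (X.u_smooth x),
    fun _ => h.ds_eq_zero _⟩

lemma dt_mbr {A B : X₁ → 𝔼₁} {v w : X₀ → 𝔼₀} (sA : IsSmoothField (k := n₁) A)
    (sB : IsSmoothField (k := n₁) B) (sv : IsSmoothField (k := n₀) v)
    (sw : IsSmoothField (k := n₀) w) (hA : ∀ p, X.dt p (A p) = v (X.t p))
    (hB : ∀ p, X.dt p (B p) = w (X.t p)) (p : X₁) :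
    X.dt p (mbr (𝓡 n₁) A B p) = mbr (𝓡 n₀) v w (X.t p) :=
  mder_mbr_of_related (X.t_smooth p) (sA p) (sB p) (sv _) (sw _) (Eventually.of_forall hA)
    (Eventually.of_forall hB)

lemma ds_mbr {A B : X₁ → 𝔼₁} {v w : X₀ → 𝔼₀} (sA : IsSmoothField (k := n₁) A)
    (sB : IsSmoothField (k := n₁) B) (sv : IsSmoothField (k := n₀) v)
    (sw : IsSmoothField (k := n₀) w) (hA : ∀ p, X.ds p (A p) = v (X.s p))
    (hB : ∀ p, X.ds p (B p) = w (X.s p)) (p : X₁) :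
    X.ds p (mbr (𝓡 n₁) A B p) = mbr (𝓡 n₀) v w (X.s p) :=
  mder_mbr_of_related (X.s_smooth p) (sA p) (sB p) (sv _) (sw _) (Eventually.of_forall hA)
    (Eventually.of_forall hB)

/-- Membership in `𝔬_m(X)`. -/
lemma mem_killing_𝔤 {ξ : X₁ → 𝔼₁} {v : X₀ → 𝔼₀} :
    (show X.FieldPair from (ξ, v)) ∈ (X.killingCrossedModule η).𝔤 ↔
      (IsSmoothField (k := n₁) ξ ∧ IsKilling (k := n₀) η v ∧
      (∀ p, X.ds p (ξ p) = v (X.s p)) ∧ (∀ p, X.dt p (ξ p) = v (X.t p)) ∧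
      X.IsMulRelated ξ ξ ξ) := by
  change (show X.FieldPair from (ξ, v)) ∈ X.multiplicativeFields ∧ IsKilling (k := n₀) η v ↔ _
  rw [mem_multiplicativeFields]
  exact ⟨fun h => ⟨h.1.1, h.2, h.1.2.2⟩, fun h => ⟨⟨h.1, h.2.1.1, h.2.2⟩, h.2.1⟩⟩

lemma mem_killing_𝔥 {α : X₀ → 𝔼₁} :
    α ∈ (X.killingCrossedModule η).𝔥 ↔ α ∈ X.algebroidSections ∧ IsKilling (k := n₀) η (X.rho α) :=
  Iff.rfl

/-- A right-invariant field over a Killing field restricts to an element of `Γ_η(A_X)`. -/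
lemma IsMulRelated.mem_killing_𝔥 {A : X₁ → 𝔼₁} {v : X₀ → 𝔼₀}
    (h : X.IsMulRelated A (fun _ => 0) A) (sA : IsSmoothField (k := n₁) A)
    (hA : ∀ p, X.dt p (A p) = v (X.t p)) (hv : IsKilling (k := n₀) η v) :
    (fun x => A (X.u x)) ∈ (X.killingCrossedModule η).𝔥 := by
  refine LieGroupoid.mem_killing_𝔥.2 ⟨h.mem_algebroidSections sA, ?_⟩
  have : X.rho (fun x => A (X.u x)) = v := funext fun x => by rw [rho, hA, X.t_u]
  rwa [this]

section Bracket

variable {α β : X₀ → EuclideanSpace ℝ (Fin n₁)} {ξ : X₁ → EuclideanSpace ℝ (Fin n₁)}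
  {v : X₀ → EuclideanSpace ℝ (Fin n₀)}

lemma mbr_right_right_isMulRelated (hα : α ∈ X.algebroidSections) (hβ : β ∈ X.algebroidSections) :
    X.IsMulRelated (mbr (𝓡 n₁) (X.rightInv α) (X.rightInv β)) (fun _ => 0)
      (mbr (𝓡 n₁) (X.rightInv α) (X.rightInv β)) := by
  have sα := rightInv_smooth hα
  have sβ := rightInv_smooth hβ
  exact ((rightInv_isMulRelated hα.2).mbr (rightInv_isMulRelated hβ.2) sα isSmoothField_zero sα sβ
    isSmoothField_zero sβ).congr (fun _ => rfl) (mbr_zero_left _) fun _ => rfl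

lemma mbr_mult_right_isMulRelated (hξ : X.IsMulRelated ξ ξ ξ) (sξ : IsSmoothField (k := n₁) ξ)
    (hα : α ∈ X.algebroidSections) :
    X.IsMulRelated (mbr (𝓡 n₁) ξ (X.rightInv α)) (fun _ => 0)
      (mbr (𝓡 n₁) ξ (X.rightInv α)) := by
  have sα := rightInv_smooth hα
  exact (hξ.mbr (rightInv_isMulRelated hα.2) sξ sξ sξ sα
    isSmoothField_zero sα).congr (fun _ => rfl) (mbr_zero_right _) fun _ => rfl

lemma rho_smooth (hα : α ∈ X.algebroidSections) : IsSmoothField (k := n₀) (X.rho α) := fun x => by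
  have h := SmoothAlong.mder (hα.1 x) (X.t_smooth (X.u x))
  exact SmoothAlong.congr h (Eventually.of_forall fun x => (X.t_u x).symm)
    (Eventually.of_forall fun x => rfl)

variable (X) in
/-- The bracket of sections of the Lie algebroid. -/
def secBr (α β : X₀ → 𝔼₁) (x : X₀) : 𝔼₁ := mbr (𝓡 n₁) (X.rightInv α) (X.rightInv β) (X.u x)

variable (X) in
/-- The derivative of a section of the Lie algebroid along a vector field on `X₁`. -/
def secDer (ξ : X₁ → 𝔼₁) (α : X₀ → 𝔼₁) (x : X₀) : 𝔼₁ := mbr (𝓡 n₁) ξ (X.rightInv α) (X.u x)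

lemma rightInv_secBr (hα : α ∈ X.algebroidSections) (hβ : β ∈ X.algebroidSections) :
    X.rightInv (X.secBr α β) = mbr (𝓡 n₁) (X.rightInv α) (X.rightInv β) :=
  funext fun p => (mbr_right_right_isMulRelated hα hβ).rightInv_eq p

lemma rightInv_secDer (hξ : X.IsMulRelated ξ ξ ξ) (sξ : IsSmoothField (k := n₁) ξ)
    (hα : α ∈ X.algebroidSections) :
    X.rightInv (X.secDer ξ α) = mbr (𝓡 n₁) ξ (X.rightInv α) :=
  funext fun p => (mbr_mult_right_isMulRelated hξ sξ hα).rightInv_eq p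

lemma secBr_mem (hα : α ∈ (X.killingCrossedModule η).𝔥) (hβ : β ∈ (X.killingCrossedModule η).𝔥) :
    X.secBr α β ∈ (X.killingCrossedModule η).𝔥 :=
  (mbr_right_right_isMulRelated hα.1 hβ.1).mem_killing_𝔥
    ((rightInv_smooth hα.1).mbr (rightInv_smooth hβ.1))
    (dt_mbr (rightInv_smooth hα.1) (rightInv_smooth hβ.1) (rho_smooth hα.1) (rho_smooth hβ.1)
      (dt_rightInv hα.1.2) (dt_rightInv hβ.1.2)) (IsKilling.mbr hα.2 hβ.2)

lemma secDer_mem (hξ : (show X.FieldPair from (ξ, v)) ∈ (X.killingCrossedModule η).𝔤)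
    (hα : α ∈ (X.killingCrossedModule η).𝔥) :
    X.secDer ξ α ∈ (X.killingCrossedModule η).𝔥 := by
  obtain ⟨sξ, hv, -, htξ, hξ⟩ := mem_killing_𝔤.1 hξ
  exact (mbr_mult_right_isMulRelated hξ sξ hα.1).mem_killing_𝔥
    (sξ.mbr (rightInv_smooth hα.1))
    (dt_mbr sξ (rightInv_smooth hα.1) hv.1 (rho_smooth hα.1) htξ
      (dt_rightInv hα.1.2)) (IsKilling.mbr hv hα.2)

lemma rho_secBr (hα : α ∈ X.algebroidSections) (hβ : β ∈ X.algebroidSections) (x : X₀) :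
    X.rho (X.secBr α β) x = mbr (𝓡 n₀) (X.rho α) (X.rho β) x := by
  have h := dt_mbr (rightInv_smooth hα) (rightInv_smooth hβ) (rho_smooth hα) (rho_smooth hβ)
    (dt_rightInv hα.2) (dt_rightInv hβ.2) (X.u x)
  rwa [X.t_u] at h

lemma rho_secDer (sξ : IsSmoothField (k := n₁) ξ) (sv : IsSmoothField (k := n₀) v)
    (htξ : ∀ p, X.dt p (ξ p) = v (X.t p)) (hα : α ∈ X.algebroidSections) (x : X₀) :
    X.rho (X.secDer ξ α) x = mbr (𝓡 n₀) v (X.rho α) x := by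
  have h := dt_mbr sξ (rightInv_smooth hα) sv (rho_smooth hα) htξ (dt_rightInv hα.2) (X.u x)
  rwa [X.t_u] at h

/-- The inversion is an automorphism of the Lie algebra of vector fields that maps `α^r` to `-α^l`;
hence the sign. -/
lemma leftInv_secBr (hα : α ∈ X.algebroidSections) (hβ : β ∈ X.algebroidSections) (p : X₁) :
    X.leftInv (X.secBr α β) p = -mbr (𝓡 n₁) (X.leftInv α) (X.leftInv β) p := by
  have sα := invField_smooth (X := X) (rightInv_smooth hα)
  have sβ := invField_smooth (X := X) (rightInv_smooth hβ)
  have e : ∀ {γ : X₀ → 𝔼₁}, γ ∈ X.algebroidSections →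
      X.leftInv γ = fun p => (-1 : ℝ) • X.invField (X.rightInv γ) p := fun hγ => funext fun p => by
    rw [leftInv_eq hγ.2, neg_one_smul]
  rw [leftInv_eq (α := X.secBr α β) ((mbr_right_right_isMulRelated hα hβ).mem_algebroidSections
      ((rightInv_smooth hα).mbr (rightInv_smooth hβ))).2, rightInv_secBr hα hβ,
    invField_mbr (rightInv_smooth hα) (rightInv_smooth hβ), e hα, e hβ, mbr_smul_left _ sα,
    mbr_smul_right _ sβ, neg_one_smul, neg_one_smul, neg_neg]

lemma leftInv_secDer (hξ : X.IsMulRelated ξ ξ ξ) (sξ : IsSmoothField (k := n₁) ξ)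
    (hα : α ∈ X.algebroidSections) (p : X₁) :
    X.leftInv (X.secDer ξ α) p = mbr (𝓡 n₁) ξ (X.leftInv α) p := by
  have sα := invField_smooth (X := X) (rightInv_smooth hα)
  have e : X.leftInv α = fun p => (-1 : ℝ) • X.invField (X.rightInv α) p := funext fun p => by
    rw [leftInv_eq hα.2, neg_one_smul]
  rw [leftInv_eq (α := X.secDer ξ α) ((mbr_mult_right_isMulRelated hξ sξ hα).mem_algebroidSections
      (sξ.mbr (rightInv_smooth hα))).2, rightInv_secDer hξ sξ hα,
    invField_mbr sξ (rightInv_smooth hα), show X.invField ξ = ξ from funext hξ.invField_eq, e,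
    mbr_smul_right _ sα, neg_one_smul]

end Bracket

section Algebra

variable {α β γ : X₀ → EuclideanSpace ℝ (Fin n₁)} {ξ ξ' : X₁ → EuclideanSpace ℝ (Fin n₁)}
  {v v' : X₀ → EuclideanSpace ℝ (Fin n₀)}

lemma rho_add (x : X₀) : X.rho (fun x => α x + β x) x = X.rho α x + X.rho β x := map_add _ _ _

lemma rho_smul (c : ℝ) (x : X₀) : X.rho (fun x => c • α x) x = c • X.rho α x := map_smul _ _ _

lemma algebroidSections_zero : (fun _ => (0 : 𝔼₁)) ∈ X.algebroidSections :=
  ⟨fun x => smoothAlong_zero (X.u_smooth x), fun _ => map_zero _⟩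

lemma algebroidSections_add (hα : α ∈ X.algebroidSections) (hβ : β ∈ X.algebroidSections) :
    (fun x => α x + β x) ∈ X.algebroidSections :=
  ⟨fun x => SmoothAlong.add (hα.1 x) (hβ.1 x),
    fun x => (map_add (X.ds (X.u x)) _ _).trans
      ((congrArg₂ (· + ·) (hα.2 x) (hβ.2 x)).trans (add_zero (0 : 𝔼₀)))⟩

lemma algebroidSections_smul (c : ℝ) (hα : α ∈ X.algebroidSections) :
    (fun x => c • α x) ∈ X.algebroidSections :=
  ⟨fun x => SmoothAlong.const_smul c (hα.1 x),
    fun x => (map_smul (X.ds (X.u x)) _ _).trans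
      ((congrArg (c • ·) (hα.2 x)).trans (smul_zero (A := 𝔼₀) c))⟩

lemma leftInv_add (hα : α ∈ X.algebroidSections) (hβ : β ∈ X.algebroidSections) (p : X₁) :
    X.leftInv (fun x => α x + β x) p = X.leftInv α p + X.leftInv β p := by
  rw [leftInv_eq (algebroidSections_add hα hβ).2, leftInv_eq hα.2, leftInv_eq hβ.2,
    rightInv_add hα.2 hβ.2]
  simp only [invField, map_add, neg_add]

lemma leftInv_smul (c : ℝ) (hα : α ∈ X.algebroidSections) (p : X₁) :
    X.leftInv (fun x => c • α x) p = c • X.leftInv α p := by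
  rw [leftInv_eq (algebroidSections_smul c hα).2, leftInv_eq hα.2, rightInv_smul c hα.2]
  simp only [invField, map_smul, smul_neg]

lemma killing_isLieAlgebraOn_𝔤 :
    IsLieAlgebraOn (X.killingCrossedModule η).𝔤 (X.killingCrossedModule η).brG where
  zero_mem := mem_killing_𝔤.2 ⟨isSmoothField_zero, isKilling_zero, fun _ => map_zero _,
    fun _ => map_zero _, isMulRelated_zero⟩
  add_mem := fun (⟨ξ, v⟩ : 𝔽) h (⟨ξ', v'⟩ : 𝔽) h' => by
    obtain ⟨sξ, hv, hs, ht, hξ⟩ := mem_killing_𝔤.1 h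
    obtain ⟨sξ', hv', hs', ht', hξ'⟩ := mem_killing_𝔤.1 h'
    exact mem_killing_𝔤.2 ⟨sξ.add sξ', hv.add hv',
      fun p => (map_add (X.ds p) _ _).trans (congrArg₂ _ (hs p) (hs' p)),
      fun p => (map_add (X.dt p) _ _).trans (congrArg₂ _ (ht p) (ht' p)), hξ.add hξ'⟩
  smul_mem := fun c (⟨ξ, v⟩ : 𝔽) h => by
    obtain ⟨sξ, hv, hs, ht, hξ⟩ := mem_killing_𝔤.1 h
    exact mem_killing_𝔤.2 ⟨sξ.const_smul c, hv.const_smul c,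
      fun p => (map_smul (X.ds p) _ _).trans (congrArg _ (hs p)),
      fun p => (map_smul (X.dt p) _ _).trans (congrArg _ (ht p)), hξ.const_smul c⟩
  br_mem := fun (⟨ξ, v⟩ : 𝔽) h (⟨ξ', v'⟩ : 𝔽) h' => by
    obtain ⟨sξ, hv, hs, ht, hξ⟩ := mem_killing_𝔤.1 h
    obtain ⟨sξ', hv', hs', ht', hξ'⟩ := mem_killing_𝔤.1 h'
    exact mem_killing_𝔤.2 ⟨sξ.mbr sξ', hv.mbr hv', ds_mbr sξ sξ' hv.1 hv'.1 hs hs',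
      dt_mbr sξ sξ' hv.1 hv'.1 ht ht', hξ.mbr hξ' sξ sξ sξ sξ' sξ' sξ'⟩
  add_br := fun (⟨_, _⟩ : 𝔽) h (⟨_, _⟩ : 𝔽) h' (⟨_, _⟩ : 𝔽) _ => Prod.ext
    (funext fun p => mbr_add_left h.1.1 h'.1.1 p) (funext fun x => mbr_add_left h.2.1 h'.2.1 x)
  br_add := fun (⟨_, _⟩ : 𝔽) _ (⟨_, _⟩ : 𝔽) h (⟨_, _⟩ : 𝔽) h' => Prod.ext
    (funext fun p => mbr_add_right h.1.1 h'.1.1 p) (funext fun x => mbr_add_right h.2.1 h'.2.1 x)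
  smul_br := fun c (⟨_, _⟩ : 𝔽) h (⟨_, _⟩ : 𝔽) _ => Prod.ext
    (funext fun p => mbr_smul_left c h.1.1 p) (funext fun x => mbr_smul_left c h.2.1 x)
  br_smul := fun c (⟨_, _⟩ : 𝔽) _ (⟨_, _⟩ : 𝔽) h => Prod.ext
    (funext fun p => mbr_smul_right c h.1.1 p) (funext fun x => mbr_smul_right c h.2.1 x)
  br_self := fun (⟨_, _⟩ : 𝔽) _ => Prod.ext
    (funext fun p => mbr_self _ p) (funext fun x => mbr_self _ x)
  jacobi := fun (⟨_, _⟩ : 𝔽) h (⟨_, _⟩ : 𝔽) h' (⟨_, _⟩ : 𝔽) h'' => Prod.ext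
    (funext fun p => mbr_jacobi h.1.1 h'.1.1 h''.1.1 p)
    (funext fun x => mbr_jacobi h.2.1 h'.2.1 h''.2.1 x)

lemma killing_isLieAlgebraOn_𝔥 :
    IsLieAlgebraOn (X.killingCrossedModule η).𝔥 (X.killingCrossedModule η).brH where
  zero_mem := mem_killing_𝔥.2 ⟨algebroidSections_zero, by
    change IsKilling (k := n₀) η (X.rho fun _ => 0)
    rw [show X.rho (fun _ => (0 : 𝔼₁)) = fun _ => 0 from funext fun _ => map_zero _]
    exact isKilling_zero⟩
  add_mem := fun (α : X₀ → 𝔼₁) h (β : X₀ → 𝔼₁) h' => mem_killing_𝔥.2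
    ⟨algebroidSections_add h.1 h'.1, by
    change IsKilling (k := n₀) η (X.rho fun x => α x + β x)
    rw [show X.rho (fun x => α x + β x) = _ from funext rho_add]
    exact IsKilling.add h.2 h'.2⟩
  smul_mem := fun c (α : X₀ → 𝔼₁) h => mem_killing_𝔥.2 ⟨algebroidSections_smul c h.1, by
    change IsKilling (k := n₀) η (X.rho fun x => c • α x)
    rw [show X.rho (fun x => c • α x) = _ from funext (rho_smul c)]
    exact IsKilling.const_smul c h.2⟩
  br_mem := fun (α : X₀ → 𝔼₁) h (β : X₀ → 𝔼₁) h' => secBr_mem h h'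
  add_br := fun (α : X₀ → 𝔼₁) h (β : X₀ → 𝔼₁) h' (γ : X₀ → 𝔼₁) _ => funext fun x => by
    change X.secBr (fun x => α x + β x) γ x = X.secBr α γ x + X.secBr β γ x
    rw [secBr, rightInv_add h.1.2 h'.1.2, mbr_add_left (rightInv_smooth h.1) (rightInv_smooth h'.1)]
    rfl
  br_add := fun (α : X₀ → 𝔼₁) _ (β : X₀ → 𝔼₁) h (γ : X₀ → 𝔼₁) h' => funext fun x => by
    change X.secBr α (fun x => β x + γ x) x = X.secBr α β x + X.secBr α γ x
    rw [secBr, rightInv_add h.1.2 h'.1.2,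
      mbr_add_right (rightInv_smooth h.1) (rightInv_smooth h'.1)]
    rfl
  smul_br := fun c (α : X₀ → 𝔼₁) h (β : X₀ → 𝔼₁) _ => funext fun x => by
    change X.secBr (fun x => c • α x) β x = c • X.secBr α β x
    rw [secBr, rightInv_smul c h.1.2, mbr_smul_left c (rightInv_smooth h.1)]
    rfl
  br_smul := fun c (α : X₀ → 𝔼₁) _ (β : X₀ → 𝔼₁) h => funext fun x => by
    change X.secBr α (fun x => c • β x) x = c • X.secBr α β x
    rw [secBr, rightInv_smul c h.1.2, mbr_smul_right c (rightInv_smooth h.1)]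
    rfl
  br_self := fun (α : X₀ → 𝔼₁) _ => funext fun x => mbr_self _ _
  jacobi := fun (α : X₀ → 𝔼₁) h (β : X₀ → 𝔼₁) h' (γ : X₀ → 𝔼₁) h'' => funext fun x => by
    change X.secBr α (X.secBr β γ) x = X.secBr (X.secBr α β) γ x + X.secBr β (X.secBr α γ) x
    rw [secBr, secBr, secBr, rightInv_secBr h'.1 h''.1, rightInv_secBr h.1 h'.1,
      rightInv_secBr h.1 h''.1]
    exact mbr_jacobi (rightInv_smooth h.1) (rightInv_smooth h'.1) (rightInv_smooth h''.1) _

/-- `δ` is a homomorphism since right-invariant and left-invariant fields commute. -/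
lemma killing_isLieHomOn_δ : IsLieHomOn (X.killingCrossedModule η).𝔥 (X.killingCrossedModule η).brH
    (X.killingCrossedModule η).𝔤 (X.killingCrossedModule η).brG (X.killingCrossedModule η).δ where
  maps_to := fun (α : X₀ → 𝔼₁) h => by
    refine mem_killing_𝔤.2 ⟨?_, h.2, fun p => ?_, fun p => ?_,
      right_sub_left_isMulRelated h.1.2⟩
    · change IsSmoothField (k := n₁) (fun p => X.rightInv α p - X.leftInv α p)
      simp only [sub_eq_add_neg]
      exact (rightInv_smooth h.1).add (leftInv_smooth h.1).neg
    · change X.ds p (X.rightInv α p - X.leftInv α p) = X.rho α (X.s p)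
      rw [map_sub, ds_leftInv h.1.2, (rightInv_isMulRelated h.1.2).ds_eq_zero, zero_sub, neg_neg]
    · change X.dt p (X.rightInv α p - X.leftInv α p) = X.rho α (X.t p)
      rw [map_sub, dt_leftInv h.1.2, dt_rightInv h.1.2, sub_zero]
  map_add := fun (α : X₀ → 𝔼₁) h (β : X₀ → 𝔼₁) h' => Prod.ext (funext fun p => by
      change X.rightInv (fun x => α x + β x) p - X.leftInv (fun x => α x + β x) p =
        X.rightInv α p - X.leftInv α p + (X.rightInv β p - X.leftInv β p)
      rw [rightInv_add h.1.2 h'.1.2, leftInv_add h.1 h'.1]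
      exact add_sub_add_comm (α := EuclideanSpace ℝ (Fin n₁)) _ _ _ _) (funext fun x => rho_add x)
  map_smul := fun c (α : X₀ → 𝔼₁) h => Prod.ext (funext fun p => by
      change X.rightInv (fun x => c • α x) p - X.leftInv (fun x => c • α x) p =
        c • (X.rightInv α p - X.leftInv α p)
      rw [rightInv_smul c h.1.2, leftInv_smul c h.1, smul_sub]) (funext fun x => rho_smul c x)
  map_br := fun (α : X₀ → 𝔼₁) h (β : X₀ → 𝔼₁) h' => Prod.ext (funext fun p => by
      change X.rightInv (X.secBr α β) p - X.leftInv (X.secBr α β) p =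
        mbr (𝓡 n₁) (fun p => X.rightInv α p - X.leftInv α p)
          (fun p => X.rightInv β p - X.leftInv β p) p
      have r := rightInv_smooth h.1
      have r' := rightInv_smooth h'.1
      have l := (leftInv_smooth h.1).neg
      have l' := (leftInv_smooth h'.1).neg
      have hm : ∀ {γ : X₀ → 𝔼₁}, γ ∈ X.algebroidSections →
          X.IsMulRelated (fun _ => 0) (fun p => -X.leftInv γ p) (fun p => -X.leftInv γ p) :=
        fun hγ => ((leftInv_isMulRelated hγ.2).const_smul (-1)).congr (fun _ => smul_zero _)
          (fun _ => neg_one_smul ℝ _) (fun _ => neg_one_smul ℝ _)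
      have z1 := (rightInv_isMulRelated h.1.2).mbr_eq_zero (hm h'.1) r l' p
      have z2 := (rightInv_isMulRelated h'.1.2).mbr_eq_zero (hm h.1) r' l p
      have e : mbr (𝓡 n₁) (fun p => -X.leftInv α p) (fun p => -X.leftInv β p) p =
          mbr (𝓡 n₁) (X.leftInv α) (X.leftInv β) p := by
        simp only [← neg_one_smul ℝ (X.leftInv α _), ← neg_one_smul ℝ (X.leftInv β _)]
        rw [mbr_smul_left _ (leftInv_smooth h.1), mbr_smul_right _ (leftInv_smooth h'.1)]
        simp
      simp only [sub_eq_add_neg]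
      rw [mbr_add_left r l, mbr_add_right r' l', mbr_add_right r' l', z1, e,
        mbr_swap (fun p => -X.leftInv α p) (X.rightInv β), z2, leftInv_secBr h.1 h'.1,
        rightInv_secBr h.1 h'.1]
      simp) (funext fun x => rho_secBr h.1 h'.1 x)

/-- `(𝔬_m(X), Γ_η(A_X), δ, D)` is a crossed module of Lie algebras: all axioms reduce to the Jacobi
identity on `X₁`, and the Peiffer identity to the vanishing of `[α^l, β^r]`. -/
theorem killing_isCrossedModule : (X.killingCrossedModule η).IsCrossedModule where
  lieG := killing_isLieAlgebraOn_𝔤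
  lieH := killing_isLieAlgebraOn_𝔥
  lieHom_δ := killing_isLieHomOn_δ
  linear_D := fun (⟨ξ, v⟩ : 𝔽) h =>
    { maps_to := fun (α : X₀ → 𝔼₁) hα => secDer_mem h hα
      map_add := fun (α : X₀ → 𝔼₁) hα (β : X₀ → 𝔼₁) hβ => funext fun x => by
        change X.secDer ξ (fun x => α x + β x) x = X.secDer ξ α x + X.secDer ξ β x
        rw [secDer, rightInv_add hα.1.2 hβ.1.2,
          mbr_add_right (rightInv_smooth hα.1) (rightInv_smooth hβ.1)]
        rfl
      map_smul := fun c (α : X₀ → 𝔼₁) hα => funext fun x => by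
        change X.secDer ξ (fun x => c • α x) x = c • X.secDer ξ α x
        rw [secDer, rightInv_smul c hα.1.2, mbr_smul_right c (rightInv_smooth hα.1)]
        rfl }
  derivation_D := fun (⟨ξ, v⟩ : 𝔽) h (α : X₀ → 𝔼₁) hα (β : X₀ → 𝔼₁) hβ => funext fun x => by
    obtain ⟨sξ, -, -, -, hξ⟩ := mem_killing_𝔤.1 h
    change X.secDer ξ (X.secBr α β) x = X.secBr (X.secDer ξ α) β x + X.secBr α (X.secDer ξ β) x
    rw [secDer, secBr, secBr, rightInv_secBr hα.1 hβ.1, rightInv_secDer hξ sξ hα.1,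
      rightInv_secDer hξ sξ hβ.1]
    exact mbr_jacobi sξ (rightInv_smooth hα.1) (rightInv_smooth hβ.1) _
  add_D := fun (⟨_, _⟩ : 𝔽) h (⟨_, _⟩ : 𝔽) h' (α : X₀ → 𝔼₁) _ =>
    funext fun x => mbr_add_left h.1.1 h'.1.1 _
  smul_D := fun c (⟨_, _⟩ : 𝔽) h (α : X₀ → 𝔼₁) _ =>
    funext fun x => mbr_smul_left c h.1.1 _
  br_D := fun (⟨ξ, v⟩ : 𝔽) h (⟨ξ', v'⟩ : 𝔽) h' (α : X₀ → 𝔼₁) hα => funext fun x => by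
    obtain ⟨sξ, -, -, -, hξ⟩ := mem_killing_𝔤.1 h
    obtain ⟨sξ', -, -, -, hξ'⟩ := mem_killing_𝔤.1 h'
    change X.secDer (mbr (𝓡 n₁) ξ ξ') α x =
      X.secDer ξ (X.secDer ξ' α) x - X.secDer ξ' (X.secDer ξ α) x
    rw [secDer, secDer, secDer, rightInv_secDer hξ sξ hα.1, rightInv_secDer hξ' sξ' hα.1,
      mbr_jacobi sξ sξ' (rightInv_smooth hα.1), add_sub_cancel_right]
  δ_D := fun (⟨ξ, v⟩ : 𝔽) h (α : X₀ → 𝔼₁) hα => Prod.ext (funext fun p => by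
      obtain ⟨sξ, -, -, -, hξ⟩ := mem_killing_𝔤.1 h
      change X.rightInv (X.secDer ξ α) p - X.leftInv (X.secDer ξ α) p =
        mbr (𝓡 n₁) ξ (fun p => X.rightInv α p - X.leftInv α p) p
      have e : (fun p => X.rightInv α p - X.leftInv α p) =
          fun p => X.rightInv α p + (-1 : ℝ) • X.leftInv α p := funext fun p => by
        rw [neg_one_smul, sub_eq_add_neg]
      rw [e, mbr_add_right (rightInv_smooth hα.1) ((leftInv_smooth hα.1).const_smul _),
        mbr_smul_right _ (leftInv_smooth hα.1), rightInv_secDer hξ sξ hα.1,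
        leftInv_secDer hξ sξ hα.1, neg_one_smul, sub_eq_add_neg]) (funext fun x => by
      obtain ⟨sξ, hv, -, ht, -⟩ := mem_killing_𝔤.1 h
      exact rho_secDer sξ hv.1 ht hα.1 x)
  peiffer := fun (α : X₀ → 𝔼₁) hα (β : X₀ → 𝔼₁) hβ => funext fun x => by
    change mbr (𝓡 n₁) (fun p => X.rightInv α p - X.leftInv α p) (X.rightInv β) (X.u x) =
      mbr (𝓡 n₁) (X.rightInv α) (X.rightInv β) (X.u x)
    have e : (fun p => X.rightInv α p - X.leftInv α p) =
        fun p => X.rightInv α p + (-1 : ℝ) • X.leftInv α p := funext fun p => by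
      rw [neg_one_smul, sub_eq_add_neg]
    rw [e, mbr_add_left (rightInv_smooth hα.1) ((leftInv_smooth hα.1).const_smul _),
      mbr_smul_left _ (leftInv_smooth hα.1), mbr_swap (X.leftInv α),
      (rightInv_isMulRelated hβ.1.2).mbr_eq_zero (leftInv_isMulRelated hα.1.2)
        (rightInv_smooth hβ.1) (leftInv_smooth hα.1), neg_zero, smul_zero, add_zero]

end Algebra

end LieGroupoid

/-! ### Smooth right actions of Lie groups -/

section Partial

variable {E H M E' H' M' E'' H'' N : Type*}
  [NormedAddCommGroup E''] [NormedSpace ℝ E''] [TopologicalSpace H'']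
  {J : ModelWithCorners ℝ E'' H''} [TopologicalSpace N] [ChartedSpace H'' N]
  [NormedAddCommGroup E] [NormedSpace ℝ E] [TopologicalSpace H] {I : ModelWithCorners ℝ E H}
  [TopologicalSpace M] [ChartedSpace H M]
  [NormedAddCommGroup E'] [NormedSpace ℝ E'] [TopologicalSpace H'] {I' : ModelWithCorners ℝ E' H'}
  [TopologicalSpace M'] [ChartedSpace H' M']

lemma mder_left {F : M × M' → N} {a : M × M'}
    (hF : MDifferentiableAt (I.prod I') J F a) (v : E) :
    mder (I.prod I') J F a (v, 0) = mder I J (fun y => F (y, a.2)) a.1 v := by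
  rw [mder_comp (g := F) (f := fun y => (y, a.2)) hF
    (mdifferentiableAt_id.prodMk mdifferentiableAt_const),
    mder_prodMk (f := fun y => y) (g := fun _ => a.2) mdifferentiableAt_id mdifferentiableAt_const,
    mder_id, mder_const]

lemma mder_right {F : M × M' → N} {a : M × M'}
    (hF : MDifferentiableAt (I.prod I') J F a) (w : E') :
    mder (I.prod I') J F a (0, w) = mder I' J (fun y => F (a.1, y)) a.2 w := by
  rw [mder_comp (g := F) (f := fun y => (a.1, y)) hF
    (mdifferentiableAt_const.prodMk mdifferentiableAt_id),
    mder_prodMk (f := fun _ => a.1) (g := fun y => y) mdifferentiableAt_const mdifferentiableAt_id,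
    mder_id, mder_const]

lemma mder_clm (T : E →L[ℝ] E') (v w : E) : mder 𝓘(ℝ, E) 𝓘(ℝ, E') T v w = T w :=
  congrArg (fun S : E →L[ℝ] E' => S w) T.mfderiv_eq

lemma mder_bilinear (B : E →L[ℝ] E' →L[ℝ] ℝ) {f : N → E} {g : N → E'} {x : N}
    (hf : MDifferentiableAt J 𝓘(ℝ, E) f x) (hg : MDifferentiableAt J 𝓘(ℝ, E') g x) (v : E'') :
    mder J 𝓘(ℝ, ℝ) (fun y => B (f y) (g y)) x v =
      B (mder J 𝓘(ℝ, E) f x v) (g x) + B (f x) (mder J 𝓘(ℝ, E') g x v) := by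
  have hB : ContMDiff (𝓘(ℝ, E).prod 𝓘(ℝ, E')) 𝓘(ℝ, ℝ) ∞ (fun a : E × E' => B a.1 a.2) :=
    (B.contMDiff.comp contMDiff_fst).clm_apply contMDiff_snd
  have hB' := (hB (f x, g x)).mdifferentiableAt (by simp)
  have e : ((mder J 𝓘(ℝ, E) f x v, mder J 𝓘(ℝ, E') g x v) : E × E') =
      (mder J 𝓘(ℝ, E) f x v, 0) + (0, mder J 𝓘(ℝ, E') g x v) := by simp
  rw [mder_comp (g := fun a : E × E' => B a.1 a.2) (f := fun y => (f y, g y)) hB' (hf.prodMk hg),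
    mder_prodMk hf hg, e, map_add, mder_left hB', mder_right hB']
  exact congrArg₂ _ (mder_clm (B.flip (g x)) _ _) (mder_clm (B (f x)) _ _)

end Partial

/-- Smooth right actions of a Lie group on a manifold. -/
structure IsSmoothRightAction {k n : ℕ} {K M : Type*}
    [TopologicalSpace K] [ChartedSpace (EuclideanSpace ℝ (Fin k)) K] [Group K]
    [TopologicalSpace M] [ChartedSpace (EuclideanSpace ℝ (Fin n)) M] (act : M → K → M) : Prop where
  smooth : ContMDiff ((𝓡 n).prod (𝓡 k)) (𝓡 n) ∞ (fun a : M × K => act a.1 a.2)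
  one : ∀ x, act x 1 = x
  mul : ∀ x g h, act x (g * h) = act (act x g) h

section Action

variable {k n : ℕ} {K M : Type*}
  [TopologicalSpace K] [ChartedSpace (EuclideanSpace ℝ (Fin k)) K] [Group K]
  [TopologicalSpace M] [ChartedSpace (EuclideanSpace ℝ (Fin n)) M]
  {act : M → K → M}

local notation "𝔼" => EuclideanSpace ℝ (Fin n)
local notation "𝔨" => EuclideanSpace ℝ (Fin k)

/-- The fundamental vector field of an action. -/
def fund (act : M → K → M) (ζ : 𝔨) (x : M) : 𝔼 := mder (𝓡 k) (𝓡 n) (fun g => act x g) 1 ζ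

/-- The left-invariant vector field on a Lie group, read in the model space. -/
def linv (ζ : 𝔨) (g : K) : 𝔨 := mder (𝓡 k) (𝓡 k) (fun h => g * h) 1 ζ

lemma linv_one (ζ : 𝔨) : linv ζ (1 : K) = ζ := by
  rw [linv, show (fun h : K => 1 * h) = fun h => h from funext one_mul, mder_id]

lemma fund_add (ζ ζ' : 𝔨) (x : M) :
    (fund act (ζ + ζ') x : 𝔼) = fund act ζ x + fund act ζ' x := map_add _ _ _

lemma fund_smul (c : ℝ) (ζ : 𝔨) (x : M) : (fund act (c • ζ) x : 𝔼) = c • fund act ζ x :=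
  map_smul _ _ _

lemma fund_zero (x : M) : (fund act (0 : 𝔨) x : 𝔼) = 0 := map_zero _

namespace IsSmoothRightAction

lemma contMDiff_left (hact : IsSmoothRightAction (k := k) (n := n) act) (g : K) :
    ContMDiff (𝓡 n) (𝓡 n) ∞ (fun x => act x g) :=
  hact.smooth.comp (contMDiff_id.prodMk contMDiff_const)

lemma contMDiff_right (hact : IsSmoothRightAction (k := k) (n := n) act) (x : M) :
    ContMDiff (𝓡 k) (𝓡 n) ∞ (fun g => act x g) :=
  hact.smooth.comp (contMDiff_const.prodMk contMDiff_id)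

lemma mdiff (hact : IsSmoothRightAction (k := k) (n := n) act) (a : M × K) :
    MDifferentiableAt ((𝓡 n).prod (𝓡 k)) (𝓡 n) (fun a : M × K => act a.1 a.2) a :=
  (hact.smooth a).mdifferentiableAt (by simp)

lemma fund_smooth [IsManifold (𝓡 n) ∞ M] [IsManifold (𝓡 k) ∞ K]
    (hact : IsSmoothRightAction (k := k) (n := n) act) (ζ : 𝔨) :
    IsSmoothField (k := n) (fund act ζ : M → 𝔼) := fun x => by
  have h1 : SmoothAlong (𝓡 n) ((𝓡 n).prod (𝓡 k)) (fun y : M => (y, (1 : K)))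
      (fun _ => ((0 : 𝔼), ζ)) x :=
    SmoothAlong.prodMk (smoothAlong_zero contMDiffAt_id) (smoothAlong_const _ _ _)
  have h2 := h1.mder (hact.smooth (x, 1))
  refine SmoothAlong.congr h2 (Eventually.of_forall fun y => (hact.one y).symm)
    (Eventually.of_forall fun y => ?_)
  exact (mder_right (hact.mdiff (y, 1)) ζ).symm

variable [LieGroup (𝓡 k) ∞ K]

/-- The orbit maps relate left-invariant fields to fundamental fields. -/
lemma mder_orbit (hact : IsSmoothRightAction (k := k) (n := n) act) (ζ : 𝔨) (x : M) (g : K) :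
    mder (𝓡 k) (𝓡 n) (fun g => act x g) g (linv ζ g) = fund act ζ (act x g) := by
  have h1 := mder_comp (J := 𝓡 k) (g := fun g => act x g) (f := fun h : K => g * h) (x := 1)
    ((hact.contMDiff_right x _).mdifferentiableAt (by simp))
    ((contMDiff_mul_left (I := 𝓡 k) (n := ∞) (a := g) 1).mdifferentiableAt (by simp)) ζ
  simp only [hact.mul, mul_one] at h1
  exact h1.symm

lemma linv_smooth (ζ : 𝔨) : IsSmoothField (k := k) (linv ζ : K → 𝔨) :=
  fund_smooth (act := fun y g : K => y * g)
    ⟨contMDiff_mul (𝓡 k) ∞, mul_one, fun x g h => (mul_assoc x g h).symm⟩ ζ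

end IsSmoothRightAction

variable (K) in
/-- The bracket of the Lie algebra of a Lie group, read in the model space. -/
def lbr (ζ ζ' : 𝔨) : 𝔨 := mbr (𝓡 k) (linv ζ : K → 𝔨) (linv ζ') 1

lemma lbr_zero_right (ζ : 𝔨) : lbr K ζ 0 = 0 := by
  have h : (linv 0 : K → 𝔨) = fun _ => 0 := funext fun _ => map_zero _
  rw [lbr, h, mbr_zero_right]

namespace IsSmoothRightAction

variable [LieGroup (𝓡 k) ∞ K] [IsManifold (𝓡 n) ∞ M]

/-- For a right action, `ζ ↦ ζ̃` is a homomorphism of Lie algebras. -/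
lemma mbr_fund (hact : IsSmoothRightAction (k := k) (n := n) act) (ζ ζ' : 𝔨) (x : M) :
    mbr (𝓡 n) (fund act ζ) (fund act ζ') x = fund act (lbr K ζ ζ') x := by
  have h := mder_mbr_of_related (hact.contMDiff_right x 1) (linv_smooth ζ 1) (linv_smooth ζ' 1)
    (hact.fund_smooth ζ _) (hact.fund_smooth ζ' _)
    (Eventually.of_forall fun g => hact.mder_orbit ζ x g)
    (Eventually.of_forall fun g => hact.mder_orbit ζ' x g)
  rw [hact.one] at h
  exact h.symm

lemma mder_inv_one (ζ : 𝔨) : mder (𝓡 k) (𝓡 k) (fun g : K => g⁻¹) 1 ζ = -ζ := by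
  have hinv : MDifferentiableAt (𝓡 k) (𝓡 k) (fun g : K => g⁻¹) 1 :=
    (contMDiff_inv (𝓡 k) ∞ 1).mdifferentiableAt (by simp)
  have hmul : MDifferentiableAt ((𝓡 k).prod (𝓡 k)) (𝓡 k) (fun a : K × K => a.1 * a.2)
      ((1 : K), (1 : K)⁻¹) := (contMDiff_mul (𝓡 k) ∞ _).mdifferentiableAt (by simp)
  have h1 := mder_comp (g := fun a : K × K => a.1 * a.2) (f := fun g : K => (g, g⁻¹)) hmul
    (mdifferentiableAt_id.prodMk hinv) ζ
  simp only [mul_inv_cancel] at h1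
  rw [mder_const, mder_prodMk (f := fun g : K => g) (g := fun g : K => g⁻¹) mdifferentiableAt_id
    hinv, mder_id] at h1
  have h2 : ((ζ, mder (𝓡 k) (𝓡 k) (fun g : K => g⁻¹) 1 ζ) : 𝔨 × 𝔨) =
      (ζ, 0) + (0, mder (𝓡 k) (𝓡 k) (fun g : K => g⁻¹) 1 ζ) := by simp
  rw [h2, map_add, mder_left hmul, mder_right hmul] at h1
  simp only [inv_one, mul_one, one_mul] at h1
  rw [mder_id, mder_id] at h1
  exact (neg_eq_of_add_eq_zero_right h1.symm).symm

/-- The flow of the fundamental field computes its bracket with `Y`: the derivative at `1` of the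
curve `g ↦ d(A_{g⁻¹})(Y(x g))` of tangent vectors at `x`. -/
lemma mder_pullback (hact : IsSmoothRightAction (k := k) (n := n) act) (ζ : 𝔨) {Y : M → 𝔼}
    (hY : IsSmoothField (k := n) Y) (x : M) :
    ContMDiffAt (𝓡 k) 𝓘(ℝ, 𝔼) ∞
      (fun g => mder (𝓡 n) (𝓡 n) (fun y => act y g⁻¹) (act x g) (Y (act x g))) 1 ∧
    mder (𝓡 k) 𝓘(ℝ, 𝔼)
      (fun g => mder (𝓡 n) (𝓡 n) (fun y => act y g⁻¹) (act x g) (Y (act x g))) 1 ζ =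
      mbr (𝓡 n) (fund act ζ) Y x := by
  let I := (𝓡 n).prod (𝓡 k)
  let A : M × K → M := fun a => act a.1 a.2
  let γ : K → M × K := fun g => (act x g, g⁻¹)
  let V : M → 𝔼 := fund act ζ
  have hV : IsSmoothField (k := n) V := hact.fund_smooth ζ
  have hγ : ContMDiff (𝓡 k) I ∞ γ := (hact.contMDiff_right x).prodMk (contMDiff_inv (𝓡 k) ∞)
  have hγ1 : γ 1 = (x, 1) := by simp [γ, hact.one]
  have hAγ : ∀ g, A (γ g) = x := fun g => by
    change act (act x g) g⁻¹ = x
    rw [← hact.mul, mul_inv_cancel, hact.one]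
  -- the fields `(Y, 0)` and `(0, L_ζ)` on `M × K`
  let Y' : M × K → 𝔼 × 𝔨 := fun a => (Y a.1, 0)
  let L : M × K → 𝔼 × 𝔨 := fun a => (0, linv ζ a.2)
  have hY' : ∀ a, SmoothAlong I I (fun b => b) Y' a := fun a =>
    SmoothAlong.prodMk (SmoothAlong.comp (b := fun y => y) (v := Y) (hY a.1) contMDiffAt_fst)
      (smoothAlong_zero contMDiffAt_snd)
  have hL : ∀ a, SmoothAlong I I (fun b => b) L a := fun a =>
    SmoothAlong.prodMk (smoothAlong_zero contMDiffAt_fst) (SmoothAlong.comp (b := fun y => y)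
      (v := linv ζ) (linv_smooth ζ a.2) contMDiffAt_snd)
  have hc : (fun g => mder (𝓡 n) (𝓡 n) (fun y => act y g⁻¹) (act x g) (Y (act x g))) =
      fun g => mder I (𝓡 n) A (γ g) (Y' (γ g)) :=
    funext fun g => (mder_left (hact.mdiff (γ g)) _).symm
  have hcs : ContMDiffAt (𝓡 k) 𝓘(ℝ, 𝔼) ∞ (fun g => mder I (𝓡 n) A (γ g) (Y' (γ g))) 1 := by
    have h1 : SmoothAlong (𝓡 k) I γ (fun g => Y' (γ g)) 1 :=
      SmoothAlong.comp (b := fun b => b) (v := Y') (hY' (γ 1)) (hγ 1)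
    have h2 := h1.mder (hact.smooth (γ 1))
    exact SmoothAlong.of_const (p := x)
      (h2.congr (Eventually.of_forall fun g => (hAγ g).symm) (Eventually.of_forall fun _ => rfl))
  rw [hc]
  refine ⟨hcs, ?_⟩
  apply mder_extChartAt_injective (I := 𝓡 n) x
  set ψ := extChartAt (𝓡 n) x with hψ
  have hψs : ContMDiffAt (𝓡 n) 𝓘(ℝ, 𝔼) ∞ ψ x := contMDiffAt_extChartAt
  have hψd : ∀ᶠ y in 𝓝 x, MDifferentiableAt (𝓡 n) 𝓘(ℝ, 𝔼) ψ y := by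
    filter_upwards [(contMDiffAt_iff_contMDiffAt_nhds (by simp)).1
      (ContMDiffAt.of_le (m := 1) hψs (by simp))] with y hy
    exact hy.mdifferentiableAt (by simp)
  have hA1 : A (x, 1) = x := hact.one x
  let F : M × K → 𝔼 := fun a => ψ (A a)
  have hF : ContMDiffAt I 𝓘(ℝ, 𝔼) ∞ F (x, 1) :=
    ContMDiffAt.comp (x, (1 : K)) (g := ψ) (f := A) (by rw [hA1]; exact hψs) (hact.smooth _)
  have hAt : Tendsto A (𝓝 (x, 1)) (𝓝 x) := by
    have := (hact.smooth (x, (1 : K))).continuousAt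
    rwa [ContinuousAt, hact.one] at this
  let Φ : M × K → 𝔼 := fun a => mder I 𝓘(ℝ, 𝔼) F a (Y' a)
  have hΦd : MDifferentiableAt I 𝓘(ℝ, 𝔼) Φ (x, 1) :=
    (smoothAlong_vectorSpace ((hY' (x, 1)).mder hF)).mdifferentiableAt (by simp)
  -- the two fields commute
  have hcomm : mbr I Y' L (x, 1) = 0 := by
    have h1 := mder_mbr_of_related (f := fun a : M × K => a.1) (V' := Y) (W' := fun _ => 0)
      contMDiffAt_fst (hY' (x, 1)) (hL (x, 1)) (hY x)
      (smoothAlong_zero contMDiffAt_id) (Eventually.of_forall fun a => mder_fst a _)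
      (Eventually.of_forall fun a => mder_fst a _)
    have h2 := mder_mbr_of_related (f := fun a : M × K => a.2) (V' := fun _ => 0)
      (W' := linv ζ) contMDiffAt_snd (hY' (x, 1)) (hL (x, 1))
      (smoothAlong_zero contMDiffAt_id) (linv_smooth ζ 1)
      (Eventually.of_forall fun a => mder_snd a _) (Eventually.of_forall fun a => mder_snd a _)
    rw [mder_fst, mbr_zero_right] at h1
    rw [mder_snd, mbr_zero_left] at h2
    exact Prod.ext h1 h2
  have hFL : (fun a => mder I 𝓘(ℝ, 𝔼) F a (L a)) =ᶠ[𝓝 (x, 1)]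
      fun a => mder (𝓡 n) 𝓘(ℝ, 𝔼) ψ (A a) (V (A a)) := by
    filter_upwards [hAt.eventually hψd] with a ha
    rw [mder_comp (g := ψ) (f := A) ha (hact.mdiff a), mder_right (hact.mdiff a)]
    exact congrArg _ (hact.mder_orbit ζ a.1 a.2)
  have hψV : MDifferentiableAt (𝓡 n) 𝓘(ℝ, 𝔼) (fun y => mder (𝓡 n) 𝓘(ℝ, 𝔼) ψ y (V y)) x :=
    (smoothAlong_vectorSpace (SmoothAlong.mder (v := V) (hV x) hψs)).mdifferentiableAt (by simp)
  -- derivative of `Φ` in the direction of the group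
  have hΦ2 : mder I 𝓘(ℝ, 𝔼) Φ (x, 1) (0, ζ) =
      mder (𝓡 n) 𝓘(ℝ, 𝔼) (fun y => mder (𝓡 n) 𝓘(ℝ, 𝔼) ψ y (V y)) x (Y x) := by
    have h1 := mder_mbr hF (hY' (x, 1)) (hL (x, 1))
    rw [hcomm, map_zero, eq_comm, sub_eq_zero] at h1
    have h2 : L (x, 1) = (0, ζ) := by simp only [L, linv_one]
    have h3 : mder I (𝓡 n) A (x, 1) (Y' (x, 1)) = Y x := by
      have h4 := mder_left (hact.mdiff (x, (1 : K))) (Y x)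
      simp only [hact.one] at h4
      rw [mder_id] at h4
      exact h4
    rw [h2] at h1
    rw [← h1, mder_congr hFL, mder_comp (g := fun y => mder (𝓡 n) 𝓘(ℝ, 𝔼) ψ y (V y)) (f := A)
      (by rw [hA1]; exact hψV) (hact.mdiff (x, 1)), h3, hA1]
  -- derivative of `Φ` in the direction of `M`
  have hΦ1 : mder I 𝓘(ℝ, 𝔼) Φ (x, 1) (V x, 0) =
      mder (𝓡 n) 𝓘(ℝ, 𝔼) (fun y => mder (𝓡 n) 𝓘(ℝ, 𝔼) ψ y (Y y)) x (V x) := by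
    rw [mder_left hΦd]
    congr 1
    apply mder_congr
    filter_upwards [hψd] with y hy
    have h1 : MDifferentiableAt (𝓡 n) 𝓘(ℝ, 𝔼) ψ (A (y, 1)) := by
      rwa [show A (y, 1) = y from hact.one y]
    change mder I 𝓘(ℝ, 𝔼) F (y, 1) (Y y, 0) = _
    rw [mder_comp (g := ψ) (f := A) h1 (hact.mdiff (y, 1)), mder_left (hact.mdiff (y, 1))]
    simp only [A, hact.one]
    rw [mder_id]
  have hcomp : (fun g => mder (𝓡 n) 𝓘(ℝ, 𝔼) ψ x (mder I (𝓡 n) A (γ g) (Y' (γ g)))) =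
      fun g => Φ (γ g) := funext fun g => by
    have h1 : MDifferentiableAt (𝓡 n) 𝓘(ℝ, 𝔼) ψ (A (γ g)) := by
      rw [hAγ]
      exact hψd.self_of_nhds
    change _ = mder I 𝓘(ℝ, 𝔼) F (γ g) (Y' (γ g))
    rw [mder_comp (g := ψ) (f := A) h1 (hact.mdiff _), hAγ]
  have hder : mder (𝓡 k) 𝓘(ℝ, 𝔼) (fun g => Φ (γ g)) 1 ζ = mder I 𝓘(ℝ, 𝔼) Φ (x, 1) (V x, -ζ) := by
    have hinv : MDifferentiableAt (𝓡 k) (𝓡 k) (fun g : K => g⁻¹) 1 :=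
      (contMDiff_inv (𝓡 k) ∞ 1).mdifferentiableAt (by simp)
    rw [mder_comp (g := Φ) (f := γ) (by rw [hγ1]; exact hΦd)
      ((hγ 1).mdifferentiableAt (by simp)), hγ1, mder_prodMk (f := fun g => act x g)
      (g := fun g : K => g⁻¹) ((hact.contMDiff_right x 1).mdifferentiableAt (by simp)) hinv,
      mder_inv_one]
    rfl
  have hout : mder (𝓡 k) 𝓘(ℝ, 𝔼) (fun g => mder (𝓡 n) 𝓘(ℝ, 𝔼) ψ x
      (mder I (𝓡 n) A (γ g) (Y' (γ g)))) 1 ζ = mder (𝓡 n) 𝓘(ℝ, 𝔼) ψ x (mder (𝓡 k) 𝓘(ℝ, 𝔼)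
        (fun g => mder I (𝓡 n) A (γ g) (Y' (γ g))) 1 ζ) := by
    let T := mder (𝓡 n) 𝓘(ℝ, 𝔼) ψ x
    rw [mder_comp (I := 𝓘(ℝ, 𝔼)) (g := T) (f := fun g => mder I (𝓡 n) A (γ g) (Y' (γ g)))
      T.mdifferentiableAt (hcs.mdifferentiableAt (by simp))]
    exact mder_clm T _ _
  have hsplit : ((V x, -ζ) : 𝔼 × 𝔨) = (V x, 0) - (0, ζ) := by simp
  rw [← hout, hcomp, hder, hsplit, map_sub, hΦ1, hΦ2, mder_mbr hψs (hV x) (hY x)]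

/-- The fundamental fields of an isometric action are Killing: the pull-backs `c Y` and `c Z` of two
fields along the action are curves in the single tangent space at `x`, so that only their
derivatives enter that of `η(Y, Z)`. -/
lemma isKilling_fund (hact : IsSmoothRightAction (k := k) (n := n) act) {η : SmoothMetric n M}
    (hη : ∀ g : K, PreservesMetric η (fun x => act x g)) (ζ : 𝔨) :
    IsKilling (k := n) η (fund act ζ : M → 𝔼) := by
  refine isKilling_iff.2 ⟨hact.fund_smooth ζ, fun Y Z hY hZ x => ?_⟩
  let c : (M → 𝔼) → K → 𝔼 := fun Y g =>
    mder (𝓡 n) (𝓡 n) (fun y => act y g⁻¹) (act x g) (Y (act x g))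
  have hc1 : ∀ Y, c Y 1 = Y x := fun Y => by
    simp only [c, inv_one, hact.one]
    exact mder_id _ _
  have h1 : (fun g => SmoothMetric.form η (act x g) (Y (act x g)) (Z (act x g))) =
      fun g => SmoothMetric.form η x (c Y g) (c Z g) := funext fun g => by
    have h2 := hη g⁻¹ (act x g) (Y (act x g)) (Z (act x g))
    have h3 : act (act x g) g⁻¹ = x := by rw [← hact.mul, mul_inv_cancel, hact.one]
    have h4 : SmoothMetric.form η (act (act x g) g⁻¹) (c Y g) (c Z g) =
      SmoothMetric.form η (act x g) (Y (act x g)) (Z (act x g)) := h2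
    rw [h3] at h4
    exact h4.symm
  obtain ⟨sY, dY⟩ := hact.mder_pullback ζ hY x
  obtain ⟨sZ, dZ⟩ := hact.mder_pullback ζ hZ x
  have h5 := mder_comp (J := 𝓡 k) (g := fun y => SmoothMetric.form η y (Y y) (Z y))
    (f := fun g => act x g) (x := 1) (by
      rw [hact.one]
      exact SmoothMetric.mdiff_form hY hZ x)
    ((hact.contMDiff_right x 1).mdifferentiableAt (by simp)) ζ
  have h6 : mder (𝓡 k) 𝓘(ℝ, ℝ) (fun g => SmoothMetric.form η x (c Y g) (c Z g)) 1 ζ =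
      SmoothMetric.form η x (mder (𝓡 k) 𝓘(ℝ, 𝔼) (c Y) 1 ζ) (Z x) +
        SmoothMetric.form η x (Y x) (mder (𝓡 k) 𝓘(ℝ, 𝔼) (c Z) 1 ζ) := by
    rw [mder_bilinear (SmoothMetric.form η x) (sY.mdifferentiableAt (by simp))
      (sZ.mdifferentiableAt (by simp))]
    exact congrArg₂ _ (congrArg _ (hc1 Z)) (congrArg (fun y => SmoothMetric.form η x y _) (hc1 Y))
  rw [h1, h6, hact.one, dY, dZ] at h5
  exact h5.symm

end IsSmoothRightAction

end Action

/-! ### Lie groups and Lie 2-groups at the identity -/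

section LieHom

variable {k k' : ℕ} {K K' : Type*}
  [TopologicalSpace K] [ChartedSpace (EuclideanSpace ℝ (Fin k)) K] [Group K]
  [LieGroup (𝓡 k) ∞ K]
  [TopologicalSpace K'] [ChartedSpace (EuclideanSpace ℝ (Fin k')) K'] [Group K']
  [LieGroup (𝓡 k') ∞ K']

lemma lieGroup_minSmoothness : LieGroup (𝓡 k) (minSmoothness ℝ 3) K := by
  rw [minSmoothness_of_isRCLikeNormedField]
  exact LieGroup.of_le (n := ∞) (WithTop.coe_le_coe.2 (le_top : (3 : ℕ∞) ≤ ⊤))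

/-- The derivative of a homomorphism of Lie groups is a homomorphism of Lie algebras: the field
`L_{df(ξ)}` is the fundamental field of the action of `K` on `K'` through `f`. -/
lemma mder_lbr {f : K →* K'} (hf : ContMDiff (𝓡 k) (𝓡 k') ∞ f) (ξ ξ' : EuclideanSpace ℝ (Fin k)) :
    mder (𝓡 k) (𝓡 k') f 1 (lbr K ξ ξ') =
      lbr K' (mder (𝓡 k) (𝓡 k') f 1 ξ) (mder (𝓡 k) (𝓡 k') f 1 ξ') := by
  have hact : IsSmoothRightAction (k := k) (n := k') (fun (y : K') (g : K) => y * f g) :=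
    ⟨(contMDiff_mul (𝓡 k') ∞).comp (contMDiff_fst.prodMk (hf.comp contMDiff_snd)),
      fun x => by rw [map_one, mul_one], fun x g h => by rw [map_mul, mul_assoc]⟩
  have hfund : ∀ ζ, (fund (fun (y : K') (g : K) => y * f g) ζ : K' → EuclideanSpace ℝ (Fin k')) =
      linv (mder (𝓡 k) (𝓡 k') f 1 ζ) := fun ζ => funext fun y => by
    have h := mder_comp (J := 𝓡 k) (g := fun h : K' => y * h) (f := f) (x := 1)
      ((contMDiff_mul_left (I := 𝓡 k') (n := ∞) (a := y) _).mdifferentiableAt (by simp))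
      ((hf 1).mdifferentiableAt (by simp)) ζ
    rw [map_one] at h
    exact h
  have h := hact.mbr_fund ξ ξ' 1
  rw [hfund, hfund, hfund, linv_one] at h
  exact h.symm

end LieHom

namespace LieTwoGroup

variable {k₀ k₁ : ℕ} {G₀ G₁ : Type*}
  [TopologicalSpace G₀] [ChartedSpace (EuclideanSpace ℝ (Fin k₀)) G₀] [Group G₀]
  [LieGroup (𝓡 k₀) ∞ G₀]
  [TopologicalSpace G₁] [ChartedSpace (EuclideanSpace ℝ (Fin k₁)) G₁] [Group G₁]
  [LieGroup (𝓡 k₁) ∞ G₁]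
  (G : LieTwoGroup k₀ k₁ G₀ G₁)

local notation "𝔤₀" => EuclideanSpace ℝ (Fin k₀)
local notation "𝔤₁" => EuclideanSpace ℝ (Fin k₁)

lemma s_one : G.s 1 = 1 := G.sHom.map_one
lemma t_one : G.t 1 = 1 := G.tHom.map_one
lemma u_one : G.u 1 = 1 := G.uHom.map_one
lemma i_one : G.i 1 = 1 := (MonoidHom.mk' G.i G.i_mul_hom).map_one
lemma s_one_eq : G.s 1 = G.t 1 := G.s_one.trans G.t_one.symm
lemma pmul_one : G.pmul 1 1 = 1 := by
  have h := G.pmul_u 1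
  rwa [G.s_one, G.u_one] at h

variable {G}

lemma tmul_ker_ds {ξ : 𝔤₁} (h : G.ds 1 ξ = 0) : G.tmul 1 1 ξ 0 = ξ := by
  have h1 := LieGroupoid.tmul_u_right (X := G.toLieGroupoid) 1 ξ
  rwa [h, map_zero, G.s_one, G.u_one] at h1

lemma tmul_ker_dt {ξ : 𝔤₁} (h : G.dt 1 ξ = 0) : G.tmul 1 1 0 ξ = ξ := by
  have h1 := LieGroupoid.tmul_u_left (X := G.toLieGroupoid) 1 ξ
  rwa [h, map_zero, G.t_one, G.u_one] at h1

lemma ds_du_one (ζ : 𝔤₀) : G.ds 1 (G.du 1 ζ) = ζ := by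
  have h := LieGroupoid.ds_du (X := G.toLieGroupoid) 1 ζ
  rwa [G.u_one] at h

lemma dt_du_one (ζ : 𝔤₀) : G.dt 1 (G.du 1 ζ) = ζ := by
  have h := LieGroupoid.dt_du (X := G.toLieGroupoid) 1 ζ
  rwa [G.u_one] at h

lemma tmul_du_one (ζ : 𝔤₀) : G.tmul 1 1 (G.du 1 ζ) (G.du 1 ζ) = G.du 1 ζ := by
  have h := LieGroupoid.tmul_u_left (X := G.toLieGroupoid) 1 (G.du 1 ζ)
  rwa [dt_du_one, G.t_one, G.u_one] at h

lemma dt_di_one (ξ : 𝔤₁) : G.dt 1 (G.di 1 ξ) = G.ds 1 ξ := by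
  have h := LieGroupoid.dt_di (X := G.toLieGroupoid) 1 ξ
  rwa [G.i_one] at h

/-- For `ξ` in the kernel of `ds`, the unit at `dt(ξ)` is the product of `ξ` and `di(ξ)`, and this
product is their sum. -/
lemma du_dt_eq {ξ : 𝔤₁} (h : G.ds 1 ξ = 0) : G.du 1 (G.dt 1 ξ) = ξ + G.di 1 ξ := by
  have h1 := LieGroupoid.tmul_i_right (X := G.toLieGroupoid) 1 ξ
  rw [G.i_one, G.t_one] at h1
  have h2 : G.dt 1 (G.di 1 ξ) = 0 := (dt_di_one ξ).trans h
  have h3 := LieGroupoid.tmul_add (X := G.toLieGroupoid) G.s_one_eq (v := ξ) (w := 0) (v' := 0)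
    (w' := G.di 1 ξ) (by rw [h, map_zero]) (by rw [h2, map_zero])
  rw [add_zero, zero_add, h1, tmul_ker_ds h, tmul_ker_dt h2] at h3
  exact h3

end LieTwoGroup

namespace RightTwoAction

variable {k₀ k₁ n₀ n₁ : ℕ} {G₀ G₁ X₀ X₁ : Type*}
  [TopologicalSpace G₀] [ChartedSpace (EuclideanSpace ℝ (Fin k₀)) G₀] [Group G₀]
  [LieGroup (𝓡 k₀) ∞ G₀]
  [TopologicalSpace G₁] [ChartedSpace (EuclideanSpace ℝ (Fin k₁)) G₁] [Group G₁]
  [LieGroup (𝓡 k₁) ∞ G₁]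
  [TopologicalSpace X₀] [ChartedSpace (EuclideanSpace ℝ (Fin n₀)) X₀] [IsManifold (𝓡 n₀) ∞ X₀]
  [TopologicalSpace X₁] [ChartedSpace (EuclideanSpace ℝ (Fin n₁)) X₁] [IsManifold (𝓡 n₁) ∞ X₁]
  {G : LieTwoGroup k₀ k₁ G₀ G₁} {X : LieGroupoid n₀ n₁ X₀ X₁} (θ : RightTwoAction G X)

local notation "𝔤₀" => EuclideanSpace ℝ (Fin k₀)
local notation "𝔤₁" => EuclideanSpace ℝ (Fin k₁)
local notation "𝔼₁" => EuclideanSpace ℝ (Fin n₁)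
local notation "𝔼₀" => EuclideanSpace ℝ (Fin n₀)

/-! ### Fundamental vector fields of 2-actions -/

lemma isSmooth₁ : IsSmoothRightAction (k := k₁) (n := n₁) θ.act₁ :=
  ⟨θ.smooth₁, θ.act₁_one, θ.act₁_mul⟩

lemma isSmooth₀ : IsSmoothRightAction (k := k₀) (n := n₀) θ.act₀ :=
  ⟨θ.smooth₀, θ.act₀_one, θ.act₀_mul⟩

lemma ds_fund (ξ : 𝔤₁) (p : X₁) :
    X.ds p (fund θ.act₁ ξ p) = fund θ.act₀ (G.ds 1 ξ) (X.s p) := by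
  have h1 := mder_comp (J := 𝓡 k₁) (g := X.s) (f := fun g => θ.act₁ p g) (x := 1)
    (LieGroupoid.mdiff_s _) ((θ.isSmooth₁.contMDiff_right p 1).mdifferentiableAt (by simp)) ξ
  have h2 := mder_comp (J := 𝓡 k₁) (g := fun g => θ.act₀ (X.s p) g) (f := G.s) (x := 1)
    ((θ.isSmooth₀.contMDiff_right (X.s p) _).mdifferentiableAt (by simp))
    (LieGroupoid.mdiff_s (X := G.toLieGroupoid) 1) ξ
  simp only [θ.s_act] at h1
  rw [h2, θ.act₁_one, G.s_one] at h1
  exact h1.symm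

lemma dt_fund (ξ : 𝔤₁) (p : X₁) :
    X.dt p (fund θ.act₁ ξ p) = fund θ.act₀ (G.dt 1 ξ) (X.t p) := by
  have h1 := mder_comp (J := 𝓡 k₁) (g := X.t) (f := fun g => θ.act₁ p g) (x := 1)
    (LieGroupoid.mdiff_t _) ((θ.isSmooth₁.contMDiff_right p 1).mdifferentiableAt (by simp)) ξ
  have h2 := mder_comp (J := 𝓡 k₁) (g := fun g => θ.act₀ (X.t p) g) (f := G.t) (x := 1)
    ((θ.isSmooth₀.contMDiff_right (X.t p) _).mdifferentiableAt (by simp))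
    (LieGroupoid.mdiff_t (X := G.toLieGroupoid) 1) ξ
  simp only [θ.t_act] at h1
  rw [h2, θ.act₁_one, G.t_one] at h1
  exact h1.symm

lemma act₁_u (x : X₀) (g : G₀) : θ.act₁ (X.u x) (G.u g) = X.u (θ.act₀ x g) := by
  have hx : X.s (X.u x) = X.t (X.u x) := (X.s_u x).trans (X.t_u x).symm
  have hg : G.s (G.u g) = G.t (G.u g) := (G.s_u g).trans (G.t_u g).symm
  have h1 := θ.m_act ⟨(X.u x, X.u x), hx⟩ ⟨(G.u g, G.u g), hg⟩
  have ex : X.m ⟨(X.u x, X.u x), hx⟩ = X.u x :=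
    (X.m_congr (h' := X.s_u _) (by rw [X.t_u]) rfl).trans (X.u_m (X.u x))
  have eg : G.m ⟨(G.u g, G.u g), hg⟩ = G.u g :=
    (G.m_congr (h' := G.s_u _) (by rw [G.t_u]) rfl).trans (G.u_m (G.u g))
  rw [ex, eg] at h1
  have hs : X.s (θ.act₁ (X.u x) (G.u g)) = θ.act₀ x g := by rw [θ.s_act, X.s_u, G.s_u]
  refine X.m_left_cancel (h' := hs.trans (X.t_u _).symm) (h1.symm.trans ?_)
  refine (X.m_u _).symm.trans (X.m_congr rfl (by rw [hs]))

lemma act₁_i (p : X₁) (g : G₁) : θ.act₁ (X.i p) (G.i g) = X.i (θ.act₁ p g) := by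
  have h1 := θ.m_act ⟨(p, X.i p), (X.t_i p).symm⟩ ⟨(g, G.i g), (G.t_i g).symm⟩
  rw [X.m_i, G.m_i, θ.act₁_u, ← θ.t_act] at h1
  exact X.m_left_cancel (h1.symm.trans (X.m_i _).symm)

/-- Composable elements of the Lie algebra have multiplicatively related fundamental fields. -/
lemma fund_isMulRelated {ξ χ : 𝔤₁} (h : G.ds 1 ξ = G.dt 1 χ) :
    X.IsMulRelated (fund θ.act₁ ξ) (fund θ.act₁ χ) (fund θ.act₁ (G.tmul 1 1 ξ χ)) := by
  refine ⟨fun p q hpq => by rw [θ.ds_fund, θ.dt_fund, h, hpq], fun p q hpq => ?_⟩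
  obtain ⟨ζ, hξ, hχ, hm⟩ := LieGroupoid.exists_tmul_eq (X := G.toLieGroupoid) G.s_one_eq h
  let e : G.Comp := ⟨(1, 1), G.s_one_eq⟩
  have he : G.m e = 1 := (LieGroupoid.pmul_eq (X := G.toLieGroupoid) G.s_one_eq).symm.trans
    G.pmul_one
  have hf : ContMDiff (𝓡 G.n₂) (𝓡 n₁) ∞ (fun a : G.Comp => θ.act₁ p a.1.1) :=
    (θ.isSmooth₁.contMDiff_right p).comp LieGroupoid.contMDiff_pr₁
  have hg : ContMDiff (𝓡 G.n₂) (𝓡 n₁) ∞ (fun a : G.Comp => θ.act₁ q a.1.2) :=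
    (θ.isSmooth₁.contMDiff_right q).comp LieGroupoid.contMDiff_pr₂
  have hc : ∀ a : G.Comp, X.s (θ.act₁ p a.1.1) = X.t (θ.act₁ q a.1.2) := fun a => by
    rw [θ.s_act, θ.t_act, hpq, a.2]
  have h1 := LieGroupoid.mder_pmul (hf e) (hg e) (Eventually.of_forall hc) ζ
  have h2 : (fun a : G.Comp => X.pmul (θ.act₁ p a.1.1) (θ.act₁ q a.1.2)) =
      fun a => θ.act₁ (X.pmul p q) (G.m a) := funext fun a => by
    rw [LieGroupoid.pmul_eq (hc a), LieGroupoid.pmul_eq hpq, θ.m_act]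
  have d : ∀ r (g : G₁), MDifferentiableAt (𝓡 k₁) (𝓡 n₁) (fun g => θ.act₁ r g) g := fun r g =>
    (θ.isSmooth₁.contMDiff_right r g).mdifferentiableAt (by simp)
  rw [h2, mder_comp (g := fun g => θ.act₁ (X.pmul p q) g) (f := G.m) (d _ _)
    (LieGroupoid.mdiff_m (X := G.toLieGroupoid) e),
    mder_comp (g := fun g => θ.act₁ p g) (f := fun a : G.Comp => a.1.1) (d _ _)
    (LieGroupoid.mdiff_pr₁ (X := G.toLieGroupoid) e),
    mder_comp (g := fun g => θ.act₁ q g) (f := fun a : G.Comp => a.1.2) (d _ _)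
    (LieGroupoid.mdiff_pr₂ (X := G.toLieGroupoid) e), he, θ.act₁_one, θ.act₁_one] at h1
  have h3 : fund θ.act₁ (G.dm e ζ) (X.pmul p q) =
    X.tmul p q (fund θ.act₁ (G.dpr₁ e ζ) p) (fund θ.act₁ (G.dpr₂ e ζ) q) := h1
  rw [hm]
  rw [← hξ, ← hχ]
  exact h3.symm

lemma fund_isMulRelated_right {ξ : 𝔤₁} (h : G.ds 1 ξ = 0) :
    X.IsMulRelated (fund θ.act₁ ξ) (fun _ => 0) (fund θ.act₁ ξ) := by
  have h1 := θ.fund_isMulRelated (ξ := ξ) (χ := 0) (by rw [h, map_zero])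
  rw [LieTwoGroup.tmul_ker_ds h] at h1
  exact h1.congr (fun _ => rfl) fund_zero fun _ => rfl

lemma fund_isMulRelated_left {ξ : 𝔤₁} (h : G.dt 1 ξ = 0) :
    X.IsMulRelated (fun _ => 0) (fund θ.act₁ ξ) (fund θ.act₁ ξ) := by
  have h1 := θ.fund_isMulRelated (ξ := 0) (χ := ξ) (by rw [h, map_zero])
  rw [LieTwoGroup.tmul_ker_dt h] at h1
  exact h1.congr fund_zero (fun _ => rfl) fun _ => rfl

lemma fund_isMulRelated_unit (ζ : 𝔤₀) :
    X.IsMulRelated (fund θ.act₁ (G.du 1 ζ)) (fund θ.act₁ (G.du 1 ζ)) (fund θ.act₁ (G.du 1 ζ)) := by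
  have h1 := θ.fund_isMulRelated (ξ := G.du 1 ζ) (χ := G.du 1 ζ) (by
    rw [LieTwoGroup.ds_du_one, LieTwoGroup.dt_du_one])
  rwa [LieTwoGroup.tmul_du_one] at h1

lemma invField_fund (ξ : 𝔤₁) (p : X₁) :
    X.invField (fund θ.act₁ ξ) p = fund θ.act₁ (G.di 1 ξ) p := by
  have h1 := mder_comp (J := 𝓡 k₁) (g := X.i) (f := fun g => θ.act₁ (X.i p) g) (x := 1)
    (LieGroupoid.mdiff_i _) ((θ.isSmooth₁.contMDiff_right _ 1).mdifferentiableAt (by simp)) ξ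
  have h2 := mder_comp (J := 𝓡 k₁) (g := fun g => θ.act₁ p g) (f := G.i) (x := 1)
    ((θ.isSmooth₁.contMDiff_right p _).mdifferentiableAt (by simp))
    (LieGroupoid.mdiff_i (X := G.toLieGroupoid) 1) ξ
  have e : (fun g => X.i (θ.act₁ (X.i p) g)) = fun g => θ.act₁ p (G.i g) := funext fun g => by
    rw [← θ.act₁_i, X.i_i]
  rw [e, h2, G.i_one, θ.act₁_one] at h1
  exact h1.symm

end RightTwoAction

/-! ### The Lie 2-algebra of a Lie 2-group -/

namespace LieTwoGroup

variable {k₀ k₁ : ℕ} {G₀ G₁ : Type*}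
  [TopologicalSpace G₀] [ChartedSpace (EuclideanSpace ℝ (Fin k₀)) G₀] [Group G₀]
  [LieGroup (𝓡 k₀) ∞ G₀]
  [TopologicalSpace G₁] [ChartedSpace (EuclideanSpace ℝ (Fin k₁)) G₁] [Group G₁]
  [LieGroup (𝓡 k₁) ∞ G₁]
  (G : LieTwoGroup k₀ k₁ G₀ G₁)

local notation "𝔤₀" => EuclideanSpace ℝ (Fin k₀)
local notation "𝔤₁" => EuclideanSpace ℝ (Fin k₁)

/-- A Lie 2-group acts on itself by right multiplication. The fundamental fields are the
left-invariant vector fields. -/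
def selfAction : RightTwoAction G G.toLieGroupoid where
  act₁ p g := p * g
  act₀ x g := x * g
  smooth₁ := contMDiff_mul (𝓡 k₁) ∞
  smooth₀ := contMDiff_mul (𝓡 k₀) ∞
  act₁_one := mul_one
  act₁_mul p g h := (mul_assoc p g h).symm
  act₀_one := mul_one
  act₀_mul p g h := (mul_assoc p g h).symm
  s_act := G.s_mul
  t_act := G.t_mul
  m_act z a := (G.m_mul z a _ rfl).symm

lemma ds_lbr (ξ ξ' : 𝔤₁) : G.ds 1 (lbr G₁ ξ ξ') = lbr G₀ (G.ds 1 ξ) (G.ds 1 ξ') :=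
  mder_lbr (f := G.sHom) G.s_smooth ξ ξ'

lemma dt_lbr (ξ ξ' : 𝔤₁) : G.dt 1 (lbr G₁ ξ ξ') = lbr G₀ (G.dt 1 ξ) (G.dt 1 ξ') :=
  mder_lbr (f := G.tHom) G.t_smooth ξ ξ'

lemma du_lbr (ζ ζ' : 𝔤₀) : G.du 1 (lbr G₀ ζ ζ') = lbr G₁ (G.du 1 ζ) (G.du 1 ζ') :=
  mder_lbr (f := G.uHom) G.u_smooth ζ ζ'

/-- The Peiffer identity holds because left- and right-invariant fields for the groupoid structure
commute. -/
lemma lbr_du_dt {ξ ξ' : 𝔤₁} (h : G.ds 1 ξ = 0) (h' : G.ds 1 ξ' = 0) :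
    lbr G₁ (G.du 1 (G.dt 1 ξ)) ξ' = lbr G₁ ξ ξ' := by
  have h1 := (G.selfAction.fund_isMulRelated_right h').mbr_eq_zero
    (G.selfAction.fund_isMulRelated_left (ξ := G.di 1 ξ) ((dt_di_one ξ).trans h))
    (G.selfAction.isSmooth₁.fund_smooth _) (G.selfAction.isSmooth₁.fund_smooth _) 1
  have h2 : mbr (𝓡 k₁) (linv ξ' : G₁ → 𝔤₁) (linv (G.di 1 ξ)) 1 = 0 := h1
  have h3 : (linv (ξ + G.di 1 ξ) : G₁ → 𝔤₁) = fun g => linv ξ g + linv (G.di 1 ξ) g :=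
    funext fun g => map_add _ _ _
  rw [du_dt_eq h, lbr, h3, mbr_add_left (IsSmoothRightAction.linv_smooth _)
    (IsSmoothRightAction.linv_smooth _), mbr_swap (linv (G.di 1 ξ)), h2, neg_zero, add_zero]
  rfl

/-- The Lie 2-algebra of a Lie 2-group is a crossed module of Lie algebras. -/
theorem lieCrossedModule_isCrossedModule : G.lieCrossedModule.IsCrossedModule := by
  have : LieGroup (𝓡 k₀) (minSmoothness ℝ 3) G₀ := lieGroup_minSmoothness
  have : LieGroup (𝓡 k₁) (minSmoothness ℝ 3) G₁ := lieGroup_minSmoothness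
  have mem : ∀ {ξ : 𝔤₁}, ξ ∈ G.lieCrossedModule.𝔥 ↔ G.ds 1 ξ = 0 := Iff.rfl
  have D_mem : ∀ (ζ : 𝔤₀) {ξ : 𝔤₁}, G.ds 1 ξ = 0 → G.ds 1 (lbr G₁ (G.du 1 ζ) ξ) = 0 :=
    fun ζ ξ h => by rw [ds_lbr, h, lbr_zero_right]
  exact
  { lieG :=
      { zero_mem := trivial
        add_mem := fun _ _ _ _ => trivial
        smul_mem := fun _ _ _ => trivial
        br_mem := fun _ _ _ _ => trivial
        add_br := fun x _ y _ z _ => add_lie x y z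
        br_add := fun x _ y _ z _ => lie_add x y z
        smul_br := fun c x _ y _ => smul_lie c x y
        br_smul := fun c x _ y _ => lie_smul c x y
        br_self := fun x _ => lie_self x
        jacobi := fun x _ y _ z _ => leibniz_lie x y z }
    lieH :=
      { zero_mem := mem.2 (map_zero _)
        add_mem := fun ξ h ξ' h' => mem.2 ((map_add (G.ds 1) _ _).trans (by
          rw [mem.1 h, mem.1 h', add_zero]))
        smul_mem := fun c ξ h => mem.2 ((map_smul (G.ds 1) _ _).trans (by
          rw [mem.1 h, smul_zero]))
        br_mem := fun ξ h ξ' h' => mem.2 ((G.ds_lbr ξ ξ').trans (by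
          rw [mem.1 h', lbr_zero_right]))
        add_br := fun x _ y _ z _ => add_lie x y z
        br_add := fun x _ y _ z _ => lie_add x y z
        smul_br := fun c x _ y _ => smul_lie c x y
        br_smul := fun c x _ y _ => lie_smul c x y
        br_self := fun x _ => lie_self x
        jacobi := fun x _ y _ z _ => leibniz_lie x y z }
    lieHom_δ :=
      { maps_to := fun _ _ => trivial
        map_add := fun _ _ _ _ => map_add (G.dt 1) _ _
        map_smul := fun _ _ _ => map_smul (G.dt 1) _ _
        map_br := fun ξ _ ξ' _ => G.dt_lbr ξ ξ' }
    linear_D := fun ζ _ =>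
      { maps_to := fun ξ h => D_mem ζ h
        map_add := fun x _ y _ => lie_add (G.unitLie ζ) x y
        map_smul := fun c x _ => lie_smul c (G.unitLie ζ) x }
    derivation_D := fun x _ y _ z _ => leibniz_lie (G.unitLie x) y z
    add_D := fun ζ _ ζ' _ ξ _ => by
      have h : G.unitLie (ζ + ζ') = G.unitLie ζ + G.unitLie ζ' := map_add (G.du 1) _ _
      exact (congrArg (fun x => ⁅x, ξ⁆) h).trans (add_lie _ _ _)
    smul_D := fun c ζ _ ξ _ => by
      have h : G.unitLie (c • ζ) = c • G.unitLie ζ := map_smul (G.du 1) _ _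
      exact (congrArg (fun x => ⁅x, ξ⁆) h).trans (smul_lie _ _ _)
    br_D := fun ζ _ ζ' _ ξ _ => by
      have h : G.unitLie ⁅ζ, ζ'⁆ = ⁅G.unitLie ζ, G.unitLie ζ'⁆ := G.du_lbr ζ ζ'
      exact (congrArg (fun x => ⁅x, ξ⁆) h).trans (lie_lie _ _ _)
    δ_D := fun (ζ : 𝔤₀) _ (ξ : 𝔤₁) _ => (G.dt_lbr (G.du 1 ζ) ξ).trans
      (congrArg (fun z : 𝔤₀ => lbr G₀ z (G.dt 1 ξ)) (dt_du_one (G := G) ζ))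
    peiffer := fun ξ h ξ' h' => G.lbr_du_dt h h' }

end LieTwoGroup

/-! ### The infinitesimal action -/

namespace RightTwoAction

variable {k₀ k₁ n₀ n₁ : ℕ} {G₀ G₁ X₀ X₁ : Type*}
  [TopologicalSpace G₀] [ChartedSpace (EuclideanSpace ℝ (Fin k₀)) G₀] [Group G₀]
  [LieGroup (𝓡 k₀) ∞ G₀]
  [TopologicalSpace G₁] [ChartedSpace (EuclideanSpace ℝ (Fin k₁)) G₁] [Group G₁]
  [LieGroup (𝓡 k₁) ∞ G₁]
  [TopologicalSpace X₀] [ChartedSpace (EuclideanSpace ℝ (Fin n₀)) X₀] [IsManifold (𝓡 n₀) ∞ X₀]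
  [TopologicalSpace X₁] [ChartedSpace (EuclideanSpace ℝ (Fin n₁)) X₁] [IsManifold (𝓡 n₁) ∞ X₁]
  {G : LieTwoGroup k₀ k₁ G₀ G₁} {X : LieGroupoid n₀ n₁ X₀ X₁} {θ : RightTwoAction G X}
  {η : SmoothMetric n₀ X₀}

local notation "𝔤₀" => EuclideanSpace ℝ (Fin k₀)
local notation "𝔤₁" => EuclideanSpace ℝ (Fin k₁)
local notation "𝔼₁" => EuclideanSpace ℝ (Fin n₁)
local notation "𝔼₀" => EuclideanSpace ℝ (Fin n₀)

/-- For `ξ ∈ ker(ds)` the fundamental field `ξ̃` on `X₁` is right-invariant. -/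
lemma rightInv_fund {ξ : 𝔤₁} (h : G.ds 1 ξ = 0) :
    X.rightInv (fun x => fund θ.act₁ ξ (X.u x)) = fund θ.act₁ ξ :=
  funext fun p => (θ.fund_isMulRelated_right h).rightInv_eq p

lemma fund_mem_killing_𝔥 (hη : ∀ g, PreservesMetric η (fun x => θ.act₀ x g)) {ξ : 𝔤₁}
    (h : G.ds 1 ξ = 0) :
    (fun x => fund θ.act₁ ξ (X.u x)) ∈ (X.killingCrossedModule η).𝔥 :=
  (θ.fund_isMulRelated_right h).mem_killing_𝔥 (θ.isSmooth₁.fund_smooth ξ) (θ.dt_fund ξ)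
    (θ.isSmooth₀.isKilling_fund hη _)

lemma fund_mem_killing_𝔤 (hη : ∀ g, PreservesMetric η (fun x => θ.act₀ x g)) (ζ : 𝔤₀) :
    (show X.FieldPair from (fund θ.act₁ (G.du 1 ζ), fund θ.act₀ ζ)) ∈
      (X.killingCrossedModule η).𝔤 :=
  LieGroupoid.mem_killing_𝔤.2 ⟨θ.isSmooth₁.fund_smooth _, θ.isSmooth₀.isKilling_fund hη ζ,
    fun p => by rw [θ.ds_fund, LieTwoGroup.ds_du_one],
    fun p => by rw [θ.dt_fund, LieTwoGroup.dt_du_one], θ.fund_isMulRelated_unit ζ⟩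

/-- Differentiating a 2-action by isometries of the base gives a morphism of crossed modules of
Lie algebras. -/
theorem fundamental_isMorphism (hη : ∀ g, PreservesMetric η (fun x => θ.act₀ x g)) :
    G.lieCrossedModule.IsMorphism (X.killingCrossedModule η)
      (fun ξ x => θ.fundamental₁ ξ (X.u x))
      (fun ζ => (θ.fundamental₁ (G.unitLie ζ), θ.fundamental₀ ζ)) where
  source := G.lieCrossedModule_isCrossedModule
  target := LieGroupoid.killing_isCrossedModule
  lieHom₀ :=
    { maps_to := fun ζ _ => fund_mem_killing_𝔤 hη ζ
      map_add := fun (ζ : 𝔤₀) _ (ζ' : 𝔤₀) _ => by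
        have h1 : (fund θ.act₁ (G.du 1 (ζ + ζ')) : X₁ → 𝔼₁) =
            fund θ.act₁ (G.du 1 ζ) + fund θ.act₁ (G.du 1 ζ') := funext fun p => by
          rw [map_add]
          exact fund_add _ _ p
        exact Prod.ext h1 (funext (fund_add ζ ζ'))
      map_smul := fun c (ζ : 𝔤₀) _ => by
        have h1 : (fund θ.act₁ (G.du 1 (c • ζ)) : X₁ → 𝔼₁) =
            c • fund θ.act₁ (G.du 1 ζ) := funext fun p => by
          rw [map_smul]
          exact fund_smul _ _ p
        exact Prod.ext h1 (funext (fund_smul c ζ))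
      map_br := fun (ζ : 𝔤₀) _ (ζ' : 𝔤₀) _ => by
        have h1 : (fund θ.act₁ (G.du 1 (lbr G₀ ζ ζ')) : X₁ → 𝔼₁) =
            mbr (𝓡 n₁) (fund θ.act₁ (G.du 1 ζ)) (fund θ.act₁ (G.du 1 ζ')) := funext fun p => by
          rw [θ.isSmooth₁.mbr_fund, G.du_lbr]
        exact Prod.ext h1 (funext fun x => (θ.isSmooth₀.mbr_fund ζ ζ' x).symm) }
  lieHom₁ :=
    { maps_to := fun ξ h => fund_mem_killing_𝔥 hη h
      map_add := fun (ξ : 𝔤₁) _ (ξ' : 𝔤₁) _ => funext fun x => fund_add ξ ξ' (X.u x)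
      map_smul := fun c (ξ : 𝔤₁) _ => funext fun x => fund_smul c ξ (X.u x)
      map_br := fun (ξ : 𝔤₁) h (ξ' : 𝔤₁) h' => by
        have h1 : (fun x => fund θ.act₁ (lbr G₁ ξ ξ') (X.u x) : X₀ → 𝔼₁) =
            X.secBr (fun x => fund θ.act₁ ξ (X.u x)) (fun x => fund θ.act₁ ξ' (X.u x)) :=
          funext fun x => by
            rw [LieGroupoid.secBr, rightInv_fund h, rightInv_fund h', θ.isSmooth₁.mbr_fund]
        exact h1 }
  map_δ := fun (ξ : 𝔤₁) h => by
    have h1 : (fund θ.act₁ (G.du 1 (G.dt 1 ξ)) : X₁ → 𝔼₁) =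
        X.rightInv (fun x => fund θ.act₁ ξ (X.u x)) -
          X.leftInv (fun x => fund θ.act₁ ξ (X.u x)) := funext fun p => by
      rw [Pi.sub_apply, LieGroupoid.leftInv_eq (fund_mem_killing_𝔥 hη h).1.2, rightInv_fund h,
        θ.invField_fund, LieTwoGroup.du_dt_eq h, fund_add, sub_neg_eq_add]
    have h2 : (fund θ.act₀ (G.dt 1 ξ) : X₀ → 𝔼₀) =
        X.rho (fun x => fund θ.act₁ ξ (X.u x)) := funext fun x => by
      have h3 := θ.dt_fund ξ (X.u x)
      rw [X.t_u] at h3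
      exact h3.symm
    exact Prod.ext h1 h2
  map_D := fun (ζ : 𝔤₀) _ (ξ : 𝔤₁) h => by
    have h1 : (fun x => fund θ.act₁ (lbr G₁ (G.du 1 ζ) ξ) (X.u x) : X₀ → 𝔼₁) =
        X.secDer (fund θ.act₁ (G.du 1 ζ)) (fun x => fund θ.act₁ ξ (X.u x)) := funext fun x => by
      rw [LieGroupoid.secDer, rightInv_fund h, θ.isSmooth₁.mbr_fund]
    exact h1

end RightTwoAction

/-! ### Isometries and push-forward metrics -/

section Descent

variable {k n : ℕ} {M N : Type*}
  [TopologicalSpace M] [ChartedSpace (EuclideanSpace ℝ (Fin k)) M] [IsManifold (𝓡 k) ∞ M]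
  [TopologicalSpace N] [ChartedSpace (EuclideanSpace ℝ (Fin n)) N] [IsManifold (𝓡 n) ∞ N]

/-- Orthogonal projection: a vector can be corrected by an element of the kernel of `L` so as to
become orthogonal to it. -/
lemma exists_sub_ker_orthogonal {E E' : Type*} [NormedAddCommGroup E] [NormedSpace ℝ E]
    [FiniteDimensional ℝ E] [NormedAddCommGroup E'] [NormedSpace ℝ E'] (B : E →L[ℝ] E →L[ℝ] ℝ)
    (hB : ∀ v, v ≠ 0 → 0 < B v v) (L : E →L[ℝ] E') (v : E) :
    ∃ v', L v' = L v ∧ ∀ w, L w = 0 → B v' w = 0 := by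
  let K : Submodule ℝ E := LinearMap.ker L.toLinearMap
  let T : K →ₗ[ℝ] Module.Dual ℝ K :=
    { toFun := fun a => (B a).toLinearMap.comp K.subtype
      map_add' := fun a b => by ext c; simp
      map_smul' := fun r a => by ext c; simp }
  have hT : Function.Injective T := by
    refine (injective_iff_map_eq_zero T).2 fun a ha => ?_
    by_contra h
    have h1 : T a a = 0 := by rw [ha]; rfl
    exact (hB a fun h0 => h (Subtype.ext h0)).ne' h1
  obtain ⟨a, ha⟩ := (LinearMap.injective_iff_surjective_of_finrank_eq_finrank
    (Subspace.dual_finrank_eq (K := ℝ) (V := K)).symm).1 hT ((B v).toLinearMap.comp K.subtype)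
  refine ⟨v - a, ?_, fun w hw => ?_⟩
  · rw [map_sub, show L a = 0 from a.2, sub_zero]
  · have h1 : B a w = B v w := congrArg (fun T : Module.Dual ℝ K => T ⟨w, hw⟩) ha
    rw [map_sub, sub_apply, h1, sub_self]

/-- A metric pushed forward along `f` is preserved by every diffeomorphism `φ` of the base that is
covered by an isometric diffeomorphism `F`: such an `F` maps horizontal vectors to horizontal
vectors. A smooth section of `f` provides the horizontal lifts. -/
lemma PreservesMetric.of_isPushforward {η : SmoothMetric k M} {ηN : SmoothMetric n N} {f : M → N}
    (hpush : IsPushforward η f ηN) (sf : ContMDiff (𝓡 k) (𝓡 n) ∞ f) {S : N → M}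
    (sS : ContMDiff (𝓡 n) (𝓡 k) ∞ S) (hS : ∀ y, f (S y) = y)
    {F F' : M → M} (sF : ContMDiff (𝓡 k) (𝓡 k) ∞ F) (sF' : ContMDiff (𝓡 k) (𝓡 k) ∞ F')
    (hF : PreservesMetric η F) (hF'F : ∀ x, F' (F x) = x) (hFF' : ∀ x, F (F' x) = x)
    {φ φ' : N → N} (sφ : ContMDiff (𝓡 n) (𝓡 n) ∞ φ) (sφ' : ContMDiff (𝓡 n) (𝓡 n) ∞ φ')
    (hφ : ∀ x, f (F x) = φ (f x)) (hφ' : ∀ x, f (F' x) = φ' (f x)) :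
    PreservesMetric ηN φ := by
  -- horizontal lifts exist
  have lift : ∀ y (v : EuclideanSpace ℝ (Fin n)), ∃ v' : EuclideanSpace ℝ (Fin k),
      mder (𝓡 k) (𝓡 n) f (S y) v' = v ∧ IsHorizontal (n := n) η f (S y) v' := fun y v => by
    obtain ⟨v', h1, h2⟩ := exists_sub_ker_orthogonal (SmoothMetric.form η (S y))
      (fun v hv => η.pos (S y) v hv) (mder (𝓡 k) (𝓡 n) f (S y)) (mder (𝓡 n) (𝓡 k) S y v)
    refine ⟨v', h1.trans ?_, h2⟩
    rw [← mder_comp ((sf _).mdifferentiableAt (by simp)) ((sS _).mdifferentiableAt (by simp))]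
    simp only [hS]
    exact mder_id _ _
  -- `F` preserves horizontality, as its inverse preserves the vertical vectors
  have hor : ∀ x (v : EuclideanSpace ℝ (Fin k)), IsHorizontal (n := n) η f x v →
      IsHorizontal (n := n) η f (F x) (mder (𝓡 k) (𝓡 k) F x v) :=
    fun x v hv (w : EuclideanSpace ℝ (Fin k)) hw => by
      have hw0 : mder (𝓡 k) (𝓡 n) f (F x) w = 0 := hw
      let w' : EuclideanSpace ℝ (Fin k) := mder (𝓡 k) (𝓡 k) F' (F x) w
      have h1 : mder (𝓡 k) (𝓡 k) F x w' = w := by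
        have h := mder_comp (g := F) (f := F') (x := F x) ((sF _).mdifferentiableAt (by simp))
          ((sF' _).mdifferentiableAt (by simp)) w
        simp only [hFF', hF'F] at h
        rw [mder_id] at h
        exact h.symm
      have h2 : mder (𝓡 k) (𝓡 n) f x w' = 0 := by
        have h := mder_comp (g := f) (f := F') (x := F x) ((sf _).mdifferentiableAt (by simp))
          ((sF' _).mdifferentiableAt (by simp)) w
        simp only [hφ'] at h
        rw [mder_comp (g := φ') (f := f) ((sφ' _).mdifferentiableAt (by simp))
          ((sf _).mdifferentiableAt (by simp)), hw0, map_zero, hF'F] at h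
        exact h.symm
      have h3 : SmoothMetric.form η (F x) (mder (𝓡 k) (𝓡 k) F x v) (mder (𝓡 k) (𝓡 k) F x w') =
        SmoothMetric.form η x v w' := hF x v w'
      rw [h1] at h3
      exact h3.trans (hv w' h2)
  intro y (v : EuclideanSpace ℝ (Fin n)) (w : EuclideanSpace ℝ (Fin n))
  change SmoothMetric.form ηN (φ y) (mder (𝓡 n) (𝓡 n) φ y v) (mder (𝓡 n) (𝓡 n) φ y w) =
    SmoothMetric.form ηN y v w
  obtain ⟨v', hv, hv'⟩ := lift y v
  obtain ⟨w', hw, hw'⟩ := lift y w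
  have key : ∀ v', mder (𝓡 k) (𝓡 n) f (F (S y)) (mder (𝓡 k) (𝓡 k) F (S y) v') =
      mder (𝓡 n) (𝓡 n) φ y (mder (𝓡 k) (𝓡 n) f (S y) v') := fun v' => by
    rw [← mder_comp (g := f) (f := F) ((sf _).mdifferentiableAt (by simp))
      ((sF _).mdifferentiableAt (by simp))]
    simp only [hφ]
    rw [mder_comp (g := φ) (f := f) ((sφ _).mdifferentiableAt (by simp))
      ((sf _).mdifferentiableAt (by simp)), hS]
  have h1 : SmoothMetric.form ηN (f (F (S y)))
      (mder (𝓡 k) (𝓡 n) f (F (S y)) (mder (𝓡 k) (𝓡 k) F (S y) v'))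
      (mder (𝓡 k) (𝓡 n) f (F (S y)) (mder (𝓡 k) (𝓡 k) F (S y) w')) =
      SmoothMetric.form η (F (S y)) (mder (𝓡 k) (𝓡 k) F (S y) v')
        (mder (𝓡 k) (𝓡 k) F (S y) w') := hpush _ _ _ (hor _ _ hv') (hor _ _ hw')
  have h2 : SmoothMetric.form ηN (f (S y)) (mder (𝓡 k) (𝓡 n) f (S y) v')
      (mder (𝓡 k) (𝓡 n) f (S y) w') = SmoothMetric.form η (S y) v' w' := hpush _ _ _ hv' hw'
  have h3 : SmoothMetric.form η (F (S y)) (mder (𝓡 k) (𝓡 k) F (S y) v')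
      (mder (𝓡 k) (𝓡 k) F (S y) w') = SmoothMetric.form η (S y) v' w' := hF _ _ _
  rw [key, key, hv, hw, hφ, hS, h3] at h1
  rw [hv, hw, hS] at h2
  exact h1.trans h2.symm

end Descent

/-! ### Morphisms into opposite crossed modules -/

namespace CrossedModule.Hom

/-- Inversion turns a morphism into the opposite of a crossed module into a morphism into the
crossed module itself. -/
def compInv {G H G' H' : Type*} [Group G] [Group H] [Group G'] [Group H']
    {C : CrossedModule G H} {C' : CrossedModule G' H'} (F : Hom C C'.op) : Hom C C' where
  onG := MonoidHom.mk' (fun g => (F.onG g⁻¹).unop) fun g g' => by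
    rw [mul_inv_rev, map_mul, MulOpposite.unop_mul]
  onH := MonoidHom.mk' (fun h => (F.onH h⁻¹).unop) fun h h' => by
    rw [mul_inv_rev, map_mul, MulOpposite.unop_mul]
  comm h := by
    change (F.onG (C.map h)⁻¹).unop = C'.map (F.onH h⁻¹).unop
    rw [← map_inv, F.comm]
    rfl
  equivariant g h := by
    change (F.onH (C.action g h)⁻¹).unop = C'.action (F.onG g⁻¹).unop (F.onH h⁻¹).unop
    rw [← map_inv, F.equivariant, map_inv F.onG]
    rfl

end CrossedModule.Hom

namespace RightTwoAction

variable {k₀ k₁ n₀ n₁ : ℕ} {G₀ G₁ X₀ X₁ : Type*}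
  [TopologicalSpace G₀] [ChartedSpace (EuclideanSpace ℝ (Fin k₀)) G₀] [Group G₀]
  [LieGroup (𝓡 k₀) ∞ G₀]
  [TopologicalSpace G₁] [ChartedSpace (EuclideanSpace ℝ (Fin k₁)) G₁] [Group G₁]
  [LieGroup (𝓡 k₁) ∞ G₁]
  [TopologicalSpace X₀] [ChartedSpace (EuclideanSpace ℝ (Fin n₀)) X₀] [IsManifold (𝓡 n₀) ∞ X₀]
  [TopologicalSpace X₁] [ChartedSpace (EuclideanSpace ℝ (Fin n₁)) X₁] [IsManifold (𝓡 n₁) ∞ X₁]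
  {G : LieTwoGroup k₀ k₁ G₀ G₁} {X : LieGroupoid n₀ n₁ X₀ X₁} {θ : RightTwoAction G X}

/-! ### Strong isometries of a 2-action -/

lemma act₁_u_mul (p : X₁) (g g' : G₀) :
    θ.act₁ p (G.u (g * g')) = θ.act₁ (θ.act₁ p (G.u g)) (G.u g') := by
  rw [G.u_mul, θ.act₁_mul]

lemma act₁_u_cancel (p : X₁) {g g' : G₀} (h : g * g' = 1) :
    θ.act₁ (θ.act₁ p (G.u g)) (G.u g') = p := by
  rw [← act₁_u_mul, h, G.u_one, θ.act₁_one]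

lemma act₀_cancel (x : X₀) {g g' : G₀} (h : g * g' = 1) : θ.act₀ (θ.act₀ x g) g' = x := by
  rw [← θ.act₀_mul, h, θ.act₀_one]

lemma m_unit (g : G₀) (h : G.s (G.u g) = G.t (G.u g)) : G.m ⟨(G.u g, G.u g), h⟩ = G.u g :=
  (G.m_congr (h' := G.s_u _) (by rw [G.t_u]) rfl).trans (G.u_m _)

/-- An isometric 2-action is by isometries of the metric on objects: the isometry of `X₂` induced by
the pair `(1_g, 1_g)` covers `p ↦ p 1_g` along `m`, which in turn covers `x ↦ x g` along `s`. -/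
theorem IsIsometric.preservesMetric_act₀ {η : X.GroupoidMetric} (hθ : θ.IsIsometric η) (g : G₀) :
    PreservesMetric η.η₀ (fun x => θ.act₀ x g) := by
  have hu : ∀ g : G₀, G.s (G.u g) = G.t (G.u g) := fun g => (G.s_u g).trans (G.t_u g).symm
  let F : G₀ → X.Comp → X.Comp := fun g z => θ.act₂ z ⟨(G.u g, G.u g), hu g⟩
  have into : ∀ {k : ℕ} {N : Type _} [TopologicalSpace N]
      [ChartedSpace (EuclideanSpace ℝ (Fin k)) N] {f : N → X.Comp},
      ContMDiff (𝓡 k) ((𝓡 n₁).prod (𝓡 n₁)) ∞ (fun y => (f y).1) → Continuous f →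
      ContMDiff (𝓡 k) (𝓡 X.n₂) ∞ f := fun hf hc => by
    rw [ContMDiff.iff_comp_isImmersion X.embedding₂.isImmersion]
    exact ⟨hc, hf⟩
  have sF : ∀ g, ContMDiff (𝓡 X.n₂) (𝓡 X.n₂) ∞ (F g) := fun g => by
    have h : ContMDiff (𝓡 X.n₂) ((𝓡 n₁).prod (𝓡 n₁)) ∞ (fun z => (F g z).1) :=
      ((θ.isSmooth₁.contMDiff_left _).comp LieGroupoid.contMDiff_pr₁).prodMk
        ((θ.isSmooth₁.contMDiff_left _).comp LieGroupoid.contMDiff_pr₂)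
    exact into h (h.continuous.subtype_mk _)
  have hF : ∀ g g', g * g' = 1 → ∀ z, F g' (F g z) = z := fun g g' h z =>
    Subtype.ext (Prod.ext (act₁_u_cancel _ h) (act₁_u_cancel _ h))
  have hm : ∀ g z, X.m (F g z) = θ.act₁ (X.m z) (G.u g) := fun g z =>
    (θ.m_act z ⟨(G.u g, G.u g), hu g⟩).symm.trans (by rw [m_unit])
  have h₁ : ∀ g, PreservesMetric η.η₁ (fun p => θ.act₁ p (G.u g)) := fun g => by
    let S : X₁ → X.Comp := fun p => ⟨(p, X.u (X.s p)), (X.t_u _).symm⟩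
    have hS : ContMDiff (𝓡 n₁) ((𝓡 n₁).prod (𝓡 n₁)) ∞ (fun p => (S p).1) :=
      contMDiff_id.prodMk (X.u_smooth.comp X.s_smooth)
    exact PreservesMetric.of_isPushforward η.pushforward_m X.m_smooth (S := S)
      (into hS (hS.continuous.subtype_mk _)) X.m_u (sF g) (sF g⁻¹) (hθ _)
      (hF _ _ (mul_inv_cancel g)) (hF _ _ (inv_mul_cancel g)) (θ.isSmooth₁.contMDiff_left _)
      (θ.isSmooth₁.contMDiff_left _) (hm g) (hm g⁻¹)
  have hs : ∀ g p, X.s (θ.act₁ p (G.u g)) = θ.act₀ (X.s p) g := fun g p => by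
    rw [θ.s_act, G.s_u]
  exact PreservesMetric.of_isPushforward η.pushforward_s X.s_smooth X.u_smooth X.s_u
    (θ.isSmooth₁.contMDiff_left _) (θ.isSmooth₁.contMDiff_left (G.u g⁻¹)) (h₁ g)
    (fun p => act₁_u_cancel p (mul_inv_cancel g)) (fun p => act₁_u_cancel p (inv_mul_cancel g))
    (θ.isSmooth₀.contMDiff_left _)
    (θ.isSmooth₀.contMDiff_left _) (hs g) (hs g⁻¹)

variable (θ)

/-- The diffeomorphism `x ↦ x g` of the objects. -/
def objectDiffeo (g : G₀) : X₀ ≃ₘ^∞⟮𝓡 n₀, 𝓡 n₀⟯ X₀ where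
  toFun x := θ.act₀ x g
  invFun x := θ.act₀ x g⁻¹
  left_inv x := act₀_cancel x (mul_inv_cancel g)
  right_inv x := act₀_cancel x (inv_mul_cancel g)
  contMDiff_toFun := θ.isSmooth₀.contMDiff_left g
  contMDiff_invFun := θ.isSmooth₀.contMDiff_left g⁻¹

/-- The automorphism `Σ_g(p) = p 1_g`. -/
def unitAut (g : G₀) : X.Aut where
  arrows :=
    { toFun := fun p => θ.act₁ p (G.u g)
      invFun := fun p => θ.act₁ p (G.u g⁻¹)
      left_inv := fun p => act₁_u_cancel p (mul_inv_cancel g)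
      right_inv := fun p => act₁_u_cancel p (inv_mul_cancel g)
      contMDiff_toFun := θ.isSmooth₁.contMDiff_left _
      contMDiff_invFun := θ.isSmooth₁.contMDiff_left _ }
  objects := θ.objectDiffeo g
  s_arrows p := (θ.s_act p _).trans (by rw [G.s_u]; rfl)
  t_arrows p := (θ.t_act p _).trans (by rw [G.t_u]; rfl)
  m_arrows z := (congrArg (θ.act₁ (X.m z)) (m_unit g ((G.s_u g).trans (G.t_u g).symm)).symm).trans
    (θ.m_act z _)

/-- The bisection `σ_h(x) = 1_x h`. -/
def kerBisection (h : G.H) : X.Bisection where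
  toFun x := θ.act₁ (X.u x) h
  smooth := (θ.isSmooth₁.contMDiff_left _).comp X.u_smooth
  base := θ.objectDiffeo (G.t h)
  s_toFun x := by rw [θ.s_act, X.s_u, show G.s h = 1 from h.2, θ.act₀_one]
  t_toFun x := by rw [θ.t_act, X.t_u]; rfl

/-- Elements `h` of `ker(s)` act by left multiplication: `p h = σ_h(t p) * p`. -/
lemma act₁_ker (p : X₁) (h : G.H) :
    θ.act₁ p h = X.m ⟨((θ.kerBisection h).toFun (X.t p), p), (θ.kerBisection h).s_toFun _⟩ := by
  have hs : G.s (h : G₁) = G.t 1 := (show G.s (h : G₁) = 1 from h.2).trans G.t_one.symm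
  have h1 := θ.m_act ⟨(X.u (X.t p), p), X.s_u _⟩ ⟨((h : G₁), 1), hs⟩
  have h2 : G.m ⟨((h : G₁), 1), hs⟩ = h := by
    have h3 : G.u (G.s (h : G₁)) = 1 := by rw [show G.s (h : G₁) = 1 from h.2, G.u_one]
    exact (G.m_congr (h' := (G.t_u _).symm) rfl h3.symm).trans (G.m_u h)
  rw [X.u_m, h2] at h1
  exact h1.trans (X.m_congr rfl (θ.act₁_one p))

/-- `I_{σ_h} = Σ_{t(h)}`: the product `(p 1_{t(h)}) * σ_h(s p)` is `p h = σ_h(t p) * p`. -/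
lemma innerAut_kerBisection (h : G.H) :
    LieGroupoid.innerAut (θ.kerBisection h) = θ.unitAut (G.t h) := by
  refine LieGroupoid.Aut.ext fun p => Eq.symm ?_
  have hs : X.s (θ.act₁ p (G.u (G.t h))) = X.t ((θ.kerBisection h).toFun (X.s p)) := by
    rw [θ.s_act, G.s_u, (θ.kerBisection h).t_toFun]; rfl
  refine LieGroupoid.innerFun_unique (θ.kerBisection h) p (θ.act₁ p (G.u (G.t h))) hs ?_
  rw [← act₁_ker]
  have h1 := θ.m_act ⟨(p, X.u (X.s p)), (X.t_u _).symm⟩ ⟨(G.u (G.t h), (h : G₁)), G.s_u _⟩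
  rw [X.m_u, G.u_m] at h1
  exact h1.symm

lemma isSmoothPair : IsSmoothPair (G := G) θ.unitAut θ.kerBisection :=
  ⟨θ.smooth₁.comp (contMDiff_snd.prodMk (G.u_smooth.comp contMDiff_fst)),
    θ.smooth₀.comp (contMDiff_snd.prodMk contMDiff_fst),
    fun _ _ hc => θ.smooth₁.comp
      ((X.u_smooth.comp contMDiff_snd).prodMk (hc.comp contMDiff_fst))⟩

end RightTwoAction

/-- Smooth pairs are stable under composition with the inversions of `G₀` and `H`. -/
lemma IsSmoothPair.comp_inv {k₀ k₁ n₀ n₁ : ℕ} {G₀ G₁ X₀ X₁ : Type*}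
    [TopologicalSpace G₀] [ChartedSpace (EuclideanSpace ℝ (Fin k₀)) G₀] [Group G₀]
    [LieGroup (𝓡 k₀) ∞ G₀]
    [TopologicalSpace G₁] [ChartedSpace (EuclideanSpace ℝ (Fin k₁)) G₁] [Group G₁]
    [LieGroup (𝓡 k₁) ∞ G₁]
    [TopologicalSpace X₀] [ChartedSpace (EuclideanSpace ℝ (Fin n₀)) X₀] [IsManifold (𝓡 n₀) ∞ X₀]
    [TopologicalSpace X₁] [ChartedSpace (EuclideanSpace ℝ (Fin n₁)) X₁] [IsManifold (𝓡 n₁) ∞ X₁]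
    {G : LieTwoGroup k₀ k₁ G₀ G₁} {X : LieGroupoid n₀ n₁ X₀ X₁}
    {S : G₀ → X.Aut} {σ : G.H → X.Bisection} (h : IsSmoothPair S σ) :
    IsSmoothPair (fun g => S g⁻¹) (fun h => σ h⁻¹) :=
  ⟨h.1.comp (((contMDiff_inv (𝓡 k₀) ∞).comp contMDiff_fst).prodMk contMDiff_snd),
    h.2.1.comp (((contMDiff_inv (𝓡 k₀) ∞).comp contMDiff_fst).prodMk contMDiff_snd),
    fun j c hc => h.2.2 j (fun e => (c e)⁻¹) ((contMDiff_inv (𝓡 k₁) ∞).comp hc)⟩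

namespace RightTwoAction

variable {k₀ k₁ n₀ n₁ : ℕ} {G₀ G₁ X₀ X₁ : Type*}
  [TopologicalSpace G₀] [ChartedSpace (EuclideanSpace ℝ (Fin k₀)) G₀] [Group G₀]
  [LieGroup (𝓡 k₀) ∞ G₀]
  [TopologicalSpace G₁] [ChartedSpace (EuclideanSpace ℝ (Fin k₁)) G₁] [Group G₁]
  [LieGroup (𝓡 k₁) ∞ G₁]
  [TopologicalSpace X₀] [ChartedSpace (EuclideanSpace ℝ (Fin n₀)) X₀] [IsManifold (𝓡 n₀) ∞ X₀]
  [TopologicalSpace X₁] [ChartedSpace (EuclideanSpace ℝ (Fin n₁)) X₁] [IsManifold (𝓡 n₁) ∞ X₁]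
  {G : LieTwoGroup k₀ k₁ G₀ G₁} {X : LieGroupoid n₀ n₁ X₀ X₁} (θ : RightTwoAction G X)
  {η : SmoothMetric n₀ X₀}

/-- The morphism of crossed modules `g ↦ Σ_g`, `h ↦ σ_h` of a 2-action by isometries of the base. -/
def isoHom (hη : ∀ g, PreservesMetric η (fun x => θ.act₀ x g)) :
    CrossedModule.Hom G.crossedModule (X.isoCrossedModule η).op where
  onG := MonoidHom.mk' (fun g => MulOpposite.op ⟨θ.unitAut g, hη g⟩) fun g g' =>
    congrArg MulOpposite.op (Subtype.ext (LieGroupoid.Aut.ext fun p => act₁_u_mul p g g'))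
  onH := MonoidHom.mk' (fun h => MulOpposite.op ⟨θ.kerBisection h,
      LieGroupoid.mem_isometricBis.2 (hη (G.t h))⟩) fun h h' =>
    congrArg MulOpposite.op (Subtype.ext (LieGroupoid.Bisection.ext fun x =>
      (θ.act₁_mul (X.u x) h h').trans (θ.act₁_ker _ h')))
  comm h := congrArg MulOpposite.op (Subtype.ext (θ.innerAut_kerBisection h).symm)
  equivariant g h := by
    refine congrArg MulOpposite.op (Subtype.ext (LieGroupoid.Bisection.ext fun x => ?_))
    change θ.act₁ (X.u x) (G.u g * h * (G.u g)⁻¹) =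
      θ.act₁ (θ.act₁ (X.u (θ.act₀ x g)) h) (G.u g⁻¹)
    rw [θ.act₁_mul, θ.act₁_mul, θ.act₁_u, show (G.u g)⁻¹ = G.u g⁻¹ from (map_inv G.uHom g).symm]

end RightTwoAction

end

theorem mainTheorem4 {k₀ k₁ n₀ n₁ : ℕ} {G₀ G₁ X₀ X₁ : Type*}
    [TopologicalSpace G₀] [ChartedSpace (EuclideanSpace ℝ (Fin k₀)) G₀] [Group G₀]
    [LieGroup (𝓡 k₀) ∞ G₀] [T2Space G₀] [SecondCountableTopology G₀]
    [TopologicalSpace G₁] [ChartedSpace (EuclideanSpace ℝ (Fin k₁)) G₁] [Group G₁]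
    [LieGroup (𝓡 k₁) ∞ G₁] [T2Space G₁] [SecondCountableTopology G₁]
    [TopologicalSpace X₀] [ChartedSpace (EuclideanSpace ℝ (Fin n₀)) X₀] [IsManifold (𝓡 n₀) ∞ X₀]
    [T2Space X₀] [SecondCountableTopology X₀]
    [TopologicalSpace X₁] [ChartedSpace (EuclideanSpace ℝ (Fin n₁)) X₁] [IsManifold (𝓡 n₁) ∞ X₁]
    [T2Space X₁] [SecondCountableTopology X₁]
    (G : LieTwoGroup k₀ k₁ G₀ G₁) (X : LieGroupoid n₀ n₁ X₀ X₁) (η : X.GroupoidMetric)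
    (θ : RightTwoAction G X) (hθ : θ.IsIsometric η) :
    (∃ F : CrossedModule.Hom G.crossedModule (X.isoCrossedModule η.η₀).op,
      (∀ (h : G.H) (x : X₀), (F.onH h).unop.1.toFun x = θ.act₁ (X.u x) h) ∧
      (∀ (g : G₀) (p : X₁), (F.onG g).unop.1.arrows p = θ.act₁ p (G.u g)) ∧
      IsSmoothPair (fun g => (F.onG g).unop.1) (fun h : G.H => (F.onH h).unop.1)) ∧
    (∃ F : CrossedModule.Hom G.crossedModule (X.isoCrossedModule η.η₀),
      (∀ (h : G.H) (x : X₀), (F.onH h).1.toFun x = θ.act₁ (X.u x) (h : G₁)⁻¹) ∧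
      (∀ (g : G₀) (p : X₁), (F.onG g).1.arrows p = θ.act₁ p (G.u g⁻¹)) ∧
      IsSmoothPair (fun g => (F.onG g).1) (fun h : G.H => (F.onH h).1)) ∧
    G.lieCrossedModule.IsMorphism (X.killingCrossedModule η.η₀)
      (fun ξ x => θ.fundamental₁ ξ (X.u x))
      (fun ζ => (θ.fundamental₁ (G.unitLie ζ), θ.fundamental₀ ζ)) := by
  have hη := hθ.preservesMetric_act₀
  exact ⟨⟨θ.isoHom hη, fun _ _ => rfl, fun _ _ => rfl, θ.isSmoothPair⟩,
    ⟨(θ.isoHom hη).compInv, fun _ _ => rfl, fun _ _ => rfl, θ.isSmoothPair.comp_inv⟩,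
    RightTwoAction.fundamental_isMorphism hη⟩
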